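/- Let $X$ be a smooth ($T_2$, second countable) manifold, $A=C^\infty(X)$, let $(L,\rho,[\,,])$ be a Lie algebroid on $X$ (a smooth vector bundle of finite rank with anchor $\rho:L\to TX$) and let $E$ be a smooth vector bundle of finite rank on $X$. Write $\mathcal L=\Gamma(X,L)$, $\mathcal E=\Gamma(X,E)$, let $U_L$ be the universal enveloping algebra of the Lie–Rinehart pair $(A,\mathcal L)$, with its cocommutative $A$-coalgebra structure, and let $J_L=\mathrm{Hom}_A(U_L,A)$ be the commutative algebra of jets, with flat $L$-connection $\nabla_x(\varphi)(D)=\rho(x)(\varphi(D))-\varphi(xD)$. Let $\Omega_L=\Lambda_A\mathcal L^\vee$ with Chevalley–Eilenberg differential $d_L$. For a $J_L$-module $N$ write $dR_L(N)=\Omega_L\otimes_A N$, graded by form degree, with the right action $(\omega\otimes n)(\eta\otimes\varphi)=\omega\eta\otimes\varphi n$ of $dR_L(J_L)$; a flat $L$-connection $\nabla$ on $N$ gives the differential $\omega\otimes n\mapsto d_L\omega\otimes n+(-1)^{|\omega|}\omega\wedge\nabla n$. Let $J_L(\mathcal E)$, with projection $p:J_L(\mathcal E)\to\mathcal E$, be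 either (a) $\mathrm{Hom}_A(U_L,\mathcal E)$ with $p(\psi)=\psi(1)$; when $\mathcal E$ carries a flat $L$-connection, $J_L(\mathcal E)$ has the flat $L$-connection $\nabla_x(\psi)(D)=\nabla_x(\psi(D))-\psi(xD)$; or (b) $J_L\otimes_{A}\mathcal E$, where $A\to J_L$ is $a\mapsto(D\mapsto D\cdot a)$, with $p(\varphi\otimes e)=\varphi(1)e$ and the flat $L$-connection $\nabla_x(\varphi\otimes e)=\nabla_x(\varphi)\otimes e$. Then $dR_L(J_L)$ is a commutative dg algebra, and $dR_L(J_L(\mathcal E))$ is a dg module over it, for (b) always and for (a) for every flat $L$-connection on $\mathcal E$. Moreover let $S\subseteq\Omega_L$ be an $A$-subalgebra that is stable under $\omega\mapsto(-1)^{|\omega|}\omega$ (for instance $S=\Omega_L$ or $S=A$), and let $\Omega^\bullet$ be the graded commutative algebra of Kähler forms of $dR_L(J_L)$ relative to $S$, generated by $r$ and $d_{dR}r$ with $d_{dR}r$ of total degree $|r|+1$, $d_{dR}(rs)=r\,d_{dR}s+(-1)^{|s|}(d_{dR}r)s$ and $d_{dR}^2=0$; let $\Omega^k$ be its part with $k$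 factors $d_{dR}r$. In both cases (a) and (b), $A$-linear splittings $\nu:\mathcal E\to J_L(\mathcal E)$ of $p$ exist, and for every such $\nu$ the map $$i_\nu:\mathcal E\otimes_A dR_L(J_L)\to dR_L(J_L(\mathcal E)),\qquad e\otimes r\mapsto(1\otimes\nu(e))\,r$$ is bijective and there is an $A$-linear map $$\widetilde\nabla_\nu:dR_L(J_L(\mathcal E))\to dR_L(J_L(\mathcal E))\otimes_{dR_L(J_L)}\Omega^1$$ which under $i_\nu$ is $1\otimes d_{dR}$, that is, $\widetilde\nabla_\nu(i_\nu(e\otimes r))=(1\otimes\nu(e))\otimes d_{dR}r$; which satisfies the graded Leibniz rule $$\widetilde\nabla_\nu(m\cdot r)=m\otimes d_{dR}r+(-1)^{|r|}\,\widetilde\nabla_\nu(m)\cdot r\qquad(m\in dR_L(J_L(\mathcal E)),\ r\in dR_L(J_L)\text{ homogeneous});$$ and which is flat: its extension $m\otimes\omega\mapsto m\otimes d_{dR}\omega+(-1)^{|\omega|}\widetilde\nabla_\nu(m)\,\omega$ to $dR_L(J_L(\mathcal E))\otimes_{dR_L(J_L)}\Omega^\bullet$ is well defined and squares to $0$. 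-/

import Mathlib

open scoped TensorProduct

namespace LieAlgd

section Enveloping

variable (A L : Type*) [CommRing A] [LieRing L] [Module A L] [LieRingModule L A]

/-- The relations of the universal enveloping algebra `U(A, L)` of a Lie-Rinehart pair. -/
inductive UEnvRel : FreeAlgebra ℤ (A ⊕ L) → FreeAlgebra ℤ (A ⊕ L) → Prop
  | one : UEnvRel (FreeAlgebra.ι ℤ (Sum.inl 1)) 1
  | add_left (a b : A) : UEnvRel (FreeAlgebra.ι ℤ (Sum.inl (a + b)))
      (FreeAlgebra.ι ℤ (Sum.inl a) + FreeAlgebra.ι ℤ (Sum.inl b))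
  | mul_left (a b : A) : UEnvRel (FreeAlgebra.ι ℤ (Sum.inl (a * b)))
      (FreeAlgebra.ι ℤ (Sum.inl a) * FreeAlgebra.ι ℤ (Sum.inl b))
  | add_right (x y : L) : UEnvRel (FreeAlgebra.ι ℤ (Sum.inr (x + y)))
      (FreeAlgebra.ι ℤ (Sum.inr x) + FreeAlgebra.ι ℤ (Sum.inr y))
  | smul (a : A) (x : L) : UEnvRel (FreeAlgebra.ι ℤ (Sum.inr (a • x)))
      (FreeAlgebra.ι ℤ (Sum.inl a) * FreeAlgebra.ι ℤ (Sum.inr x))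
  | lie (x y : L) : UEnvRel
      (FreeAlgebra.ι ℤ (Sum.inr x) * FreeAlgebra.ι ℤ (Sum.inr y))
      (FreeAlgebra.ι ℤ (Sum.inr y) * FreeAlgebra.ι ℤ (Sum.inr x) +
        FreeAlgebra.ι ℤ (Sum.inr ⁅x, y⁆))
  | anchor (x : L) (a : A) : UEnvRel
      (FreeAlgebra.ι ℤ (Sum.inr x) * FreeAlgebra.ι ℤ (Sum.inl a))
      (FreeAlgebra.ι ℤ (Sum.inl a) * FreeAlgebra.ι ℤ (Sum.inr x) +
        FreeAlgebra.ι ℤ (Sum.inl ⁅x, a⁆))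

/-- The universal enveloping algebra `U_L` of the Lie-Rinehart algebra `L` over `A`: generated by
`A` and `L` subject to the relations of the ring `A`, `a · x = a x`, `x y - y x = ⁅x, y⁆` and
`x a - a x = ⁅x, a⁆`. It is an `A`-module by left multiplication. -/
def UEnv : Type _ := RingQuot (UEnvRel A L)

namespace UEnv

noncomputable instance : Ring (UEnv A L) := inferInstanceAs (Ring (RingQuot (UEnvRel A L)))

noncomputable def mk : FreeAlgebra ℤ (A ⊕ L) →+* UEnv A L := RingQuot.mkRingHom (UEnvRel A L)

variable {A L} in
lemma mk_eq {p q : FreeAlgebra ℤ (A ⊕ L)} (h : UEnvRel A L p q) : mk A L p = mk A L q :=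
  RingQuot.mkRingHom_rel h

/-- The canonical map `A → U_L`. -/
noncomputable def inA : A →+* UEnv A L where
  toFun a := mk A L (FreeAlgebra.ι ℤ (Sum.inl a))
  map_one' := by rw [mk_eq .one, map_one]
  map_mul' a b := by rw [mk_eq (.mul_left a b), map_mul]
  map_add' a b := by rw [mk_eq (.add_left a b), map_add]
  map_zero' := by
    have h := mk_eq (UEnvRel.add_left (L := L) (0 : A) 0)
    rw [map_add, add_zero] at h
    exact left_eq_add.mp h

/-- The canonical map `L → U_L`. -/
noncomputable def inL : L →+ UEnv A L :=
  AddMonoidHom.mk' (fun x => mk A L (FreeAlgebra.ι ℤ (Sum.inr x)))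
    (fun x y => by rw [mk_eq (.add_right x y), map_add])

noncomputable instance : Module A (UEnv A L) := Module.compHom _ (inA A L)

variable {A L}

lemma smul_def (a : A) (D : UEnv A L) : a • D = inA A L a * D := rfl

lemma inL_smul (a : A) (x : L) : inL A L (a • x) = a • inL A L x := by
  rw [smul_def]; exact (mk_eq (.smul a x)).trans (map_mul _ _ _)

lemma inL_mul_inL (x y : L) :
    inL A L x * inL A L y = inL A L y * inL A L x + inL A L ⁅x, y⁆ := by
  have h := mk_eq (UEnvRel.lie (A := A) x y)
  rw [map_add, map_mul, map_mul] at h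
  exact h

lemma inL_mul_inA (x : L) (a : A) :
    inL A L x * inA A L a = inA A L a * inL A L x + inA A L ⁅x, a⁆ := by
  have h := mk_eq (UEnvRel.anchor x a)
  rw [map_add, map_mul, map_mul] at h
  exact h

lemma inL_mul_smul (x : L) (a : A) (D : UEnv A L) :
    inL A L x * (a • D) = a • (inL A L x * D) + ⁅x, a⁆ • D := by
  simp only [smul_def, ← mul_assoc, inL_mul_inA, add_mul]

instance : IsScalarTower A (UEnv A L) (UEnv A L) := ⟨fun a D E => by
  simp only [smul_def, smul_eq_mul, mul_assoc]⟩

theorem hom_ext {B : Type*} [Ring B] {f g : UEnv A L →+* B}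
    (hA : ∀ a, f (inA A L a) = g (inA A L a)) (hL : ∀ x, f (inL A L x) = g (inL A L x)) :
    f = g := by
  apply RingQuot.ringQuot_ext
  have : ((f.comp (mk A L)).toIntAlgHom) = ((g.comp (mk A L)).toIntAlgHom) := by
    apply FreeAlgebra.hom_ext
    funext z
    rcases z with a | x
    · exact hA a
    · exact hL x
  exact RingHom.ext fun p => DFunLike.congr_fun this p

@[elab_as_elim]
theorem induction {P : UEnv A L → Prop} (one : P 1) (add : ∀ D E, P D → P E → P (D + E))
    (smul : ∀ (a : A) D, P D → P (a • D)) (inL_mul : ∀ (x : L) D, P D → P (inL A L x * D))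
    (D : UEnv A L) : P D := by
  have hz : P 0 := by simpa using smul 0 1 one
  have key : ∀ p : FreeAlgebra ℤ (A ⊕ L), ∀ D, P D → P (mk A L p * D) := by
    intro p
    induction p using FreeAlgebra.induction with
    | grade0 r =>
      intro D hD
      have : mk A L (algebraMap ℤ _ r) * D = (r : A) • D := by
        rw [smul_def]; simp
      rw [this]
      exact smul _ _ hD
    | grade1 z =>
      intro D hD
      rcases z with a | x
      · exact smul a D hD
      · exact inL_mul x D hD
    | mul p q hp hq => intro D hD; rw [map_mul, mul_assoc]; exact hp _ (hq _ hD)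
    | add p q hp hq => intro D hD; rw [map_add, add_mul]; exact add _ _ (hp _ hD) (hq _ hD)
  obtain ⟨p, rfl⟩ := RingQuot.mkRingHom_surjective (UEnvRel A L) D
  have h := key p 1 one
  rw [mul_one] at h
  exact h

end UEnv

end Enveloping

section Connections

variable (A L : Type*) [CommRing A] [LieRing L] [Module A L] [LieRingModule L A]

/-- A flat `L`-connection on the `A`-module `N`, i.e. a left `U_L`-module structure that extends
the `A`-module structure. -/
structure FlatConn (N : Type*) [AddCommGroup N] [Module A N] where
  nabla : L →+ N →+ N
  smul_left : ∀ (a : A) (x : L) (n : N), nabla (a • x) n = a • nabla x n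
  leibniz : ∀ (x : L) (a : A) (n : N), nabla x (a • n) = a • nabla x n + ⁅x, a⁆ • n
  flat : ∀ (x y : L) (n : N), nabla ⁅x, y⁆ n = nabla x (nabla y n) - nabla y (nabla x n)

namespace FlatConn

variable {A L}
variable {N P : Type*} [AddCommGroup N] [Module A N] [AddCommGroup P] [Module A P]

noncomputable def actFree (c : FlatConn A L N) : FreeAlgebra ℤ (A ⊕ L) →ₐ[ℤ] Module.End ℤ N :=
  FreeAlgebra.lift ℤ (Sum.elim (fun a => (DistribSMul.toAddMonoidHom N a).toIntLinearMap)
    (fun x => (c.nabla x).toIntLinearMap))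

/-- The action of `U_L` given by a flat connection. -/
noncomputable def act (c : FlatConn A L N) : UEnv A L →+* Module.End ℤ N :=
  RingQuot.lift ⟨c.actFree.toRingHom, by
    intro p q h
    cases h <;> ext n <;>
      simp [actFree, add_smul, mul_smul, c.smul_left, c.leibniz, c.flat]⟩

lemma act_inA (c : FlatConn A L N) (a : A) (n : N) : c.act (UEnv.inA A L a) n = a • n := by
  have : c.act (UEnv.inA A L a) = c.actFree (FreeAlgebra.ι ℤ (Sum.inl a)) :=
    RingQuot.lift_mkRingHom_apply _ _ _
  rw [this]; simp [actFree]

lemma act_inL (c : FlatConn A L N) (x : L) (n : N) : c.act (UEnv.inL A L x) n = c.nabla x n := by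
  have : c.act (UEnv.inL A L x) = c.actFree (FreeAlgebra.ι ℤ (Sum.inr x)) :=
    RingQuot.lift_mkRingHom_apply _ _ _
  rw [this]; simp [actFree]

lemma act_smul (c : FlatConn A L N) (a : A) (D : UEnv A L) (n : N) :
    c.act (a • D) n = a • c.act D n := by
  rw [UEnv.smul_def, map_mul, Module.End.mul_apply, act_inA]

lemma act_inL_mul (c : FlatConn A L N) (x : L) (D : UEnv A L) (n : N) :
    c.act (UEnv.inL A L x * D) n = c.nabla x (c.act D n) := by
  rw [map_mul, Module.End.mul_apply, act_inL]

/-- The map `D ↦ D · n`. -/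
noncomputable def orbit (c : FlatConn A L N) (n : N) : UEnv A L →ₗ[A] N where
  toFun D := c.act D n
  map_add' D E := by simp
  map_smul' a D := c.act_smul a D n

lemma map_act {c : FlatConn A L N} {e : FlatConn A L P} (f : N →ₗ[A] P)
    (hf : ∀ x n, f (c.nabla x n) = e.nabla x (f n)) (D : UEnv A L) (n : N) :
    f (c.act D n) = e.act D (f n) := by
  induction D using UEnv.induction with
  | one => simp
  | add D E hD hE => simp [hD, hE]
  | smul a D hD => simp [act_smul, hD]
  | inL_mul x D hD => simp only [act_inL_mul, hf, hD]

variable (A L) in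
/-- The flat connection `∇_x a = ⁅x, a⁆` (the anchor) on `A`. -/
noncomputable def self [LieRinehartRing A L] : FlatConn A L A where
  nabla := AddMonoidHom.mk' (fun x => AddMonoidHom.mk' (fun a => ⁅x, a⁆) (fun a b => lie_add x a b))
    (fun x y => by ext a; simp)
  smul_left a x b := by simp
  leibniz x a b := by simp
  flat x y a := by simp

lemma self_nabla_one [LieRinehartRing A L] (x : L) : (self A L).nabla x 1 = 0 := by
  have h := (self A L).leibniz x 1 1
  rw [smul_eq_mul, one_mul, one_smul] at h
  have h' : (self A L).nabla x 1 = ⁅x, (1 : A)⁆ := rfl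
  rw [smul_eq_mul, mul_one, ← h'] at h
  exact left_eq_add.mp h

variable (A L) in
/-- The flat connection on `U_L` by left multiplication. -/
noncomputable def mulLeft : FlatConn A L (UEnv A L) where
  nabla := AddMonoidHom.mul.comp (UEnv.inL A L)
  smul_left a x D := by
    simp only [AddMonoidHom.comp_apply, AddMonoidHom.mul_apply, UEnv.inL_smul, smul_mul_assoc]
  leibniz x a D := by simp [UEnv.inL_mul_smul]
  flat x y D := by
    simp only [AddMonoidHom.comp_apply, AddMonoidHom.mul_apply, ← mul_assoc]
    rw [UEnv.inL_mul_inL x y, add_mul]; abel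

lemma mulLeft_act (D E : UEnv A L) : (mulLeft A L).act D E = D * E := by
  induction D using UEnv.induction with
  | one => simp
  | add D E hD hE => simp [hD, hE, add_mul]
  | smul a D hD => rw [act_smul, hD, smul_mul_assoc]
  | inL_mul x D hD => rw [act_inL_mul, hD, mul_assoc]; rfl

noncomputable def tensorNabla (c : FlatConn A L N) (e : FlatConn A L P) (x : L) :
    N ⊗[A] P →+ N ⊗[A] P :=
  TensorProduct.liftAddHom
    (AddMonoidHom.mk' (fun n => AddMonoidHom.mk' (fun p => c.nabla x n ⊗ₜ[A] p + n ⊗ₜ e.nabla x p)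
      (fun p q => by simp only [map_add, TensorProduct.tmul_add]; abel))
      (fun m n => by
        ext p
        simp only [map_add, TensorProduct.add_tmul, AddMonoidHom.mk'_apply, AddMonoidHom.add_apply]
        abel))
    (fun a n p => by
      simp only [AddMonoidHom.mk'_apply, c.leibniz, e.leibniz, TensorProduct.add_tmul,
        TensorProduct.tmul_add, TensorProduct.smul_tmul]
      abel)

@[simp] lemma tensorNabla_tmul (c : FlatConn A L N) (e : FlatConn A L P) (x : L) (n : N) (p : P) :
    tensorNabla c e x (n ⊗ₜ p) = c.nabla x n ⊗ₜ[A] p + n ⊗ₜ e.nabla x p := rfl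

/-- The tensor product of flat connections. -/
noncomputable def tensor (c : FlatConn A L N) (e : FlatConn A L P) : FlatConn A L (N ⊗[A] P) where
  nabla := AddMonoidHom.mk' (tensorNabla c e) (fun x y => by
    ext t
    induction t with
    | zero => simp
    | add s t hs ht => rw [map_add, map_add, hs, ht]
    | tmul n p =>
      simp only [tensorNabla_tmul, map_add, AddMonoidHom.add_apply, TensorProduct.add_tmul,
        TensorProduct.tmul_add]
      abel)
  smul_left a x t := by
    induction t with
    | zero => simp
    | add s t hs ht => rw [map_add, map_add, hs, ht, smul_add]
    | tmul n p =>
      simp only [AddMonoidHom.mk'_apply, tensorNabla_tmul, c.smul_left, e.smul_left, smul_add,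
        TensorProduct.smul_tmul', TensorProduct.tmul_smul]
  leibniz x a t := by
    induction t with
    | zero => simp
    | add s t hs ht => simp only [smul_add, map_add, hs, ht]; abel
    | tmul n p =>
      simp only [AddMonoidHom.mk'_apply, tensorNabla_tmul, c.leibniz, TensorProduct.smul_tmul',
        smul_add, TensorProduct.add_tmul]
      abel
  flat x y t := by
    induction t with
    | zero => simp
    | add s t hs ht => simp only [map_add, hs, ht]; abel
    | tmul n p =>
      simp only [AddMonoidHom.mk'_apply, tensorNabla_tmul, c.flat, e.flat, map_add,
        TensorProduct.sub_tmul, TensorProduct.tmul_sub]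
      abel

@[simp] lemma tensor_nabla_tmul (c : FlatConn A L N) (e : FlatConn A L P) (x : L) (n : N) (p : P) :
    (tensor c e).nabla x (n ⊗ₜ p) = c.nabla x n ⊗ₜ[A] p + n ⊗ₜ e.nabla x p := rfl

end FlatConn

namespace UEnv

variable {A L}

/-- Two linear maps out of `U` that intertwine the connections and agree at `1` are equal. -/
lemma linearMap_ext {P : Type*} [AddCommGroup P] [Module A P] (e : FlatConn A L P)
    {f g : UEnv A L →ₗ[A] P} (hf : ∀ x D, f (inL A L x * D) = e.nabla x (f D))
    (hg : ∀ x D, g (inL A L x * D) = e.nabla x (g D)) (h1 : f 1 = g 1) : f = g := by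
  ext D
  induction D using UEnv.induction with
  | one => exact h1
  | add D E hD hE => simp [hD, hE]
  | smul a D hD => simp [hD]
  | inL_mul x D hD => rw [hf, hg, hD]

lemma map_nabla {N P : Type*} [AddCommGroup N] [Module A N] [AddCommGroup P] [Module A P]
    {N' P' : Type*} [AddCommGroup N'] [Module A N'] [AddCommGroup P'] [Module A P']
    {c : FlatConn A L N} {e : FlatConn A L P} {c' : FlatConn A L N'} {e' : FlatConn A L P'}
    (f : N →ₗ[A] N') (g : P →ₗ[A] P') (hf : ∀ x n, f (c.nabla x n) = c'.nabla x (f n))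
    (hg : ∀ x n, g (e.nabla x n) = e'.nabla x (g n)) (x : L) (t : N ⊗[A] P) :
    TensorProduct.map f g ((c.tensor e).nabla x t) =
      (c'.tensor e').nabla x (TensorProduct.map f g t) := by
  induction t with
  | zero => simp
  | add s t hs ht => simp only [map_add, hs, ht]
  | tmul n p => simp [hf, hg]

end UEnv

end Connections

section Coalg

variable (A L : Type*) [CommRing A] [LieRing L] [Module A L] [LieRingModule L A]
  [LieRinehartRing A L]

namespace UEnv

/-- The comultiplication is `Δ(D) = D · (1 ⊗ 1)` and the counit is `ε(D) = D · 1`, so that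
`Δ(x) = x ⊗ 1 + 1 ⊗ x` for `x` in `L`. -/
noncomputable instance : CoalgebraStruct A (UEnv A L) where
  comul := ((FlatConn.mulLeft A L).tensor (FlatConn.mulLeft A L)).orbit (1 ⊗ₜ 1)
  counit := (FlatConn.self A L).orbit 1

variable {A L}

lemma counit_apply (D : UEnv A L) :
    Coalgebra.counit (R := A) D = (FlatConn.self A L).act D 1 := rfl

lemma comul_apply (D : UEnv A L) :
    Coalgebra.comul (R := A) D =
      ((FlatConn.mulLeft A L).tensor (FlatConn.mulLeft A L)).act D (1 ⊗ₜ 1) := rfl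

@[simp] lemma counit_one : Coalgebra.counit (R := A) (1 : UEnv A L) = 1 := by
  simp [counit_apply]

@[simp] lemma comul_one : Coalgebra.comul (R := A) (1 : UEnv A L) = 1 ⊗ₜ 1 := by
  simp [comul_apply]

lemma counit_inL_mul (x : L) (D : UEnv A L) :
    Coalgebra.counit (R := A) (inL A L x * D) = ⁅x, Coalgebra.counit (R := A) D⁆ := by
  rw [counit_apply, FlatConn.act_inL_mul]; rfl

lemma comul_inL_mul (x : L) (D : UEnv A L) :
    Coalgebra.comul (R := A) (inL A L x * D) =
      ((FlatConn.mulLeft A L).tensor (FlatConn.mulLeft A L)).nabla x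
        (Coalgebra.comul (R := A) D) := by
  rw [comul_apply, FlatConn.act_inL_mul]; rfl

lemma comul_nabla (x : L) (D : UEnv A L) :
    Coalgebra.comul (R := A) ((FlatConn.mulLeft A L).nabla x D) =
      ((FlatConn.mulLeft A L).tensor (FlatConn.mulLeft A L)).nabla x
        (Coalgebra.comul (R := A) D) := comul_inL_mul x D

lemma counit_nabla (x : L) (D : UEnv A L) :
    Coalgebra.counit (R := A) ((FlatConn.mulLeft A L).nabla x D) =
      (FlatConn.self A L).nabla x (Coalgebra.counit (R := A) D) := counit_inL_mul x D

noncomputable instance : Coalgebra A (UEnv A L) where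
  coassoc := by
    refine linearMap_ext ((FlatConn.mulLeft A L).tensor
      ((FlatConn.mulLeft A L).tensor (FlatConn.mulLeft A L))) (fun x D => ?_) (fun x D => ?_) ?_
    · simp only [LinearMap.comp_apply, comul_inL_mul]
      rw [LinearMap.rTensor, map_nabla (c' := (FlatConn.mulLeft A L).tensor (FlatConn.mulLeft A L))
        (e' := FlatConn.mulLeft A L) _ _ comul_nabla (fun _ _ => rfl)]
      generalize (TensorProduct.map (Coalgebra.comul (R := A)) (LinearMap.id (R := A)
        (M := UEnv A L))) (Coalgebra.comul (R := A) D) = t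
      induction t with
      | zero => simp
      | add s t hs ht => simp only [map_add, hs, ht]
      | tmul s p =>
        induction s with
        | zero => simp
        | add s t hs ht => simp only [map_add, TensorProduct.add_tmul, hs, ht]
        | tmul m n =>
          simp [TensorProduct.add_tmul, TensorProduct.tmul_add, add_assoc]
    · simp only [LinearMap.comp_apply, comul_inL_mul]
      rw [LinearMap.lTensor, map_nabla (c' := FlatConn.mulLeft A L)
        (e' := (FlatConn.mulLeft A L).tensor (FlatConn.mulLeft A L)) _ _ (fun _ _ => rfl)
          comul_nabla]
    · simp
  rTensor_counit_comp_comul := by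
    refine linearMap_ext ((FlatConn.self A L).tensor (FlatConn.mulLeft A L)) (fun x D => ?_)
      (fun x D => ?_) ?_
    · simp only [LinearMap.comp_apply, comul_inL_mul]
      rw [LinearMap.rTensor, map_nabla (c' := FlatConn.self A L)
        (e' := FlatConn.mulLeft A L) _ _ counit_nabla (fun _ _ => rfl)]
    · simp only [TensorProduct.mk_apply, FlatConn.tensor_nabla_tmul]
      rw [FlatConn.self_nabla_one, TensorProduct.zero_tmul, zero_add]; rfl
    · simp
  lTensor_counit_comp_comul := by
    refine linearMap_ext ((FlatConn.mulLeft A L).tensor (FlatConn.self A L)) (fun x D => ?_)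
      (fun x D => ?_) ?_
    · simp only [LinearMap.comp_apply, comul_inL_mul]
      rw [LinearMap.lTensor, map_nabla (c' := FlatConn.mulLeft A L)
        (e' := FlatConn.self A L) _ _ (fun _ _ => rfl) counit_nabla]
    · simp only [LinearMap.flip_apply, TensorProduct.mk_apply, FlatConn.tensor_nabla_tmul]
      rw [FlatConn.self_nabla_one, TensorProduct.tmul_zero, add_zero]; rfl
    · simp

instance : Coalgebra.IsCocomm A (UEnv A L) where
  comm_comp_comul := by
    refine linearMap_ext ((FlatConn.mulLeft A L).tensor (FlatConn.mulLeft A L)) (fun x D => ?_)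
      (fun x D => comul_inL_mul x D) (by simp)
    simp only [LinearMap.comp_apply, comul_inL_mul]
    generalize Coalgebra.comul (R := A) D = t
    induction t with
    | zero => simp
    | add s t hs ht => simp only [map_add, hs, ht]
    | tmul m n => simp [add_comm]

end UEnv
end Coalg

section Jets

variable (A L : Type*) [CommRing A] [LieRing L] [Module A L] [LieRingModule L A]
  [LieRinehartRing A L]

/-- The algebra of jets `J_L = Hom_A(U_L, A)`, with the convolution product dual to the
comultiplication of `U_L`. -/
abbrev Jet : Type _ := WithConv (UEnv A L →ₗ[A] A)

namespace Jet

noncomputable instance : CommRing (Jet A L) := LinearMap.convCommRing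

noncomputable instance : Algebra A (Jet A L) := LinearMap.convAlgebra

variable {A L}

lemma mul_apply (φ ψ : Jet A L) (D : UEnv A L) :
    (φ * ψ) D = LinearMap.mul' A A (TensorProduct.map φ.ofConv ψ.ofConv (Coalgebra.comul D)) := rfl

lemma algebraMap_apply (a : A) (D : UEnv A L) :
    algebraMap A (Jet A L) a D = Coalgebra.counit D * a := by
  rw [mul_comm]; rfl

variable (A L)

/-- The jet `j(a) : D ↦ D · a` of a function, `J_L` being an `A`-algebra in a second way by it. -/
noncomputable def taylor : A →+* Jet A L where
  toFun a := WithConv.toConv ((FlatConn.self A L).orbit a)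
  map_zero' := by ext D; exact map_zero ((FlatConn.self A L).act D)
  map_add' a b := by ext D; exact map_add ((FlatConn.self A L).act D) a b
  map_one' := by ext D; simp [UEnv.counit_apply]; rfl
  map_mul' a b := by
    apply WithConv.ofConv_injective
    refine UEnv.linearMap_ext (FlatConn.self A L) (fun x D => FlatConn.act_inL_mul _ x D _) ?_ ?_
    · intro x D
      change LinearMap.mul' A A (TensorProduct.map _ _ (Coalgebra.comul _)) =
        (FlatConn.self A L).nabla x (LinearMap.mul' A A (TensorProduct.map _ _ (Coalgebra.comul _)))
      rw [UEnv.comul_inL_mul, UEnv.map_nabla (c' := FlatConn.self A L) (e' := FlatConn.self A L) _ _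
        (fun x D => FlatConn.act_inL_mul _ x D _) (fun x D => FlatConn.act_inL_mul _ x D _)]
      generalize (TensorProduct.map ((FlatConn.self A L).orbit a) ((FlatConn.self A L).orbit b))
        (Coalgebra.comul D) = t
      induction t with
      | zero => simp
      | add s t hs ht => simp only [map_add] at hs ht ⊢; rw [hs, ht]
      | tmul m n =>
        have := (FlatConn.self A L).leibniz x m n
        simp only [FlatConn.tensor_nabla_tmul, map_add, LinearMap.mul'_apply]
        simp only [smul_eq_mul] at this
        rw [this, add_comm]; rfl
    · change _ = LinearMap.mul' A A (TensorProduct.map _ _ (Coalgebra.comul _))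
      simp [FlatConn.orbit]

end Jet

end Jets

section JetModules

variable (A L : Type*) [CommRing A] [LieRing L] [Module A L] [LieRingModule L A]
  (E : Type*) [AddCommGroup E] [Module A E]

/-- The jets `J_L(E) = Hom_A(U_L, E)` with values in the `A`-module `E`. -/
abbrev JetHom : Type _ := UEnv A L →ₗ[A] E

variable [LieRinehartRing A L]

namespace JetHom

variable {A L E}

/-- The bilinear map `φ, ψ ↦ (D ↦ ∑ φ(D₁) ψ(D₂))`. -/
noncomputable def conv (φ : Jet A L) (ψ : JetHom A L E) : JetHom A L E :=
  (TensorProduct.lid A E).toLinearMap ∘ₗ TensorProduct.map φ.ofConv ψ ∘ₗ Coalgebra.comul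

lemma conv_apply (φ : Jet A L) (ψ : JetHom A L E) (D : UEnv A L) :
    conv φ ψ D = TensorProduct.lid A E (TensorProduct.map φ.ofConv ψ (Coalgebra.comul D)) := rfl

lemma one_conv (ψ : JetHom A L E) : conv 1 ψ = ψ := by
  ext D
  have h := congrArg (fun t => TensorProduct.lid A E (LinearMap.lTensor A ψ t))
    (Coalgebra.rTensor_counit_comul (R := A) D)
  simp only [LinearMap.lTensor_tmul, TensorProduct.lid_tmul, one_smul] at h
  rw [← LinearMap.comp_apply, LinearMap.lTensor_comp_rTensor] at h
  exact h

lemma mul_conv (φ χ : Jet A L) (ψ : JetHom A L E) : conv (φ * χ) ψ = conv φ (conv χ ψ) := by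
  ext D
  have h := congrArg (fun t => TensorProduct.lid A E (TensorProduct.map φ.ofConv
    ((TensorProduct.lid A E).toLinearMap ∘ₗ TensorProduct.map χ.ofConv ψ) t))
    (Coalgebra.coassoc_apply (R := A) D)
  refine Eq.trans ?_ (h.trans ?_)
  · rw [conv_apply]
    generalize (Coalgebra.comul D : UEnv A L ⊗[A] UEnv A L) = t
    induction t with
    | zero => simp
    | add s t hs ht => simp only [map_add] at hs ht ⊢; rw [hs, ht]
    | tmul m n =>
      simp only [TensorProduct.map_tmul, TensorProduct.lid_tmul, LinearMap.rTensor_tmul]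
      rw [Jet.mul_apply]
      generalize (Coalgebra.comul m : UEnv A L ⊗[A] UEnv A L) = t
      induction t with
      | zero => simp
      | add s t hs ht =>
        simp only [map_add, add_smul, TensorProduct.add_tmul] at hs ht ⊢; rw [hs, ht]
      | tmul p q => simp [mul_smul, smul_comm (φ.ofConv p) (χ.ofConv q)]
  · rw [conv_apply]
    simp only [LinearMap.lTensor]
    rw [← LinearMap.comp_apply (TensorProduct.map φ.ofConv _), ← TensorProduct.map_comp]
    rfl

noncomputable instance : Module (Jet A L) (JetHom A L E) where
  smul := conv
  one_smul := one_conv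
  mul_smul := mul_conv
  smul_zero φ := by
    change conv φ 0 = 0
    simp [conv]
  smul_add φ ψ χ := by
    change conv φ (ψ + χ) = conv φ ψ + conv φ χ
    simp [conv, TensorProduct.map_add_right, LinearMap.add_comp, LinearMap.comp_add]
  add_smul φ χ ψ := by
    change conv (φ + χ) ψ = conv φ ψ + conv χ ψ
    simp [conv, TensorProduct.map_add_left, LinearMap.add_comp, LinearMap.comp_add]
  zero_smul ψ := by
    change conv 0 ψ = 0
    simp [conv]

lemma smul_def (φ : Jet A L) (ψ : JetHom A L E) : φ • ψ = conv φ ψ := rfl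

instance : IsScalarTower A (Jet A L) (JetHom A L E) := ⟨fun a φ ψ => by
  rw [smul_def, smul_def]
  simp [conv, TensorProduct.map_smul_left, LinearMap.smul_comp, LinearMap.comp_smul]⟩

variable (A L E)

/-- The projection `J_L(E) → E`, `ψ ↦ ψ(1)`. -/
noncomputable def proj : JetHom A L E →ₗ[A] E := LinearMap.applyₗ (1 : UEnv A L)

end JetHom

namespace FlatConn

variable {A L E}

/-- `∇_x(φ)(D) = x · φ(D) - φ(x D)`. -/
noncomputable def jetNabla (c : FlatConn A L E) (x : L) (φ : JetHom A L E) : JetHom A L E where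
  toFun D := c.nabla x (φ D) - φ (UEnv.inL A L x * D)
  map_add' D D' := by simp only [mul_add, map_add]; abel
  map_smul' a D := by
    simp only [UEnv.inL_mul_smul, map_add, map_smul, c.leibniz, RingHom.id_apply, smul_sub]; abel

/-- The canonical flat connection on `Hom_A(U_L, E)` for an `E` with a flat `L`-connection. -/
noncomputable def jetHom (c : FlatConn A L E) : FlatConn A L (JetHom A L E) where
  nabla := AddMonoidHom.mk' (fun x => AddMonoidHom.mk' (c.jetNabla x)
      (fun φ ψ => by ext D; simp only [jetNabla, map_add, LinearMap.add_apply, LinearMap.coe_mk,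
        AddHom.coe_mk]; abel))
      (fun x y => by ext φ D; simp only [jetNabla, map_add, LinearMap.add_apply, LinearMap.coe_mk,
        AddHom.coe_mk, AddMonoidHom.mk'_apply, AddMonoidHom.add_apply, add_mul]; abel)
  smul_left a x φ := by
    ext D
    simp [jetNabla, c.smul_left, UEnv.inL_smul, smul_sub, smul_mul_assoc]
  leibniz x a φ := by
    ext D
    simp only [jetNabla, AddMonoidHom.mk'_apply, LinearMap.coe_mk, AddHom.coe_mk,
      LinearMap.smul_apply, LinearMap.add_apply, c.leibniz, smul_sub]
    abel
  flat x y φ := by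
    ext D
    have h := UEnv.inL_mul_inL (A := A) x y
    rw [← sub_eq_iff_eq_add'] at h
    simp only [jetNabla, AddMonoidHom.mk'_apply, LinearMap.coe_mk, AddHom.coe_mk,
      LinearMap.sub_apply, c.flat, map_sub, ← h, sub_mul, mul_assoc]
    abel

variable (A L) in
/-- The canonical flat connection `∇_x(φ)(D) = ρ(x)(φ(D)) - φ(x D)` on `J_L`. -/
noncomputable def jet : FlatConn A L (Jet A L) where
  nabla := AddMonoidHom.mk' (fun x => AddMonoidHom.mk'
      (fun φ => WithConv.toConv ((self A L).jetHom.nabla x φ.ofConv))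
      (fun φ ψ => congrArg WithConv.toConv (map_add ((self A L).jetHom.nabla x) _ _)))
      (fun x y => by ext φ : 1; exact congrArg (fun f => WithConv.toConv (f φ.ofConv)) (map_add (self A L).jetHom.nabla x y))
  smul_left a x φ := congrArg WithConv.toConv ((self A L).jetHom.smul_left a x φ.ofConv)
  leibniz x a φ := congrArg WithConv.toConv ((self A L).jetHom.leibniz x a φ.ofConv)
  flat x y φ := congrArg WithConv.toConv ((self A L).jetHom.flat x y φ.ofConv)

lemma jet_apply (x : L) (φ : Jet A L) (D : UEnv A L) :
    (jet A L).nabla x φ D = ⁅x, φ D⁆ - φ (UEnv.inL A L x * D) := rfl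

lemma jet_taylor (x : L) (a : A) : (jet A L).nabla x (Jet.taylor A L a) = 0 := by
  ext D
  change ⁅x, (self A L).act D a⁆ - (self A L).act (UEnv.inL A L x * D) a = 0
  rw [act_inL_mul]; exact sub_self _

lemma jet_mul (x : L) (φ ψ : Jet A L) :
    (jet A L).nabla x (φ * ψ) = (jet A L).nabla x φ * ψ + φ * (jet A L).nabla x ψ := by
  ext D
  change ⁅x, (φ * ψ) D⁆ - (φ * ψ) (UEnv.inL A L x * D) =
    ((jet A L).nabla x φ * ψ) D + (φ * (jet A L).nabla x ψ) D
  simp only [Jet.mul_apply, UEnv.comul_inL_mul]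
  generalize (Coalgebra.comul D : UEnv A L ⊗[A] UEnv A L) = t
  induction t with
  | zero => simp
  | add s t hs ht =>
    simp only [map_add, lie_add] at hs ht ⊢
    rw [add_sub_add_comm, hs, ht]; abel
  | tmul m n =>
    simp only [tensor_nabla_tmul, map_add, TensorProduct.map_tmul, LinearMap.mul'_apply,
      LieRinehartRing.leibniz_mul_right, jet_apply, smul_eq_mul]
    have h : ∀ m, (mulLeft A L).nabla x m = UEnv.inL A L x * m := fun _ => rfl
    rw [h, h]
    ring

end FlatConn

/-- `J_L` regarded as an `A`-module through `a ↦ j(a)`. -/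
def JetTaylor : Type _ := Jet A L

namespace JetTaylor

noncomputable instance : AddCommGroup (JetTaylor A L) := inferInstanceAs (AddCommGroup (Jet A L))
noncomputable instance : Module (Jet A L) (JetTaylor A L) :=
  inferInstanceAs (Module (Jet A L) (Jet A L))
noncomputable instance : Module A (JetTaylor A L) :=
  Module.compHom (Jet A L) (Jet.taylor A L)

variable {A L}

lemma smul_def (a : A) (φ : JetTaylor A L) : a • φ = Jet.taylor A L a • φ := rfl

instance : SMulCommClass A (Jet A L) (JetTaylor A L) := ⟨fun a φ ψ => by
  rw [smul_def, smul_def, smul_smul, smul_smul, mul_comm]⟩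

end JetTaylor

/-- The jets of sections of `E`, `J_L ⊗_A E` with `j(a) φ ⊗ e = φ ⊗ a e`. This carries a flat
`L`-connection without any connection on `E`. It is an `A`-module through `a φ ⊗ e`. -/
def JetHol : Type _ := JetTaylor A L ⊗[A] E

namespace JetHol

noncomputable instance : AddCommGroup (JetHol A L E) :=
  inferInstanceAs (AddCommGroup (JetTaylor A L ⊗[A] E))
noncomputable instance : Module (Jet A L) (JetHol A L E) :=
  inferInstanceAs (Module (Jet A L) (JetTaylor A L ⊗[A] E))
noncomputable instance : Module A (JetHol A L E) :=
  Module.compHom _ (algebraMap A (Jet A L))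
instance : IsScalarTower A (Jet A L) (JetHol A L E) := ⟨fun a φ ψ => by
  rw [Algebra.smul_def, mul_smul]; rfl⟩

variable {A L E}

/-- The element `φ ⊗ e`. -/
noncomputable def tmul (φ : Jet A L) (e : E) : JetHol A L E :=
  TensorProduct.tmul A (show JetTaylor A L from φ) e

lemma taylor_mul_tmul (a : A) (φ : Jet A L) (e : E) :
  tmul (Jet.taylor A L a * φ) e = tmul φ (a • e) := TensorProduct.smul_tmul (R := A) a (show JetTaylor A L from φ) e

lemma add_tmul (φ ψ : Jet A L) (e : E) : tmul (φ + ψ) e = tmul φ e + tmul ψ e :=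
  TensorProduct.add_tmul (R := A) (show JetTaylor A L from φ) (show JetTaylor A L from ψ) e
lemma tmul_add (φ : Jet A L) (e f : E) : tmul φ (e + f) = tmul φ e + tmul φ f :=
  TensorProduct.tmul_add (R := A) (show JetTaylor A L from φ) e f
lemma smul_tmul (φ ψ : Jet A L) (e : E) : φ • tmul ψ e = tmul (φ * ψ) e := rfl
lemma smul_tmul' (a : A) (ψ : Jet A L) (e : E) : a • tmul ψ e = tmul (a • ψ) e := by
  rw [Algebra.smul_def]; rfl

/-- The universal property of `J_L ⊗_A E`. -/
noncomputable def liftAdd {P : Type*} [AddCommMonoid P] (f : Jet A L →+ E →+ P)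
    (hf : ∀ a φ e, f (Jet.taylor A L a * φ) e = f φ (a • e)) : JetHol A L E →+ P :=
  TensorProduct.liftAddHom (R := A) (M := JetTaylor A L) (N := E) f hf

@[simp] lemma liftAdd_tmul {P : Type*} [AddCommMonoid P] (f : Jet A L →+ E →+ P)
    (hf : ∀ a φ e, f (Jet.taylor A L a * φ) e = f φ (a • e)) (φ : Jet A L) (e : E) :
    liftAdd f hf (tmul φ e) = f φ e := rfl

theorem induction {P : JetHol A L E → Prop} (add : ∀ s t, P s → P t → P (s + t))
    (tmul : ∀ φ e, P (JetHol.tmul φ e)) (t : JetHol A L E) : P t := by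
  refine TensorProduct.induction_on (R := A) (M := JetTaylor A L) (N := E)
    (motive := P) t ?_ tmul add
  have h := tmul 0 0
  have h0 : JetHol.tmul (0 : Jet A L) (0 : E) = 0 := TensorProduct.tmul_zero _ _
  rwa [h0] at h

variable (A L E)

/-- The projection `φ ⊗ e ↦ φ(1) e`. -/
noncomputable def proj : JetHol A L E →ₗ[A] E where
  toFun := liftAdd (AddMonoidHom.mk' (fun φ => AddMonoidHom.mk' (fun e => φ 1 • e)
      (fun e f => smul_add _ e f)) (fun φ ψ => by ext e; exact add_smul (φ 1) (ψ 1) e))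
    (fun a φ e => by
      change (Jet.taylor A L a * φ) 1 • e = φ 1 • (a • e)
      rw [Jet.mul_apply, UEnv.comul_one, smul_smul]
      simp [Jet.taylor, FlatConn.orbit, mul_comm])
  map_add' := map_add _
  map_smul' a t := by
    induction t using induction with
    | add s t hs ht => rw [smul_add, map_add, map_add, hs, ht, smul_add]
    | tmul φ e =>
      rw [smul_tmul']
      exact mul_smul a (φ 1) e

end JetHol

namespace FlatConn

variable {A L E}

/-- `∇_x(φ ⊗ e) = ∇_x(φ) ⊗ e`. -/
noncomputable def holNabla (x : L) : JetHol A L E →+ JetHol A L E :=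
  JetHol.liftAdd
    (AddMonoidHom.mk' (fun φ => AddMonoidHom.mk' (fun e => JetHol.tmul ((jet A L).nabla x φ) e)
      (JetHol.tmul_add _)) (fun φ ψ => AddMonoidHom.ext fun e =>
        (congrArg (JetHol.tmul · e) (map_add ((jet A L).nabla x) φ ψ)).trans
          (JetHol.add_tmul _ _ e)))
    (fun a φ e => by
      simp only [AddMonoidHom.mk'_apply]
      rw [jet_mul, jet_taylor, zero_mul, zero_add, JetHol.taylor_mul_tmul])

lemma holNabla_tmul (x : L) (φ : Jet A L) (e : E) :
    holNabla x (JetHol.tmul φ e) = JetHol.tmul ((jet A L).nabla x φ) e := rfl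

variable (A L E)

/-- The canonical flat connection `∇_x(φ ⊗ e) = ∇_x(φ) ⊗ e`. -/
noncomputable def jetHol : FlatConn A L (JetHol A L E) where
  nabla := AddMonoidHom.mk' holNabla (fun x y => by
    ext t
    rw [AddMonoidHom.add_apply]
    induction t using JetHol.induction with
    | add s t hs ht => simp only [map_add, hs, ht]; abel
    | tmul φ e =>
      simp only [holNabla_tmul, map_add, AddMonoidHom.add_apply, JetHol.add_tmul])
  smul_left a x t := by
    simp only [AddMonoidHom.mk'_apply]
    induction t using JetHol.induction with
    | add s t hs ht => rw [map_add, map_add, hs, ht, smul_add]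
    | tmul φ e => rw [holNabla_tmul, holNabla_tmul, JetHol.smul_tmul', (jet A L).smul_left]
  leibniz x a t := by
    rw [AddMonoidHom.mk'_apply]
    induction t using JetHol.induction with
    | add s t hs ht => simp only [smul_add, map_add, hs, ht]; abel
    | tmul φ e =>
      rw [JetHol.smul_tmul', holNabla_tmul, (jet A L).leibniz, JetHol.add_tmul, holNabla_tmul,
        JetHol.smul_tmul', JetHol.smul_tmul']
  flat x y t := by
    simp only [AddMonoidHom.mk'_apply]
    induction t using JetHol.induction with
    | add s t hs ht => simp only [map_add, hs, ht]; abel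
    | tmul φ e =>
      simp only [holNabla_tmul, (jet A L).flat]
      rw [eq_sub_iff_add_eq, ← JetHol.add_tmul, sub_add_cancel]

end FlatConn

end JetModules

section OddExtension

variable {A R : Type*} [CommRing A] [Ring R] [Algebra A R]

/-- Pairs `(x, x')` with multiplication `(x, x') (y, y') = (x y, l(x) y' + x' r(y))`. -/
@[ext] structure OddExt (l r : R →ₐ[A] R) where
  re : R
  im : R

namespace OddExt

variable {l r : R →ₐ[A] R}

def equivProd : OddExt l r ≃ R × R := ⟨fun x => (x.re, x.im), fun x => ⟨x.1, x.2⟩, fun _ => rfl,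
  fun _ => rfl⟩

instance : AddCommGroup (OddExt l r) := equivProd.addCommGroup
instance : One (OddExt l r) := ⟨⟨1, 0⟩⟩
instance : Mul (OddExt l r) := ⟨fun x y => ⟨x.re * y.re, l x.re * y.im + x.im * r y.re⟩⟩

@[simp] lemma re_zero : (0 : OddExt l r).re = 0 := rfl
@[simp] lemma im_zero : (0 : OddExt l r).im = 0 := rfl
@[simp] lemma re_one : (1 : OddExt l r).re = 1 := rfl
@[simp] lemma im_one : (1 : OddExt l r).im = 0 := rfl
@[simp] lemma re_add (x y : OddExt l r) : (x + y).re = x.re + y.re := rfl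
@[simp] lemma im_add (x y : OddExt l r) : (x + y).im = x.im + y.im := rfl
@[simp] lemma re_neg (x : OddExt l r) : (-x).re = -x.re := rfl
@[simp] lemma im_neg (x : OddExt l r) : (-x).im = -x.im := rfl
@[simp] lemma re_mul (x y : OddExt l r) : (x * y).re = x.re * y.re := rfl
@[simp] lemma im_mul (x y : OddExt l r) : (x * y).im = l x.re * y.im + x.im * r y.re := rfl

instance : Ring (OddExt l r) where
  left_distrib x y z := by ext <;> simp [mul_add]; abel
  right_distrib x y z := by ext <;> simp [add_mul]; abel
  zero_mul x := by ext <;> simp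
  mul_zero x := by ext <;> simp
  mul_assoc x y z := by ext <;> simp [mul_assoc, mul_add, add_mul, add_assoc]
  one_mul x := by ext <;> simp
  mul_one x := by ext <;> simp
  neg_add_cancel x := by ext <;> simp
  sub_eq_add_neg x y := by ext <;> exact sub_eq_add_neg _ _
  zsmul := zsmulRec

/-- The algebra structure `a ↦ (a, δ a)` for a derivation `δ` that is central in the odd sense. -/
@[reducible] def algebraOf (l r : R →ₐ[A] R) (δ : A →+ R)
    (hmul : ∀ a b, δ (a * b) = a • δ b + b • δ a)
    (hcomm : ∀ a x, δ a * r x = l x * δ a) : Algebra A (OddExt l r) :=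
  RingHom.toAlgebra'
    { toFun := fun a => ⟨algebraMap A R a, δ a⟩
      map_one' := by
        ext
        · simp
        · have h := hmul 1 1
          simp only [mul_one, one_smul] at h
          simpa using left_eq_add.mp h
      map_mul' := fun a b => by
        ext
        · simp
        · simp [hmul, Algebra.smul_def, Algebra.commutes b (δ a)]
      map_zero' := by ext <;> simp
      map_add' := fun a b => by ext <;> simp }
    (fun a x => by
      ext
      · exact Algebra.commutes a x.re
      · simp [hcomm, Algebra.commutes a x.im, add_comm])

end OddExt

end OddExtension

section Forms

variable (A L : Type*) [CommRing A] [LieRing L] [Module A L]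

/-- `Ω_L = Λ L^∨`. -/
abbrev Forms : Type _ := ExteriorAlgebra A (Module.Dual A L)

namespace Forms

variable {A L}

/-- The automorphism `ω ↦ (-1)^{|ω|} ω`. -/
noncomputable def parity : Forms A L →ₐ[A] Forms A L := CliffordAlgebra.involute

@[simp] lemma parity_ι (α : Module.Dual A L) : parity (ExteriorAlgebra.ι A α) = -ExteriorAlgebra.ι A α :=
  CliffordAlgebra.involute_ι α

/-- Contraction with `x`, acting on the first slot. -/
noncomputable def contract (x : L) : Forms A L →ₗ[A] Forms A L :=
  CliffordAlgebra.contractLeft (Q := (0 : QuadraticForm A (Module.Dual A L)))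
    (Module.Dual.eval A L x)

lemma ι_mul_eq (α : Module.Dual A L) (ω : Forms A L) :
    ExteriorAlgebra.ι A α * ω = parity ω * ExteriorAlgebra.ι A α := by
  induction ω using ExteriorAlgebra.induction with
  | algebraMap r => rw [AlgHom.commutes, Algebra.commutes]
  | ι x =>
    rw [parity_ι, neg_mul, eq_neg_iff_add_eq_zero, ExteriorAlgebra.ι_add_mul_swap]
  | mul a b ha hb => rw [map_mul, ← mul_assoc, ha, mul_assoc, hb, mul_assoc]
  | add a b ha hb => rw [map_add, mul_add, add_mul, ha, hb]

variable (A L)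

/-- A finite family `b_i` in `L` and `β_i` in the dual of `L`. -/
structure Family where
  card : ℕ
  frame : Fin card → L
  coframe : Fin card → Module.Dual A L

variable {A L} in
/-- `x = ∑ β_i(x) b_i` for all `x`: the family is a dual basis. -/
def Family.IsDual (F : Family A L) : Prop := ∀ x, ∑ i, F.coframe i x • F.frame i = x

open Classical in
/-- A chosen dual basis of the finitely generated projective module `L` (the empty family
if there is no dual basis, which does not happen for modules of sections of vector bundles). -/
noncomputable def dualBasis : Family A L :=
  if h : ∃ F : Family A L, F.IsDual then h.choose else ⟨0, fun _ => 0, fun _ => 0⟩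

lemma dualBasis_isDual_or : (dualBasis A L).IsDual ∨ (dualBasis A L).card = 0 := by
  by_cases h : ∃ F : Family A L, F.IsDual
  · left; rw [dualBasis, dif_pos h]; exact h.choose_spec
  · right; rw [dualBasis, dif_neg h]

noncomputable def frame (i : Fin (dualBasis A L).card) : L := (dualBasis A L).frame i
noncomputable def coframe (i : Fin (dualBasis A L).card) : Module.Dual A L :=
  (dualBasis A L).coframe i

variable {A L}

lemma sum_smul_coframe (h : (dualBasis A L).IsDual) (α : Module.Dual A L) :
    ∑ i, α (frame A L i) • coframe A L i = α := by
  ext x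
  conv_rhs => rw [← h x]
  simp [mul_comm, frame, coframe]

variable [LieRingModule L A]

/-- `d_L a = ∑ ⁅b_i, a⁆ β_i`, i.e. `(d_L a)(x) = ⁅x, a⁆`. -/
noncomputable def dFun : A →+ Forms A L :=
  AddMonoidHom.mk' (fun a => ∑ i, ⁅frame A L i, a⁆ • ExteriorAlgebra.ι A (coframe A L i))
    (fun a b => by simp [add_smul, Finset.sum_add_distrib])

lemma dFun_mul [LieRinehartRing A L] (a b : A) : dFun (L := L) (a * b) = a • dFun b + b • dFun a := by
  simp only [dFun, AddMonoidHom.mk'_apply, LieRinehartRing.leibniz_mul_right, add_smul,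
    Finset.sum_add_distrib, Finset.smul_sum, smul_smul, smul_eq_mul]
  simp only [mul_comm]

lemma dFun_comm (a : A) (ω : Forms A L) : dFun a * ω = parity ω * dFun a := by
  simp only [dFun, AddMonoidHom.mk'_apply, Finset.sum_mul, Finset.mul_sum, smul_mul_assoc,
    mul_smul_comm, ι_mul_eq]

variable [LieRinehartRing A L]

variable (A L) in
/-- Pairs `(ω, ω')` in which `ω'` stands for `d_L ω`. -/
abbrev DExt : Type _ := OddExt (parity (A := A) (L := L)) (AlgHom.id A (Forms A L))

noncomputable instance : Algebra A (DExt A L) :=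
  OddExt.algebraOf parity (AlgHom.id A _) dFun dFun_mul dFun_comm

lemma dExt_smul (a : A) (x : DExt A L) : a • x = ⟨a • x.re, a • x.im + dFun a * x.re⟩ := by
  rw [Algebra.smul_def, Algebra.smul_def, Algebra.smul_def]
  refine OddExt.ext rfl ?_
  change parity (algebraMap A _ a) * x.im + dFun a * x.re = _
  rw [AlgHom.commutes]

end Forms

end Forms

section FormsDiff

variable {A L : Type*} [CommRing A] [Algebra ℝ A] [LieRing L] [Module A L] [LieRingModule L A]

namespace Forms

/-- `(d_L α)(x, y) = ⁅x, α y⁆ - ⁅y, α x⁆ - α ⁅x, y⁆`. -/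
noncomputable def dOne (α : Module.Dual A L) : Forms A L :=
  algebraMap ℝ A 2⁻¹ • ∑ i, ∑ j,
    (⁅frame A L i, α (frame A L j)⁆ - ⁅frame A L j, α (frame A L i)⁆ -
      α ⁅frame A L i, frame A L j⁆) •
        (ExteriorAlgebra.ι A (coframe A L i) * ExteriorAlgebra.ι A (coframe A L j))

lemma dOne_add (α β : Module.Dual A L) : dOne (α + β) = dOne α + dOne β := by
  simp only [dOne, ← smul_add, ← Finset.sum_add_distrib, ← add_smul, LinearMap.add_apply, lie_add]
  refine congrArg _ (Finset.sum_congr rfl fun i _ => Finset.sum_congr rfl fun j _ => ?_)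
  congr 1
  ring

variable [LieRinehartRing A L]

lemma dOne_smul (a : A) (α : Module.Dual A L) :
    dOne (a • α) = a • dOne α + dFun a * ExteriorAlgebra.ι A α := by
  rcases dualBasis_isDual_or A L with hd | hd
  swap
  · have : IsEmpty (Fin (dualBasis A L).card) := by rw [hd]; infer_instance
    simp [dOne, dFun]
  have h1 : ∑ i, ∑ j, (⁅frame A L i, a⁆ * α (frame A L j)) •
      (ExteriorAlgebra.ι A (coframe A L i) * ExteriorAlgebra.ι A (coframe A L j)) =
      dFun a * ExteriorAlgebra.ι A α := by
    conv_rhs => rw [← sum_smul_coframe hd α]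
    rw [map_sum, Finset.mul_sum, Finset.sum_comm]
    simp only [dFun, AddMonoidHom.mk'_apply, map_smul, Finset.sum_mul,
      smul_mul_assoc, mul_smul_comm, mul_smul, Finset.smul_sum]
    exact Finset.sum_congr rfl fun i _ => Finset.sum_congr rfl fun j _ => smul_comm _ _ _
  have h2 : ∑ i, ∑ j, (⁅frame A L j, a⁆ * α (frame A L i)) •
      (ExteriorAlgebra.ι A (coframe A L i) * ExteriorAlgebra.ι A (coframe A L j)) =
      - (dFun a * ExteriorAlgebra.ι A α) := by
    rw [← h1, Finset.sum_comm, ← Finset.sum_neg_distrib]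
    refine Finset.sum_congr rfl fun i _ => ?_
    rw [← Finset.sum_neg_distrib]
    refine Finset.sum_congr rfl fun j _ => ?_
    rw [← smul_neg]
    congr 1
    rw [eq_neg_iff_add_eq_zero, ExteriorAlgebra.ι_add_mul_swap]
  have h3 : ∀ i j, (⁅frame A L i, (a • α) (frame A L j)⁆ - ⁅frame A L j, (a • α) (frame A L i)⁆ -
      (a • α) ⁅frame A L i, frame A L j⁆) •
        (ExteriorAlgebra.ι A (coframe A L i) * ExteriorAlgebra.ι A (coframe A L j)) =
      a • ((⁅frame A L i, α (frame A L j)⁆ - ⁅frame A L j, α (frame A L i)⁆ -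
        α ⁅frame A L i, frame A L j⁆) •
        (ExteriorAlgebra.ι A (coframe A L i) * ExteriorAlgebra.ι A (coframe A L j))) +
      ((⁅frame A L i, a⁆ * α (frame A L j)) •
        (ExteriorAlgebra.ι A (coframe A L i) * ExteriorAlgebra.ι A (coframe A L j)) -
      (⁅frame A L j, a⁆ * α (frame A L i)) •
        (ExteriorAlgebra.ι A (coframe A L i) * ExteriorAlgebra.ι A (coframe A L j))) := by
    intro i j
    simp only [LinearMap.smul_apply, smul_eq_mul, LieRinehartRing.leibniz_mul_right, smul_smul,
      ← sub_smul, ← add_smul]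
    congr 1
    ring
  have h4 : ∀ ω : Forms A L, algebraMap ℝ A 2⁻¹ • (ω + ω) = ω := by
    intro ω
    rw [← two_smul A ω, smul_smul]
    have : algebraMap ℝ A 2⁻¹ * 2 = 1 := by
      rw [← map_ofNat (algebraMap ℝ A) 2, ← map_mul]; norm_num
    rw [this, one_smul]
  simp only [dOne, h3, Finset.sum_add_distrib, Finset.sum_sub_distrib, h1, h2, sub_neg_eq_add,
    smul_add (algebraMap ℝ A 2⁻¹), ← Finset.smul_sum]
  rw [← smul_add, h4, smul_comm]

/-- The algebra map `ω ↦ (ω, d_L ω)`. -/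
noncomputable def dLift : Forms A L →ₐ[A] DExt A L :=
  ExteriorAlgebra.lift A ⟨
    { toFun := fun α => ⟨ExteriorAlgebra.ι A α, dOne α⟩
      map_add' := fun α β => OddExt.ext (map_add _ _ _) (dOne_add α β)
      map_smul' := fun a α => by
        rw [RingHom.id_apply, dExt_smul]
        exact OddExt.ext (map_smul _ _ _) (dOne_smul a α) },
    fun α => by
      refine OddExt.ext (ExteriorAlgebra.ι_sq_zero α) ?_
      · have h : ExteriorAlgebra.ι A α * dOne α = dOne α * ExteriorAlgebra.ι A α := by
          simp only [dOne, mul_smul_comm, smul_mul_assoc, Finset.mul_sum, Finset.sum_mul]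
          refine congrArg _ (Finset.sum_congr rfl fun i _ => Finset.sum_congr rfl fun j _ => ?_)
          congr 1
          rw [ι_mul_eq, map_mul, parity_ι, parity_ι, neg_mul_neg]
        change parity (ExteriorAlgebra.ι A α) * dOne α + dOne α * ExteriorAlgebra.ι A α = 0
        rw [parity_ι, neg_mul, h, neg_add_cancel]⟩

lemma dLift_ι (α : Module.Dual A L) :
    dLift (ExteriorAlgebra.ι A α) = ⟨ExteriorAlgebra.ι A α, dOne α⟩ := by
  simp [dLift]

lemma dLift_re (ω : Forms A L) : (dLift ω).re = ω := by
  induction ω using ExteriorAlgebra.induction with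
  | algebraMap r => rw [AlgHom.commutes]; rfl
  | ι x => rw [dLift_ι]
  | mul a b ha hb =>
    rw [map_mul]; exact (OddExt.re_mul (dLift a) (dLift b)).trans (by rw [ha, hb])
  | add a b ha hb =>
    rw [map_add]; exact (OddExt.re_add (dLift a) (dLift b)).trans (by rw [ha, hb])

/-- The Chevalley-Eilenberg differential `d_L` on `Ω_L`. -/
noncomputable def d : Forms A L →+ Forms A L :=
  AddMonoidHom.mk' (fun ω => (dLift ω).im)
    (fun a b => by rw [map_add]; rfl)

lemma d_algebraMap (a : A) : d (algebraMap A (Forms A L) a) = dFun a := by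
  change (dLift _).im = _
  rw [AlgHom.commutes]; rfl

lemma d_ι (α : Module.Dual A L) : d (ExteriorAlgebra.ι A α) = dOne α := by
  change (dLift _).im = _
  rw [dLift_ι]

lemma d_mul (ω η : Forms A L) : d (ω * η) = d ω * η + parity ω * d η := by
  change (dLift _).im = _
  rw [map_mul]
  refine (OddExt.im_mul (dLift ω) (dLift η)).trans ?_
  rw [dLift_re, dLift_re, add_comm]; rfl

lemma d_smul (a : A) (ω : Forms A L) : d (a • ω) = a • d ω + dFun a * ω := by
  rw [Algebra.smul_def, d_mul, d_algebraMap, AlgHom.commutes, ← Algebra.smul_def, add_comm]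

end Forms

end FormsDiff

section DR

variable (A L : Type*) [CommRing A] [LieRing L] [Module A L]

/-- graded module `Ω_L ⊗_A N`. -/
abbrev dR (N : Type*) [AddCommGroup N] [Module A N] : Type _ := Forms A L ⊗[A] N

namespace dR

variable (N : Type*) [AddCommGroup N] [Module A N]

/-- The part of cohomological degree `k`. -/
noncomputable def deg (k : ℕ) : Submodule A (dR A L N) :=
  LinearMap.range (LinearMap.rTensor N (⋀[A]^k (Module.Dual A L)).subtype)

/-- The map `x ↦ (-1)^{|x|} x`. -/
noncomputable def parity : dR A L N →ₗ[A] dR A L N :=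
  LinearMap.rTensor N Forms.parity.toLinearMap

lemma parity_of_mem_deg {k : ℕ} {x : dR A L N} (hx : x ∈ deg A L N k) :
    parity A L N x = (-1 : A) ^ k • x := by
  obtain ⟨y, rfl⟩ := hx
  induction y with
  | zero => simp
  | add y z hy hz => simp only [map_add, hy, hz, smul_add]
  | tmul ω n =>
    simp only [parity, LinearMap.rTensor_tmul, TensorProduct.smul_tmul']
    congr 1
    obtain ⟨ω, hω⟩ := ω
    simp only [Submodule.subtype_apply, AlgHom.toLinearMap_apply]
    induction hω using Submodule.pow_induction_on_left' with
    | algebraMap r => simp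
    | add x y i hx hy h h' => rw [map_add, h, h', smul_add]
    | mem_mul m hm i x hx h =>
      obtain ⟨α, rfl⟩ := hm
      rw [map_mul, h, Forms.parity_ι, pow_succ, mul_smul]
      simp

variable [LieRingModule L A] [LieRinehartRing A L] [Module (Jet A L) N] [IsScalarTower A (Jet A L) N]

/-- The right action of `dR_L(J_L)` on `dR_L(N)`, `(ω ⊗ n) · (η ⊗ φ) = ωη ⊗ φ n`. -/
noncomputable def rmul : dR A L N →ₗ[A] dR A L (Jet A L) →ₗ[A] dR A L N :=
  TensorProduct.map₂ (LinearMap.mul A (Forms A L)) (Algebra.lsmul A A N).toLinearMap.flip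

variable {A L N} in
lemma rmul_tmul (ω η : Forms A L) (n : N) (φ : Jet A L) :
    rmul A L N (ω ⊗ₜ n) (η ⊗ₜ φ) = (ω * η) ⊗ₜ (φ • n) := rfl

end dR

end DR

section DRDiff

variable {A L : Type*} [CommRing A] [Algebra ℝ A] [LieRing L] [Module A L] [LieRingModule L A]
  [LieRinehartRing A L]
  {N : Type*} [AddCommGroup N] [Module A N]

/-- The differential `d(ω ⊗ n) = d_L ω ⊗ n + (-1)^{|ω|} ω ∧ ∇ n` of `dR_L(N)`. -/
noncomputable def dR.diff (c : FlatConn A L N) : dR A L N →+ dR A L N :=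
  TensorProduct.liftAddHom
    (AddMonoidHom.mk' (fun ω => AddMonoidHom.mk' (fun n => Forms.d ω ⊗ₜ[A] n +
        ∑ i, (Forms.parity ω * ExteriorAlgebra.ι A (Forms.coframe A L i)) ⊗ₜ[A]
          c.nabla (Forms.frame A L i) n)
      (fun m n => by
        simp only [map_add, TensorProduct.tmul_add, Finset.sum_add_distrib]; abel))
      (fun ω η => by
        ext n
        simp only [AddMonoidHom.mk'_apply, AddMonoidHom.add_apply, map_add, add_mul,
          TensorProduct.add_tmul, Finset.sum_add_distrib]
        abel))
    (fun a ω n => by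
      simp only [AddMonoidHom.mk'_apply, Forms.d_smul, Forms.dFun_comm, map_smul, c.leibniz,
        TensorProduct.add_tmul, TensorProduct.tmul_add, Finset.sum_add_distrib, smul_mul_assoc,
        TensorProduct.smul_tmul, add_assoc]
      congr 1
      rw [add_comm]
      congr 1
      simp only [Forms.dFun, AddMonoidHom.mk'_apply, Finset.mul_sum, TensorProduct.sum_tmul,
        mul_smul_comm, TensorProduct.smul_tmul])

lemma dR.diff_tmul (c : FlatConn A L N) (ω : Forms A L) (n : N) :
    dR.diff c (ω ⊗ₜ n) = Forms.d ω ⊗ₜ[A] n +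
      ∑ i, (Forms.parity ω * ExteriorAlgebra.ι A (Forms.coframe A L i)) ⊗ₜ[A]
        c.nabla (Forms.frame A L i) n := rfl

end DRDiff

section Kaehler

/-- A graded algebra over `A` with its automorphism `r ↦ (-1)^{|r|} r` and a distinguished part
(the base) relative to which Kähler differentials are taken. -/
structure GrAlg (A R : Type*) [CommRing A] [Ring R] [Algebra A R] where
  deg : ℕ → Submodule A R
  parity : R →ₐ[A] R
  parity_of_mem : ∀ {k : ℕ} {r : R}, r ∈ deg k → parity r = (-1 : A) ^ k • r
  base : Submodule A R
  parity_base : ∀ {r : R}, r ∈ base → parity r ∈ base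

variable {A R : Type*} [CommRing A] [Ring R] [Algebra A R] (𝒢 : GrAlg A R)

/-- The relations between the generators `r` and `dr` of the algebra of Kähler forms of `R` over
the base: `d` is an odd derivation that kills the base, and the algebra is graded commutative for
the total degree, in which `dr` has degree `|r| + 1`. -/
inductive KaehlerRel : FreeAlgebra A (R ⊕ R) → FreeAlgebra A (R ⊕ R) → Prop
  | one : KaehlerRel (FreeAlgebra.ι A (Sum.inl 1)) 1
  | add (r s : R) : KaehlerRel (FreeAlgebra.ι A (Sum.inl (r + s)))
      (FreeAlgebra.ι A (Sum.inl r) + FreeAlgebra.ι A (Sum.inl s))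
  | smul (a : A) (r : R) : KaehlerRel (FreeAlgebra.ι A (Sum.inl (a • r)))
      (a • FreeAlgebra.ι A (Sum.inl r))
  | mul (r s : R) : KaehlerRel (FreeAlgebra.ι A (Sum.inl (r * s)))
      (FreeAlgebra.ι A (Sum.inl r) * FreeAlgebra.ι A (Sum.inl s))
  | d_add (r s : R) : KaehlerRel (FreeAlgebra.ι A (Sum.inr (r + s)))
      (FreeAlgebra.ι A (Sum.inr r) + FreeAlgebra.ι A (Sum.inr s))
  | d_smul (a : A) (r : R) : KaehlerRel (FreeAlgebra.ι A (Sum.inr (a • r)))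
      (a • FreeAlgebra.ι A (Sum.inr r))
  | d_base (r : R) (hr : r ∈ 𝒢.base) : KaehlerRel (FreeAlgebra.ι A (Sum.inr r)) 0
  | d_mul (r s : R) : KaehlerRel (FreeAlgebra.ι A (Sum.inr (r * s)))
      (FreeAlgebra.ι A (Sum.inl r) * FreeAlgebra.ι A (Sum.inr s) +
        FreeAlgebra.ι A (Sum.inr r) * FreeAlgebra.ι A (Sum.inl (𝒢.parity s)))
  | d_comm (i j : ℕ) (r s : R) (hr : r ∈ 𝒢.deg i) (hs : s ∈ 𝒢.deg j) :
      KaehlerRel (FreeAlgebra.ι A (Sum.inr r) * FreeAlgebra.ι A (Sum.inl s))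
        ((-1 : A) ^ ((i + 1) * j) • (FreeAlgebra.ι A (Sum.inl s) * FreeAlgebra.ι A (Sum.inr r)))
  | d_comm_d (i j : ℕ) (r s : R) (hr : r ∈ 𝒢.deg i) (hs : s ∈ 𝒢.deg j) :
      KaehlerRel (FreeAlgebra.ι A (Sum.inr r) * FreeAlgebra.ι A (Sum.inr s))
        ((-1 : A) ^ ((i + 1) * (j + 1)) •
          (FreeAlgebra.ι A (Sum.inr s) * FreeAlgebra.ι A (Sum.inr r)))

/-- The graded algebra `Ω^•_R` of Kähler forms of `R` relative to the base. -/
def Kaehler : Type _ := RingQuot (KaehlerRel 𝒢)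

namespace Kaehler

noncomputable instance : Ring (Kaehler 𝒢) := inferInstanceAs (Ring (RingQuot (KaehlerRel 𝒢)))
noncomputable instance : Algebra A (Kaehler 𝒢) :=
  inferInstanceAs (Algebra A (RingQuot (KaehlerRel 𝒢)))

noncomputable def mk : FreeAlgebra A (R ⊕ R) →ₐ[A] Kaehler 𝒢 := RingQuot.mkAlgHom A (KaehlerRel 𝒢)

variable {𝒢} in
lemma mk_eq {p q : FreeAlgebra A (R ⊕ R)} (h : KaehlerRel 𝒢 p q) : mk 𝒢 p = mk 𝒢 q :=
  RingQuot.mkAlgHom_rel A h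

/-- The inclusion `R → Ω^•_R` -/
noncomputable def of : R →ₐ[A] Kaehler 𝒢 :=
  AlgHom.ofLinearMap
    { toFun := fun r => mk 𝒢 (FreeAlgebra.ι A (Sum.inl r))
      map_add' := fun r s => by rw [mk_eq (.add r s), map_add]
      map_smul' := fun a r => by rw [mk_eq (.smul a r), map_smul]; rfl }
    ((mk_eq .one).trans (map_one _))
    (fun r s => (mk_eq (.mul r s)).trans (map_mul _ _ _))

/-- The universal derivation `d_dR : R → Ω¹_R`. -/
noncomputable def der : R →ₗ[A] Kaehler 𝒢 where
  toFun r := mk 𝒢 (FreeAlgebra.ι A (Sum.inr r))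
  map_add' r s := by rw [mk_eq (.d_add r s), map_add]
  map_smul' a r := by rw [mk_eq (.d_smul a r), map_smul]; rfl

variable {𝒢}

lemma der_base {r : R} (hr : r ∈ 𝒢.base) : der 𝒢 r = 0 :=
  (mk_eq (.d_base r hr)).trans (map_zero _)

lemma der_mul (r s : R) : der 𝒢 (r * s) = of 𝒢 r * der 𝒢 s + der 𝒢 r * of 𝒢 (𝒢.parity s) := by
  have h := mk_eq (KaehlerRel.d_mul (𝒢 := 𝒢) r s)
  rw [map_add, map_mul, map_mul] at h
  exact h

lemma der_mul_of {i j : ℕ} {r s : R} (hr : r ∈ 𝒢.deg i) (hs : s ∈ 𝒢.deg j) :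
    der 𝒢 r * of 𝒢 s = (-1 : A) ^ ((i + 1) * j) • (of 𝒢 s * der 𝒢 r) := by
  have h := mk_eq (KaehlerRel.d_comm i j r s hr hs)
  rw [map_smul, map_mul, map_mul] at h
  exact h

lemma der_mul_der {i j : ℕ} {r s : R} (hr : r ∈ 𝒢.deg i) (hs : s ∈ 𝒢.deg j) :
    der 𝒢 r * der 𝒢 s = (-1 : A) ^ ((i + 1) * (j + 1)) • (der 𝒢 s * der 𝒢 r) := by
  have h := mk_eq (KaehlerRel.d_comm_d i j r s hr hs)
  rw [map_smul, map_mul, map_mul] at h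
  exact h

/-- The universal property of `Ω^•_R`. -/
noncomputable def lift {B : Type*} [Ring B] [Algebra A B] (f : R →ₐ[A] B) (δ : R →ₗ[A] B)
    (hbase : ∀ r ∈ 𝒢.base, δ r = 0)
    (hmul : ∀ r s, δ (r * s) = f r * δ s + δ r * f (𝒢.parity s))
    (hcomm : ∀ (i j : ℕ) (r s : R), r ∈ 𝒢.deg i → s ∈ 𝒢.deg j →
      δ r * f s = (-1 : A) ^ ((i + 1) * j) • (f s * δ r))
    (hcomm' : ∀ (i j : ℕ) (r s : R), r ∈ 𝒢.deg i → s ∈ 𝒢.deg j →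
      δ r * δ s = (-1 : A) ^ ((i + 1) * (j + 1)) • (δ s * δ r)) : Kaehler 𝒢 →ₐ[A] B :=
  RingQuot.liftAlgHom A ⟨FreeAlgebra.lift A (Sum.elim f δ), by
    intro p q h
    cases h with
    | one => simp
    | add r s => simp
    | smul a r => simp
    | mul r s => simp
    | d_add r s => simp
    | d_smul a r => simp
    | d_base r hr => simpa using hbase r hr
    | d_mul r s => simpa using hmul r s
    | d_comm i j r s hr hs =>
      rw [map_smul, map_mul, map_mul]; simpa using hcomm i j r s hr hs
    | d_comm_d i j r s hr hs =>
      rw [map_smul, map_mul, map_mul]; simpa using hcomm' i j r s hr hs⟩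

section lift

variable {B : Type*} [Ring B] [Algebra A B] (f : R →ₐ[A] B) (δ : R →ₗ[A] B)
    (hbase : ∀ r ∈ 𝒢.base, δ r = 0)
    (hmul : ∀ r s, δ (r * s) = f r * δ s + δ r * f (𝒢.parity s))
    (hcomm : ∀ (i j : ℕ) (r s : R), r ∈ 𝒢.deg i → s ∈ 𝒢.deg j →
      δ r * f s = (-1 : A) ^ ((i + 1) * j) • (f s * δ r))
    (hcomm' : ∀ (i j : ℕ) (r s : R), r ∈ 𝒢.deg i → s ∈ 𝒢.deg j →
      δ r * δ s = (-1 : A) ^ ((i + 1) * (j + 1)) • (δ s * δ r))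

lemma lift_of (r : R) : lift f δ hbase hmul hcomm hcomm' (of 𝒢 r) = f r := by
  refine (RingQuot.liftAlgHom_mkAlgHom_apply _ _ _ _).trans ?_
  simp

lemma lift_der (r : R) : lift f δ hbase hmul hcomm hcomm' (der 𝒢 r) = δ r := by
  refine (RingQuot.liftAlgHom_mkAlgHom_apply _ _ _ _).trans ?_
  simp

end lift

lemma parity_mem {k : ℕ} {r : R} (hr : r ∈ 𝒢.deg k) : 𝒢.parity r ∈ 𝒢.deg k := by
  rw [𝒢.parity_of_mem hr]; exact Submodule.smul_mem _ _ hr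

variable (𝒢) in
/-- The automorphism `ω ↦ (-1)^{|ω|} ω` of `Ω^•_R`, with the total degree. -/
noncomputable def parity : Kaehler 𝒢 →ₐ[A] Kaehler 𝒢 :=
  lift ((of 𝒢).comp 𝒢.parity) (-(der 𝒢 ∘ₗ 𝒢.parity.toLinearMap))
    (fun r hr => by simp [der_base (𝒢.parity_base hr)])
    (fun r s => by simp [der_mul, add_comm])
    (fun i j r s hr hs => by simp [der_mul_of (parity_mem hr) (parity_mem hs)])
    (fun i j r s hr hs => by simp [der_mul_der (parity_mem hr) (parity_mem hs)])

lemma parity_of (r : R) : parity 𝒢 (of 𝒢 r) = of 𝒢 (𝒢.parity r) := lift_of _ _ _ _ _ _ _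

lemma parity_der (r : R) : parity 𝒢 (der 𝒢 r) = -der 𝒢 (𝒢.parity r) := lift_der _ _ _ _ _ _ _

variable (𝒢) in
abbrev DExt : Type _ := OddExt (AlgHom.id A (Kaehler 𝒢)) (parity 𝒢)

noncomputable instance : Algebra A (DExt 𝒢) :=
  OddExt.algebraOf (AlgHom.id A _) (parity 𝒢) 0 (by simp) (by simp)

lemma dExt_smul (a : A) (x : DExt 𝒢) : a • x = ⟨a • x.re, a • x.im⟩ := by
  rw [Algebra.smul_def, Algebra.smul_def, Algebra.smul_def]
  refine OddExt.ext rfl ?_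
  change algebraMap A _ a * x.im + 0 * _ = _
  rw [zero_mul, add_zero]

variable (𝒢) in
/-- `x ↦ (x, d x)` -/
noncomputable def dLift : Kaehler 𝒢 →ₐ[A] DExt 𝒢 :=
  lift
    (AlgHom.ofLinearMap
      { toFun := fun r => (⟨of 𝒢 r, der 𝒢 r⟩ : DExt 𝒢)
        map_add' := fun r s => OddExt.ext (map_add _ _ _) (map_add _ _ _)
        map_smul' := fun a r => by
          rw [RingHom.id_apply, dExt_smul]
          exact OddExt.ext (map_smul _ _ _) (map_smul _ _ _) }
      (OddExt.ext (map_one _) (by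
        have h := der_mul (𝒢 := 𝒢) 1 1
        simp only [mul_one, map_one, one_mul] at h
        exact left_eq_add.mp h))
      (fun r s => OddExt.ext (map_mul _ _ _) ((der_mul r s).trans
        (congrArg (_ + der 𝒢 r * ·) (parity_of s).symm))))
    { toFun := fun r => (⟨der 𝒢 r, 0⟩ : DExt 𝒢)
      map_add' := fun r s => OddExt.ext (map_add _ _ _) (add_zero _).symm
      map_smul' := fun a r => by
        rw [RingHom.id_apply, dExt_smul]
        exact OddExt.ext (map_smul _ _ _) (smul_zero _).symm }
    (fun r hr => OddExt.ext (der_base hr) rfl)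
    (fun r s => OddExt.ext (der_mul r s) (by
      change 0 = (of 𝒢 r * 0 + der 𝒢 r * parity 𝒢 (der 𝒢 s)) +
        (der 𝒢 r * der 𝒢 (𝒢.parity s) + 0 * _)
      rw [parity_der]; simp))
    (fun i j r s hr hs => by
      rw [dExt_smul]
      refine OddExt.ext (der_mul_of hr hs) ?_
      change der 𝒢 r * der 𝒢 s + 0 * _ =
        (-1 : A) ^ ((i + 1) * j) • (of 𝒢 s * 0 + der 𝒢 s * parity 𝒢 (der 𝒢 r))
      rw [parity_der, 𝒢.parity_of_mem hr, der_mul_der hr hs, map_smul]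
      simp only [zero_mul, add_zero, mul_zero, zero_add, mul_neg, mul_smul_comm, smul_smul,
        ← neg_smul]
      congr 1
      ring)
    (fun i j r s hr hs => by
      rw [dExt_smul]
      refine OddExt.ext (der_mul_der hr hs) ?_
      change der 𝒢 r * 0 + 0 * _ = (-1 : A) ^ ((i + 1) * (j + 1)) • (der 𝒢 s * 0 + 0 * _)
      simp)

variable (𝒢) in
/-- The de Rham differential of `Ω^•_R`, with `d r = dr` and `d(dr) = 0`. -/
noncomputable def d : Kaehler 𝒢 →ₗ[A] Kaehler 𝒢 where
  toFun x := (dLift 𝒢 x).im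
  map_add' x y := by rw [map_add]; rfl
  map_smul' a x := by rw [map_smul, dExt_smul]; rfl

lemma d_of (r : R) : d 𝒢 (of 𝒢 r) = der 𝒢 r :=
  congrArg OddExt.im (lift_of _ _ _ _ _ _ r)

lemma d_der (r : R) : d 𝒢 (der 𝒢 r) = 0 :=
  congrArg OddExt.im (lift_der _ _ _ _ _ _ r)

@[elab_as_elim]
theorem induction {P : Kaehler 𝒢 → Prop} (of : ∀ r, P (of 𝒢 r)) (der : ∀ r, P (der 𝒢 r))
    (add : ∀ x y, P x → P y → P (x + y)) (mul : ∀ x y, P x → P y → P (x * y))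
    (x : Kaehler 𝒢) : P x := by
  obtain ⟨p, rfl⟩ := RingQuot.mkAlgHom_surjective A (KaehlerRel 𝒢) x
  induction p using FreeAlgebra.induction with
  | grade0 a =>
    have h : RingQuot.mkAlgHom A (KaehlerRel 𝒢) (algebraMap A _ a) =
        Kaehler.of 𝒢 (algebraMap A R a) :=
      (AlgHom.commutes _ a).trans (AlgHom.commutes (Kaehler.of 𝒢) a).symm
    rw [h]
    exact of _
  | grade1 z =>
    rcases z with r | r
    · exact of r
    · exact der r
  | mul p q hp hq => rw [map_mul]; exact mul _ _ hp hq
  | add p q hp hq => rw [map_add]; exact add _ _ hp hq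

lemma dLift_re (x : Kaehler 𝒢) : (dLift 𝒢 x).re = x := by
  induction x using induction with
  | of r => exact congrArg OddExt.re (lift_of _ _ _ _ _ _ r)
  | der r => exact congrArg OddExt.re (lift_der _ _ _ _ _ _ r)
  | add x y hx hy => rw [map_add]; exact congrArg₂ (· + ·) hx hy
  | mul x y hx hy => rw [map_mul]; exact congrArg₂ (· * ·) hx hy

lemma d_mul (x y : Kaehler 𝒢) : d 𝒢 (x * y) = x * d 𝒢 y + d 𝒢 x * parity 𝒢 y := by
  change (dLift 𝒢 (x * y)).im = _
  rw [map_mul]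
  refine (OddExt.im_mul (dLift 𝒢 x) (dLift 𝒢 y)).trans ?_
  rw [dLift_re, dLift_re]; rfl

variable (𝒢) in
/-- `Ω^k_R`: span of `r₀ dr₁ ⋯ dr_k`. -/
noncomputable def form (k : ℕ) : Submodule A (Kaehler 𝒢) :=
  LinearMap.range (of 𝒢).toLinearMap * LinearMap.range (der 𝒢) ^ k

end Kaehler

section TensorForms

variable {M : Type*} [AddCommGroup M] [Module A M] (rmul : M →ₗ[A] R →ₗ[A] M)

/-- relations `m r ⊗ ω = m ⊗ r ω`. -/
noncomputable def balanceRel : Submodule A (M ⊗[A] Kaehler 𝒢) :=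
  Submodule.span A {t | ∃ m r ω, t = rmul m r ⊗ₜ ω - m ⊗ₜ (Kaehler.of 𝒢 r * ω)}

/-- `M ⊗_R Ω^•_R`. -/
abbrev TensorForms : Type _ := (M ⊗[A] Kaehler 𝒢) ⧸ balanceRel 𝒢 rmul

namespace TensorForms

noncomputable def tmul (m : M) (ω : Kaehler 𝒢) : TensorForms 𝒢 rmul :=
  (balanceRel 𝒢 rmul).mkQ (m ⊗ₜ ω)

/-- `M ⊗_R Ω^k_R` -/
noncomputable def form (k : ℕ) : Submodule A (TensorForms 𝒢 rmul) :=
  Submodule.span A {t | ∃ m, ∃ ω ∈ Kaehler.form 𝒢 k, t = tmul 𝒢 rmul m ω}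

/-- Right multiplication by a form -/
noncomputable def mulRight (η : Kaehler 𝒢) : TensorForms 𝒢 rmul →ₗ[A] TensorForms 𝒢 rmul :=
  (balanceRel 𝒢 rmul).mapQ (balanceRel 𝒢 rmul) (LinearMap.lTensor M (LinearMap.mulRight A η)) (by
    rw [balanceRel, Submodule.span_le]
    rintro _ ⟨m, r, ω, rfl⟩
    refine Submodule.subset_span ⟨m, r, ω * η, ?_⟩
    simp [mul_assoc])

lemma mulRight_tmul (m : M) (ω η : Kaehler 𝒢) :
    mulRight 𝒢 rmul η (tmul 𝒢 rmul m ω) = tmul 𝒢 rmul m (ω * η) := rfl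

end TensorForms

end TensorForms

end Kaehler

section Geometry

open Bundle
open scoped Manifold ContDiff

variable {n : ℕ} {X : Type*} [TopologicalSpace X] [ChartedSpace (EuclideanSpace ℝ (Fin n)) X]

variable (n X) in
/-- The algebra `C^∞(X)`. -/
abbrev SmoothFun : Type _ := C^∞⟮𝓡 n, X; 𝓘(ℝ, ℝ), ℝ⟯

variable (n) in
/-- The module `Γ(X, V)` of smooth sections of a vector bundle. -/
abbrev Sections (F : Type*) [NormedAddCommGroup F] [NormedSpace ℝ F] (V : X → Type*)
    [TopologicalSpace (TotalSpace F V)] [∀ x, TopologicalSpace (V x)] [FiberBundle F V] : Type _ :=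
  Cₛ^∞⟮𝓡 n; F, V⟯

variable (F : Type*) [NormedAddCommGroup F] [NormedSpace ℝ F] (V : X → Type*)
  [TopologicalSpace (TotalSpace F V)] [∀ x, TopologicalSpace (V x)] [∀ x, AddCommGroup (V x)]
  [∀ x, Module ℝ (V x)] [FiberBundle F V] [VectorBundle ℝ F V]

noncomputable instance : Module (SmoothFun n X) (Sections n F V) where
  smul f s := ⟨fun x => f x • s x, f.contMDiff.smul_section s.contMDiff⟩
  one_smul s := by ext x; exact one_smul ℝ (s x)
  mul_smul f g s := by ext x; exact mul_smul (f x) (g x) (s x)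
  smul_zero f := by ext x; exact smul_zero (f x)
  smul_add f s t := by ext x; exact smul_add (f x) (s x) (t x)
  add_smul f g s := by ext x; exact add_smul (f x) (g x) (s x)
  zero_smul s := by ext x; exact zero_smul ℝ (s x)

variable {F V}

lemma Sections.smul_apply (f : SmoothFun n X) (s : Sections n F V) (x : X) :
    (f • s) x = f x • s x := rfl

variable [IsManifold (𝓡 n) ∞ X]

variable (n F V) in
/-- A bundle map `ρ : V → TX`. -/
structure AnchorMap where
  toFun : ∀ x, V x →ₗ[ℝ] TangentSpace (𝓡 n) x
  contMDiff_toFun : ContMDiff ((𝓡 n).prod 𝓘(ℝ, F)) (𝓡 n).tangent ∞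
    (fun v : TotalSpace F V => (⟨v.1, toFun v.1 v.2⟩ : TangentBundle (𝓡 n) X))

/-- The derivative `ρ(s) f` of a function along the anchor of a section. -/
noncomputable def AnchorMap.deriv (ρ : AnchorMap n F V) (s : Sections n F V)
    (f : SmoothFun n X) : SmoothFun n X where
  val x := mfderiv (𝓡 n) 𝓘(ℝ, ℝ) f x (ρ.toFun x (s x))
  property := by
    have h1 : ContMDiff (𝓡 n) (𝓡 n).tangent ∞
        (fun x => (⟨x, ρ.toFun x (s x)⟩ : TangentBundle (𝓡 n) X)) :=
      ρ.contMDiff_toFun.comp s.contMDiff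
    have h2 := f.contMDiff.contMDiff_tangentMap (m := ∞) (by simp)
    exact (contMDiff_snd_tangentBundle_modelSpace ℝ 𝓘(ℝ, ℝ)).comp (h2.comp h1)

lemma AnchorMap.deriv_apply (ρ : AnchorMap n F V) (s : Sections n F V)
    (f : SmoothFun n X) (x : X) :
    ρ.deriv s f x = mfderiv (𝓡 n) 𝓘(ℝ, ℝ) f x (ρ.toFun x (s x)) := rfl

lemma AnchorMap.deriv_add_left (ρ : AnchorMap n F V) (s t : Sections n F V)
    (f : SmoothFun n X) : ρ.deriv (s + t) f = ρ.deriv s f + ρ.deriv t f := by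
  ext x
  change mfderiv (𝓡 n) 𝓘(ℝ, ℝ) f x (ρ.toFun x (s x + t x)) = _
  rw [map_add, map_add]; rfl

lemma AnchorMap.deriv_smul_left (ρ : AnchorMap n F V) (g : SmoothFun n X) (s : Sections n F V)
    (f : SmoothFun n X) : ρ.deriv (g • s) f = g * ρ.deriv s f := by
  ext x
  change mfderiv (𝓡 n) 𝓘(ℝ, ℝ) f x (ρ.toFun x (g x • s x)) = _
  rw [map_smul, map_smul]; rfl

lemma SmoothFun.mdiffAt (f : SmoothFun n X) (x : X) : MDifferentiableAt (𝓡 n) 𝓘(ℝ, ℝ) f x :=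
  f.contMDiff.mdifferentiableAt (by simp)

lemma AnchorMap.deriv_add (ρ : AnchorMap n F V) (s : Sections n F V)
    (f g : SmoothFun n X) : ρ.deriv s (f + g) = ρ.deriv s f + ρ.deriv s g := by
  ext x
  change mfderiv (𝓡 n) 𝓘(ℝ, ℝ) (⇑f + ⇑g) x (ρ.toFun x (s x)) = _
  rw [mfderiv_add (f.mdiffAt x) (g.mdiffAt x)]; rfl

lemma AnchorMap.deriv_mul (ρ : AnchorMap n F V) (s : Sections n F V)
    (f g : SmoothFun n X) : ρ.deriv s (f * g) = f * ρ.deriv s g + ρ.deriv s f * g := by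
  ext x
  change mfderiv (𝓡 n) 𝓘(ℝ, ℝ) (⇑f * ⇑g) x (ρ.toFun x (s x)) = _
  rw [((f.mdiffAt x).hasMFDerivAt.mul (g.mdiffAt x).hasMFDerivAt).mfderiv]
  change f x * ρ.deriv s g x + g x * ρ.deriv s f x = f x * ρ.deriv s g x + ρ.deriv s f x * g x
  ring

variable (n F V) in
/-- A Lie algebroid structure on the vector bundle `V` over `X`: an anchor `V → TX` and an
`ℝ`-bilinear Lie bracket on the sections with `ρ⁅s, t⁆ = ⁅ρ s, ρ t⁆` and the Leibniz rule. -/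
class LieAlgebroid where
  anchor : AnchorMap n F V
  bracket : Sections n F V →ₗ[ℝ] Sections n F V →ₗ[ℝ] Sections n F V
  bracket_self : ∀ s, bracket s s = 0
  jacobi : ∀ s t u, bracket s (bracket t u) = bracket (bracket s t) u + bracket t (bracket s u)
  anchor_bracket : ∀ s t f, anchor.deriv (bracket s t) f =
    anchor.deriv s (anchor.deriv t f) - anchor.deriv t (anchor.deriv s f)
  leibniz : ∀ (s t : Sections n F V) (f : SmoothFun n X),
    bracket s (f • t) = f • bracket s t + anchor.deriv s f • t

variable [LieAlgebroid n F V]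

noncomputable instance : LieRing (Sections n F V) where
  bracket s t := LieAlgebroid.bracket s t
  add_lie s t u := by
    change LieAlgebroid.bracket (s + t) u = _
    rw [map_add]; rfl
  lie_add s t u := map_add (LieAlgebroid.bracket s) t u
  lie_self := LieAlgebroid.bracket_self
  leibniz_lie := LieAlgebroid.jacobi

noncomputable instance : LieRingModule (Sections n F V) (SmoothFun n X) where
  bracket s f := (LieAlgebroid.anchor (n := n) (F := F) (V := V)).deriv s f
  add_lie s t f := AnchorMap.deriv_add_left _ s t f
  lie_add s f g := AnchorMap.deriv_add _ s f g
  leibniz_lie s t f := by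
    have h := LieAlgebroid.anchor_bracket s t f
    rw [eq_sub_iff_add_eq] at h
    exact h.symm

instance : LieRinehartRing (SmoothFun n X) (Sections n F V) where
  lie_smul_eq_mul' f g s := AnchorMap.deriv_smul_left _ f s g
  leibniz_mul_right' s f g := AnchorMap.deriv_mul _ s f g
  leibniz_smul_right' s t f := LieAlgebroid.leibniz s t f

end Geometry

section Statements

/-- The predicate that `d` is the Chevalley-Eilenberg differential of `Λ L^∨`: the graded
derivation with `(d a)(x) = ⁅x, a⁆` and `(d α)(x, y) = ⁅x, α y⁆ - ⁅y, α x⁆ - α ⁅x, y⁆`. -/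
structure IsCEDifferential {A L : Type*} [CommRing A] [LieRing L] [Module A L] [LieRingModule L A]
    (d : Forms A L →+ Forms A L) : Prop where
  d_fun : ∀ (x : L) (a : A),
    Forms.contract x (d (algebraMap A _ a)) = algebraMap A _ ⁅x, a⁆
  d_form : ∀ (x y : L) (α : Module.Dual A L),
    Forms.contract y (Forms.contract x (d (ExteriorAlgebra.ι A α))) =
      algebraMap A _ (⁅x, α y⁆ - ⁅y, α x⁆ - α ⁅x, y⁆)
  d_fun_mem : ∀ a : A, d (algebraMap A _ a) ∈ ⋀[A]^1 (Module.Dual A L)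
  d_form_mem : ∀ α : Module.Dual A L, d (ExteriorAlgebra.ι A α) ∈ ⋀[A]^2 (Module.Dual A L)
  d_mul : ∀ ω η : Forms A L, d (ω * η) = d ω * η + Forms.parity ω * d η

/-- The predicate that `D` is the de Rham differential of `Λ L^∨ ⊗ N` for the flat connection
`c`: the extension of `d_L` by the Leibniz rule with `(D n)(x) = ∇_x n`. -/
structure IsDeRhamDifferential {A L N : Type*} [CommRing A] [Algebra ℝ A] [LieRing L] [Module A L]
    [LieRingModule L A] [LieRinehartRing A L] [AddCommGroup N] [Module A N] (c : FlatConn A L N)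
    (D : dR A L N →+ dR A L N) : Prop where
  d_sec : ∀ (x : L) (m : N),
    LinearMap.rTensor N (Forms.contract x) (D (1 ⊗ₜ m)) = 1 ⊗ₜ c.nabla x m
  d_sec_mem : ∀ m : N, D (1 ⊗ₜ m) ∈ dR.deg A L N 1
  d_tmul : ∀ (ω : Forms A L) (m : N), D (ω ⊗ₜ m) =
    Forms.d ω ⊗ₜ m + LinearMap.rTensor N (LinearMap.mulLeft A (Forms.parity ω)) (D (1 ⊗ₜ m))

/-- `(R, deg, d)` is a commutative differential graded algebra (cohomological grading). -/
structure IsCDGA {A R : Type*} [CommRing A] [Ring R] [Algebra A R] (deg : ℕ → Submodule A R)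
    (d : R →+ R) : Prop where
  decomp : DirectSum.IsInternal deg
  one_mem : (1 : R) ∈ deg 0
  mul_mem : ∀ {i j : ℕ} {r s : R}, r ∈ deg i → s ∈ deg j → r * s ∈ deg (i + j)
  mul_comm : ∀ {i j : ℕ} {r s : R}, r ∈ deg i → s ∈ deg j → r * s = (-1 : A) ^ (i * j) • (s * r)
  d_mem : ∀ {i : ℕ} {r : R}, r ∈ deg i → d r ∈ deg (i + 1)
  d_d : ∀ r : R, d (d r) = 0
  d_mul : ∀ {i : ℕ} {r s : R}, r ∈ deg i → d (r * s) = d r * s + (-1 : A) ^ i • (r * d s)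

/-- `(M, deg', d')` is a right differential graded module over the differential graded algebra
`(R, deg, d)`, where `act m r = m r` is the action. -/
structure IsDGModule {A R M : Type*} [CommRing A] [Ring R] [Algebra A R] [AddCommGroup M]
    [Module A M] (deg : ℕ → Submodule A R) (d : R →+ R) (act : M →ₗ[A] R →ₗ[A] M)
    (deg' : ℕ → Submodule A M) (d' : M →+ M) : Prop where
  act_one : ∀ m, act m 1 = m
  act_mul : ∀ m r s, act m (r * s) = act (act m r) s
  decomp : DirectSum.IsInternal deg'
  act_mem : ∀ {i j : ℕ} {m : M} {r : R}, m ∈ deg' i → r ∈ deg j → act m r ∈ deg' (i + j)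
  d_mem : ∀ {i : ℕ} {m : M}, m ∈ deg' i → d' m ∈ deg' (i + 1)
  d_d : ∀ m, d' (d' m) = 0
  d_act : ∀ {i : ℕ} {m : M} {r : R}, m ∈ deg' i →
    d' (act m r) = act (d' m) r + (-1 : A) ^ i • act m (d r)

section Connection

variable {A R M : Type*} [CommRing A] [Ring R] [Algebra A R] [AddCommGroup M] [Module A M]

/-- `D` is a connection on the right graded module `M`: it takes values in `M ⊗_R Ω¹_R` and
`D(m r) = m ⊗ dr + (-1)^{|r|} D(m) r`. -/
structure IsConnection (𝒢 : GrAlg A R) (act : M →ₗ[A] R →ₗ[A] M)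
    (D : M →ₗ[A] TensorForms 𝒢 act) : Prop where
  mem_form : ∀ m, D m ∈ TensorForms.form 𝒢 act 1
  leibniz : ∀ {k : ℕ} {r : R} (m : M), r ∈ 𝒢.deg k →
    D (act m r) = TensorForms.tmul 𝒢 act m (Kaehler.der 𝒢 r) +
      (-1 : A) ^ k • TensorForms.mulRight 𝒢 act (Kaehler.of 𝒢 r) (D m)

/-- `D² = 0` for the extension `m ⊗ ω ↦ m ⊗ dω + (-1)^{|ω|} D(m) ω` of `D` to
`M ⊗_R Ω^•_R`, with `|ω|` the total degree of `ω`. -/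
def IsFlat (𝒢 : GrAlg A R) (act : M →ₗ[A] R →ₗ[A] M) (D : M →ₗ[A] TensorForms 𝒢 act) : Prop :=
  ∃ D' : TensorForms 𝒢 act →ₗ[A] TensorForms 𝒢 act,
    (∀ m ω, D' (TensorForms.tmul 𝒢 act m ω) =
      TensorForms.tmul 𝒢 act m (Kaehler.d 𝒢 ω) +
        TensorForms.mulRight 𝒢 act (Kaehler.parity 𝒢 ω) (D m)) ∧
    ∀ t, D' (D' t) = 0

end Connection

variable {A L : Type*} [CommRing A] [LieRing L] [Module A L] [LieRingModule L A]
  [LieRinehartRing A L]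

/-- The graded algebra `dR_L(J_L) = Λ L^∨ ⊗ J_L`, regarded as an algebra over the subalgebra `S`
of `Λ L^∨`. For `S = ⊤` the base is the whole of `Ω_L`, for `S = ⊥` it is `A`. -/
noncomputable def drAlg (S : Subalgebra A (Forms A L)) (hS : ∀ ω ∈ S, Forms.parity ω ∈ S) :
    GrAlg A (dR A L (Jet A L)) where
  deg := dR.deg A L (Jet A L)
  parity := Algebra.TensorProduct.map Forms.parity (AlgHom.id A (Jet A L))
  parity_of_mem hr := dR.parity_of_mem_deg A L (Jet A L) hr
  base := (Subalgebra.toSubmodule S).map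
    (Algebra.TensorProduct.includeLeft (R := A) (S := A) (A := Forms A L)
      (B := Jet A L)).toLinearMap
  parity_base := by
    rintro _ ⟨ω, hω, rfl⟩
    exact ⟨Forms.parity ω, hS ω hω, by simp⟩

/-- The isomorphism `i_ν : e ⊗ r ↦ ν(e) r` from `E ⊗_A dR_L(J_L)` to `dR_L(N)` that is
induced by a map `ν : E → N`. -/
noncomputable def splitMap {E N : Type*} [AddCommGroup E] [Module A E] [AddCommGroup N]
    [Module A N] [Module (Jet A L) N] [IsScalarTower A (Jet A L) N] (ν : E →ₗ[A] N) :
    E ⊗[A] dR A L (Jet A L) →ₗ[A] dR A L N :=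
  TensorProduct.lift (dR.rmul A L N ∘ₗ TensorProduct.mk A (Forms A L) N 1 ∘ₗ ν)

/-- Every splitting `ν` of `p : N → E` gives an isomorphism `i_ν : E ⊗_A dR_L(J_L) ≅ dR_L(N)`,
and `1 ⊗ d_dR` is, under `i_ν`, a flat connection on `dR_L(N)`. -/
def SplittingGivesFlatConnection {E N : Type*} [AddCommGroup E] [Module A E] [AddCommGroup N]
    [Module A N] [Module (Jet A L) N] [IsScalarTower A (Jet A L) N]
    (𝒢 : GrAlg A (dR A L (Jet A L))) (p : N →ₗ[A] E) : Prop :=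
  (∃ ν : E →ₗ[A] N, p ∘ₗ ν = LinearMap.id) ∧
  ∀ ν : E →ₗ[A] N, p ∘ₗ ν = LinearMap.id →
    Function.Bijective (splitMap (L := L) ν) ∧
    ∃ D : dR A L N →ₗ[A] TensorForms 𝒢 (dR.rmul A L N),
      (∀ (e : E) (r : dR A L (Jet A L)), D (splitMap ν (e ⊗ₜ r)) =
        TensorForms.tmul 𝒢 (dR.rmul A L N) (1 ⊗ₜ ν e) (Kaehler.der 𝒢 r)) ∧
      IsConnection 𝒢 (dR.rmul A L N) D ∧ IsFlat 𝒢 (dR.rmul A L N) D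

end Statements

end LieAlgd

open LieAlgd
open scoped Manifold ContDiff

/-! Once `i_ν` is known to be bijective, the connection is formal. Every element of `dR_L(J_L(E))`
is then a sum of elements `ν(e) r`, and `1 ⊗ d_dR` can be transported along `i_ν`. Its Leibniz rule
is that of `d_dR`. It kills `ν(e)` because `d_dR 1 = 0`, so its extension is `ν(e) ⊗ η ↦ ν(e) ⊗ d_dR
η`, which squares to zero (`exists_flat_connection`).

Bijectivity of `i_ν` follows by tensoring with `Ω_L` from that of `J_L ⊗_A E → N`, `φ ⊗ e ↦ φ ν(e)`.
Modulo the kernel of evaluation at `1`, this map is the identity of `E`, because `p ∘ ν = id`.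
Nakayama's lemma lifts this to an isomorphism (`bijective_of_comp_eq`), for two reasons. The kernel
of `J_L → A` lies in the Jacobson radical (`Jet.ker_evalOne_le_jacobson`): if `χ(1) = 0`, the powers
of `χ` eventually vanish on any given `D`, so `∑ χ^j` makes sense pointwise and inverts `1 - χ`. And
both modules are finite over `J_L`, with `N` projective. `IsJetFibre` collects what is needed of
`N`; both kinds of jets satisfy it through explicit dual bases.

These dual bases come from a finite dual basis of `Γ(X, E)` (`exists_sections_dualBasis`). As `X`
need not be compact, this requires a finite trivialising cover, whose members are disjoint unions of
small open sets (`exists_finite_disjoint_cover`). Dimension theory gives `n + 1` members: `n + 1`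
smooth functions map `X` onto a null set of `ℝ^(n+1)`, so for generic levels no point lies on `n +
1` level sets.

For the dg structures, a finite dual basis of `Γ(X, L)` lets contractions detect forms of positive
degree. Hence `d² = 0` may be checked on sections of `L`, where it reduces to the Jacobi identity,
the compatibility of anchor and bracket, and flatness. -/

namespace LieAlgd

/-! ### Finite covers of a manifold by disjoint unions of small open sets. -/

section FiniteCover

open Set MeasureTheory Topology
open scoped Manifold ContDiff

variable {n : ℕ} {X : Type*} [TopologicalSpace X] [SecondCountableTopology X]
  [ChartedSpace (EuclideanSpace ℝ (Fin n)) X] [IsManifold (𝓡 n) ∞ X]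

/-- The image of an `n`-manifold under a smooth map has Hausdorff dimension at most `n`. -/
lemma dimH_range_le_of_contMDiff {E : Type*} [NormedAddCommGroup E] [NormedSpace ℝ E]
    {f : X → E} (hf : ContMDiff (𝓡 n) 𝓘(ℝ, E) ∞ f) : dimH (range f) ≤ n := by
  -- Countably many charts suffice, and in each of them the map is `C^1`, hence locally Lipschitz,
  -- so it does not raise the dimension of the chart.
  obtain ⟨s, hs, hcov⟩ := TopologicalSpace.countable_cover_nhds
    (fun x : X => chart_source_mem_nhds (EuclideanSpace ℝ (Fin n)) x)
  have hsub : range f ⊆ ⋃ x ∈ s, (f ∘ (chartAt (EuclideanSpace ℝ (Fin n)) x).symm) ''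
      (chartAt (EuclideanSpace ℝ (Fin n)) x).target := by
    rintro _ ⟨y, rfl⟩
    have hy : y ∈ ⋃ x ∈ s, (chartAt (EuclideanSpace ℝ (Fin n)) x).source := hcov ▸ mem_univ y
    simp only [mem_iUnion, exists_prop] at hy ⊢
    obtain ⟨x, hx, hyx⟩ := hy
    exact ⟨x, hx, _, (chartAt _ x).map_source hyx, congrArg f ((chartAt _ x).left_inv hyx)⟩
  refine (dimH_mono hsub).trans ?_
  rw [dimH_bUnion hs]
  refine iSup₂_le fun x _ => ?_
  refine (dimH_image_le_of_locally_lipschitzOn fun y hy => ?_).trans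
    ((dimH_mono (subset_univ _)).trans ?_)
  · have h1 : ContMDiffAt (𝓡 n) (𝓡 n) ∞ (chartAt (EuclideanSpace ℝ (Fin n)) x).symm y :=
      (contMDiffOn_chart_symm (I := 𝓡 n) (n := ∞) (x := x)).contMDiffAt
        ((chartAt _ x).open_target.mem_nhds hy)
    have h2 : ContDiffAt ℝ 1 (f ∘ (chartAt (EuclideanSpace ℝ (Fin n)) x).symm) y :=
      (contMDiffAt_iff_contDiffAt.mp (hf.contMDiffAt.comp y h1)).of_le (by simp)
    obtain ⟨K, t, ht, hK⟩ := h2.exists_lipschitzOnWith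
    exact ⟨K, t, mem_nhdsWithin_of_mem_nhds ht, hK⟩
  · rw [Real.dimH_univ_eq_finrank]; simp

/-- For countably many smooth functions on an `n`-manifold there are levels in `[0, 1]` such that
no point lies on `n + 1` of the level sets. -/
lemma exists_generic_levels {ι : Type*} [Countable ι] (f : ι → X → ℝ)
    (hf : ∀ i, ContMDiff (𝓡 n) 𝓘(ℝ, ℝ) ∞ (f i)) :
    ∃ r : ι → ℝ, (∀ i, r i ∈ Icc (0 : ℝ) 1) ∧
      ∀ J : Finset ι, J.card = n + 1 → ∀ x, ∃ i ∈ J, f i x ≠ r i := by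
  -- The levels are drawn independently and uniformly from `[0, 1]`. Each condition holds almost
  -- surely, and there are only countably many of them.
  let ν : Measure ℝ := volume.restrict (Icc 0 1)
  have : IsProbabilityMeasure ν := ⟨by simp [ν]⟩
  let μ : Measure (ι → ℝ) := Measure.infinitePi fun _ => ν
  have h1 : ∀ i, ∀ᵐ r ∂μ, r i ∈ Icc (0 : ℝ) 1 := fun i => by
    have h : ∀ᵐ t ∂(μ.map fun r => r i), t ∈ Icc (0 : ℝ) 1 := by
      rw [show μ.map (fun r => r i) = ν from Measure.infinitePi_map_eval _ i]
      exact ae_restrict_mem measurableSet_Icc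
    exact ae_of_ae_map (measurable_pi_apply i).aemeasurable h
  have h2 : ∀ J : Finset ι, J.card = n + 1 → ∀ᵐ r ∂μ,
      (fun i : J => r i) ∉ range fun (x : X) (i : J) => f i x := fun J hJ => by
    have : Nonempty J := Finset.Nonempty.to_subtype (Finset.card_pos.mp (by omega))
    -- The image has dimension at most `n` in a space of dimension `n + 1`.
    have h0 : volume (range fun (x : X) (i : J) => f i x) = 0 := by
      rw [← hausdorffMeasure_pi_real, Fintype.card_coe, hJ]
      refine hausdorffMeasure_of_dimH_lt (d := ((n + 1 : ℕ) : NNReal)) ?_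
      refine (dimH_range_le_of_contMDiff (f := fun (x : X) (i : J) => f i x)
        (contMDiff_pi_space.mpr fun i => hf i)).trans_lt ?_
      exact_mod_cast Nat.lt_succ_self n
    have h : ∀ᵐ t ∂(μ.map fun r (i : J) => r i), t ∉ range fun (x : X) (i : J) => f i x := by
      rw [show μ.map (fun r (i : J) => r i) = Measure.pi fun _ => ν from Measure.infinitePi_map_restrict _,
        ← Measure.restrict_pi_pi]
      exact (Measure.absolutelyContinuous_of_le Measure.restrict_le_self).ae_le
        (measure_eq_zero_iff_ae_notMem.mp h0)
    exact ae_of_ae_map (Finset.measurable_restrict J).aemeasurable h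
  have h3 : ∀ᵐ r ∂μ, ∀ J : Finset ι, J.card = n + 1 →
      (fun i : J => r i) ∉ range fun (x : X) (i : J) => f i x :=
    ae_all_iff.mpr fun J => by
      by_cases hJ : J.card = n + 1
      · filter_upwards [h2 J hJ] with r hr _ using hr
      · exact Filter.Eventually.of_forall fun r h => absurd h hJ
  obtain ⟨r, hr, hr'⟩ := ((ae_all_iff.mpr h1).and h3).exists
  refine ⟨r, hr, fun J hJ x => ?_⟩
  by_contra! hx
  exact hr' J hJ ⟨x, funext fun i => hx i i.2⟩

variable [T2Space X]

omit [SecondCountableTopology X] [IsManifold (𝓡 n) ∞ X] [T2Space X]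
  [ChartedSpace (EuclideanSpace ℝ (Fin n)) X] in
-- The infinitely many conditions on `k ∉ J` are locally finite in number: near a point all but
-- finitely many `k` have `|f k - r k| ≥ 1`, which the bound `|f i - r i| < 1` already beats.
lemma isOpen_of_dominated {ι : Type*} {f : ι → X → ℝ} {r : ι → ℝ} (hf : ∀ i, Continuous (f i))
    (hlf : LocallyFinite fun i => {x | |f i x - r i| < 1}) (J : Finset ι) :
    IsOpen {x | ∀ i ∈ J, |f i x - r i| < 1 ∧ ∀ k ∉ J, |f i x - r i| < |f k x - r k|} := by
  classical
  have hc : ∀ i, Continuous fun x => |f i x - r i| := fun i => ((hf i).sub continuous_const).abs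
  simp only [Set.ofPred_forall]
  refine isOpen_biInter_finset fun i hi => ?_
  rw [isOpen_iff_mem_nhds]
  rintro x ⟨hx, hxk⟩
  obtain ⟨N, hN, hfin⟩ := hlf x
  have h1 : ∀ᶠ y in 𝓝 x, |f i y - r i| < 1 := (hc i).continuousAt.eventually_lt_const hx
  have h2 : ∀ᶠ y in 𝓝 x, ∀ k ∈ hfin.toFinset.filter (· ∉ J),
      |f i y - r i| < |f k y - r k| := by
    rw [Filter.eventually_all_finset]
    intro k hk
    exact (hc i).continuousAt.eventually_lt (hc k).continuousAt (hxk k (Finset.mem_filter.mp hk).2)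
  filter_upwards [hN, h1, h2] with y hyN hy1 hy2
  refine ⟨hy1, fun k hk => ?_⟩
  by_cases hkf : |f k y - r k| < 1
  · exact hy2 k (Finset.mem_filter.mpr ⟨hfin.mem_toFinset.mpr ⟨y, hkf, hyN⟩, hk⟩)
  · exact hy1.trans_le (not_lt.mp hkf)

variable (n) in
/-- An `n`-manifold has a cover by `n + 1` open sets, each of which is a disjoint union of open
sets subordinate to a given family of neighbourhoods. -/
theorem exists_finite_disjoint_cover (U : X → Set X) (hU : ∀ x, U x ∈ 𝓝 x) :
    ∃ W : ℕ → Set (Set X), (∀ c, ∀ w ∈ W c, IsOpen w ∧ ∃ x, w ⊆ U x) ∧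
      (∀ c, (W c).PairwiseDisjoint id) ∧ ∀ x, ∃ c < n + 1, x ∈ ⋃₀ W c := by
  have : LocallyCompactSpace X := ChartedSpace.locallyCompactSpace (EuclideanSpace ℝ (Fin n)) X
  obtain ⟨ι, b, hb⟩ := SmoothBumpCovering.exists_isSubordinate (𝓡 n) isClosed_univ
    (fun x (_ : x ∈ univ) => hU x)
  have hι : Countable ι := by
    have h := b.locallyFinite.countable_univ
      (fun i => ⟨b.c i, by simp [Function.mem_support, SmoothBumpFunction.eq_one]⟩)
    exact Set.countable_univ_iff.mp h
  obtain ⟨e, he⟩ := exists_injective_nat ι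
  -- With levels in `[0, 1]`, the value `-1` off the support of `b i` stays at distance at least `1`
  -- below the level, and the value `2` where `b i = 1` lies above it.
  let f : ι → X → ℝ := fun i x => 3 * b i x - 1
  have hf : ∀ i, ContMDiff (𝓡 n) 𝓘(ℝ, ℝ) ∞ (f i) := fun i =>
    (contMDiff_const.mul (b i).contMDiff).sub contMDiff_const
  obtain ⟨r, hr, hgen⟩ := exists_generic_levels f hf
  have hsupp : ∀ i x, |f i x - r i| < 1 → b i x ≠ 0 := by
    intro i x h h0
    have h1 := (hr i).1
    rw [abs_lt] at h
    simp only [f, h0] at h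
    linarith
  have hsub : ∀ i x, b i x ≠ 0 → x ∈ U (b.c i) := fun i x h => hb i (subset_closure h)
  -- Here `T` is the first index whose function exceeds its level, and the earlier ones lie strictly
  -- below theirs. These sets reach every point that lies on no level set.
  let O : ι → Set X := fun T => {x | r T < f T x ∧ ∀ i, e i < e T → f i x < r i}
  -- `J` consists of the indices nearest to their levels. These sets reach the points whose level
  -- sets are exactly those indexed by a nonempty `J`.
  let D : Finset ι → Set X := fun J =>
    {x | ∀ i ∈ J, |f i x - r i| < 1 ∧ ∀ k ∉ J, |f i x - r i| < |f k x - r k|}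
  refine ⟨fun c => if c = 0 then range O else D '' {J | J.card = c}, ?_, ?_, ?_⟩
  · intro c w hw
    simp only at hw
    split_ifs at hw with hc
    · obtain ⟨T, rfl⟩ := hw
      refine ⟨?_, b.c T, fun x hx => hsub T x fun h0 => ?_⟩
      · have hfin : {i | e i < e T}.Finite := (Set.finite_lt_nat (e T)).preimage he.injOn
        have : O T = {x | r T < f T x} ∩ ⋂ i ∈ {i | e i < e T}, {x | f i x < r i} := by
          ext x; simp [O]
        rw [this]
        exact (isOpen_lt continuous_const (hf T).continuous).inter
          (hfin.isOpen_biInter fun i _ => isOpen_lt (hf i).continuous continuous_const)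
      · have h1 := hx.1
        have h2 := (hr T).1
        simp only [f, h0] at h1
        linarith
    · obtain ⟨J, hJ, rfl⟩ := hw
      refine ⟨isOpen_of_dominated (fun i => (hf i).continuous)
        (b.locallyFinite.subset fun i x hx => hsupp i x hx) J, ?_⟩
      obtain ⟨i, hi⟩ : J.Nonempty := Finset.card_pos.mp (by rw [hJ]; omega)
      exact ⟨b.c i, fun x hx => hsub i x (hsupp i x (hx i hi).1)⟩
  · intro c w hw w' hw' hne
    rw [Function.onFun, Set.disjoint_left]
    intro x hx hx'
    apply hne
    simp only at hw hw'
    split_ifs at hw hw' with hc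
    · obtain ⟨T, rfl⟩ := hw
      obtain ⟨T', rfl⟩ := hw'
      rcases lt_trichotomy (e T) (e T') with h | h | h
      · exact absurd (hx.1.trans (hx'.2 T h)) (lt_irrefl _)
      · rw [he h]
      · exact absurd (hx'.1.trans (hx.2 T' h)) (lt_irrefl _)
    · obtain ⟨J, hJ, rfl⟩ := hw
      obtain ⟨J', hJ', rfl⟩ := hw'
      by_cases h : J ⊆ J'
      · rw [Finset.eq_of_subset_of_card_le h (by rw [hJ, hJ'])]
      · by_cases h' : J' ⊆ J
        · rw [Finset.eq_of_subset_of_card_le h' (by rw [hJ, hJ'])]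
        · obtain ⟨i, hi, hi'⟩ := Finset.not_subset.mp h
          obtain ⟨k, hk, hk'⟩ := Finset.not_subset.mp h'
          exact absurd (((hx i hi).2 k hk').trans ((hx' k hk).2 i hi')) (lt_irrefl _)
  · intro x
    have hfin : {i | f i x = r i}.Finite := by
      refine (b.locallyFinite.point_finite x).subset fun i hi => hsupp i x ?_
      rw [Set.mem_ofPred_eq] at hi
      simp [hi]
    by_cases hJ : hfin.toFinset = ∅
    · have hne : ∀ i, f i x ≠ r i := fun i hi => by
        have : i ∈ hfin.toFinset := hfin.mem_toFinset.mpr hi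
        rw [hJ] at this
        exact absurd this (Finset.notMem_empty i)
      have hex : ∃ T, r T < f T x := by
        obtain ⟨i, hi⟩ := b.eventuallyEq_one' x (mem_univ x)
        refine ⟨i, ?_⟩
        have h1 : b i x = 1 := hi.eq_of_nhds
        have h2 := (hr i).2
        simp only [f, h1]
        linarith
      obtain ⟨T, hT, hmin⟩ := (measure e).wf.has_min {T | r T < f T x} hex
      refine ⟨0, by omega, O T, by simp, hT, fun i hi => ?_⟩
      exact lt_of_le_of_ne (not_lt.mp fun h => hmin i h hi) (hne i)
    · have hpos : hfin.toFinset.card ≠ 0 := fun h => hJ (Finset.card_eq_zero.mp h)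
      -- Genericity bounds the number of level sets through `x` by `n`, so together with the class
      -- `0` there are `n + 1` classes.
      refine ⟨hfin.toFinset.card, ?_, D hfin.toFinset, ?_, ?_⟩
      · by_contra! hlt
        obtain ⟨J, hJs, hJc⟩ := Finset.exists_subset_card_eq hlt
        obtain ⟨i, hi, hne⟩ := hgen J hJc x
        exact hne (hfin.mem_toFinset.mp (hJs hi))
      · simp only [if_neg hpos]
        exact ⟨_, rfl, rfl⟩
      · intro i hi
        have hi' : f i x = r i := hfin.mem_toFinset.mp hi
        rw [hi', sub_self, abs_zero]
        exact ⟨one_pos, fun k hk => abs_pos.mpr (sub_ne_zero.mpr fun h =>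
          hk (hfin.mem_toFinset.mpr h))⟩

end FiniteCover

/-! ### Sections of a vector bundle form a finitely generated projective module. -/

section DualFamily

open Bundle Topology Module
open scoped Manifold ContDiff

variable {n : ℕ} {X : Type*} [TopologicalSpace X] [ChartedSpace (EuclideanSpace ℝ (Fin n)) X]
  [IsManifold (𝓡 n) ∞ X]
  {F : Type*} [NormedAddCommGroup F] [NormedSpace ℝ F] {V : X → Type*}
  [TopologicalSpace (TotalSpace F V)] [∀ x, TopologicalSpace (V x)] [∀ x, AddCommGroup (V x)]
  [∀ x, Module ℝ (V x)] [FiberBundle F V] [VectorBundle ℝ F V]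
  [ContMDiffVectorBundle ∞ F V (𝓡 n)] {ι : Type*}

omit [IsManifold (𝓡 n) ∞ X] in
/-- A bundle has a frame with smooth coefficients over a disjoint union of open sets over which
it is trivial. -/
lemma exists_isLocalFrameOn_sUnion [FiniteDimensional ℝ F] (b : Basis ι ℝ F) {W : Set (Set X)}
    (hW : ∀ w ∈ W, IsOpen w ∧ ∃ x, w ⊆ (trivializationAt F V x).baseSet)
    (hd : W.PairwiseDisjoint id) :
    ∃ (e : ι → (x : X) → V x) (he : IsLocalFrameOn (𝓡 n) F ∞ e (⋃₀ W)),
      ∀ (s : Sections n F V) (i : ι),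
        ContMDiffOn (𝓡 n) 𝓘(ℝ, ℝ) ∞ (fun x => he.coeff i x (s x)) (⋃₀ W) := by
  classical
  choose ho c hc using hW
  -- Disjointness makes the piece containing `x` unique, so on each piece `w` the choice is the
  -- frame of one fixed trivialisation. The value `0` is used only off the union.
  let e : ι → (x : X) → V x := fun i x =>
    if h : ∃ w ∈ W, x ∈ w then (trivializationAt F V (c h.choose h.choose_spec.1)).localFrame b i x else 0
  have hex : ∀ w (hw : w ∈ W), ∀ x ∈ w, ∀ i, e i x = (trivializationAt F V (c w hw)).localFrame b i x := by
    intro w hw x hx i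
    have h : ∃ w ∈ W, x ∈ w := ⟨w, hw, hx⟩
    have hcw : h.choose = w := by
      by_contra hne
      exact Set.disjoint_left.mp (hd h.choose_spec.1 hw hne) h.choose_spec.2 hx
    have hcongr : ∀ w' (hw' : w' ∈ W), w' = w →
        (trivializationAt F V (c w' hw')).localFrame b i x =
          (trivializationAt F V (c w hw)).localFrame b i x := by
      rintro _ _ rfl; rfl
    simp only [e, dif_pos h]
    exact hcongr _ _ hcw
  have hfr : ∀ w (hw : w ∈ W), IsLocalFrameOn (𝓡 n) F ∞ ((trivializationAt F V (c w hw)).localFrame b) w :=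
    fun w hw => ((trivializationAt F V (c w hw)).isLocalFrameOn_localFrame_baseSet (𝓡 n) ∞ b).mono
      (hc w hw)
  have hew : ∀ w ∈ W, IsLocalFrameOn (𝓡 n) F ∞ e w := fun w hw =>
    (hfr w hw).congr fun i x hx => (hex w hw x hx i).symm
  have he : IsLocalFrameOn (𝓡 n) F ∞ e (⋃₀ W) :=
    { linearIndependent := by
        rintro x ⟨w, hw, hx⟩
        exact (hew w hw).linearIndependent hx
      generating := by
        rintro x ⟨w, hw, hx⟩
        exact (hew w hw).generating hx
      contMDiffOn := by
        rintro i x ⟨w, hw, hx⟩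
        exact ((hew w hw).contMDiffAt (ho w hw) hx i).contMDiffWithinAt }
  refine ⟨e, he, fun s i => ?_⟩
  rintro x ⟨w, hw, hx⟩
  refine ContMDiffAt.contMDiffWithinAt ?_
  refine (contMDiffAt_localFrameCoeff (e := trivializationAt F V (c w hw)) b (hc w hw hx)
    s.contMDiff.contMDiffAt i).congr_of_eventuallyEq ?_
  filter_upwards [(ho w hw).mem_nhds hx] with y hy
  let hf := (trivializationAt F V (c w hw)).isLocalFrameOn_localFrame_baseSet (𝓡 n) 1 b
  have hyW : y ∈ ⋃₀ W := Set.mem_sUnion_of_mem hy hw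
  have hb : he.toBasisAt hyW = hf.toBasisAt (hc w hw hy) :=
    Basis.eq_of_apply_eq fun i => by
      rw [IsLocalFrameOn.toBasisAt_coe, IsLocalFrameOn.toBasisAt_coe, hex w hw y hy]
  have h1 := he.coeff_apply_of_mem hyW (fun x => s x) i
  rw [hb] at h1
  exact h1.trans (hf.coeff_apply_of_mem (hc w hw hy) (fun x => s x) i).symm

variable (n F V)
variable [T2Space X] [SecondCountableTopology X] [FiniteDimensional ℝ F]

/-- The smooth sections of a vector bundle over a manifold have a finite dual basis. -/
theorem exists_sections_dualBasis :
    ∃ (m : ℕ) (b : Fin m → Sections n F V)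
      (β : Fin m → Module.Dual (SmoothFun n X) (Sections n F V)),
      ∀ s, ∑ i, β i s • b i = s := by
  have : LocallyCompactSpace X := ChartedSpace.locallyCompactSpace (EuclideanSpace ℝ (Fin n)) X
  obtain ⟨W, hW, hd, hcov⟩ := exists_finite_disjoint_cover n
    (fun x : X => (trivializationAt F V x).baseSet)
    (fun x => (trivializationAt F V x).open_baseSet.mem_nhds
      (FiberBundle.mem_baseSet_trivializationAt' x))
  choose e he hsm using fun c => exists_isLocalFrameOn_sUnion (n := n) (F := F) (V := V)
    (finBasis ℝ F) (hW c) (hd c)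
  have hopen : ∀ c, IsOpen (⋃₀ W c) := fun c => isOpen_sUnion fun w hw => (hW c w hw).1
  obtain ⟨ρ, hρ⟩ := SmoothPartitionOfUnity.exists_isSubordinate (𝓡 n) isClosed_univ
    (fun c : Fin (n + 1) => ⋃₀ W c) (fun c => hopen c) (fun x _ => by
      obtain ⟨c, hc, hx⟩ := hcov x
      exact Set.mem_iUnion.mpr ⟨⟨c, hc⟩, hx⟩)
  -- Both the sections and the linear forms need a cut-off in order to be globally smooth. So each
  -- point is weighted by squares, normalised by `q`, which vanishes nowhere as the `ρ c` sum to
  -- `1`.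
  let q : X → ℝ := fun x => ∑ c, ρ c x ^ 2
  have hq : ∀ x, q x ≠ 0 := by
    intro x h0
    have h1 := (Finset.sum_eq_zero_iff_of_nonneg fun c _ => sq_nonneg (ρ c x)).mp h0
    have h2 : ∑ᶠ c, ρ c x = 1 := ρ.sum_eq_one (Set.mem_univ x)
    rw [finsum_eq_sum_of_fintype, Finset.sum_eq_zero fun c hc => by simpa using h1 c hc] at h2
    exact zero_ne_one h2
  have hqs : ContMDiff (𝓡 n) 𝓘(ℝ, ℝ) ∞ q := contMDiff_finsetSum fun c _ => (ρ c).contMDiff.pow 2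
  let τ : Fin (n + 1) → X → ℝ := fun c x => ρ c x * (q x)⁻¹
  have hτs : ∀ c, ContMDiff (𝓡 n) 𝓘(ℝ, ℝ) ∞ (τ c) := fun c =>
    (ρ c).contMDiff.mul (hqs.inv₀ hq)
  have hτ : ∀ c, tsupport (τ c) ⊆ ⋃₀ W c := fun c =>
    (closure_mono (Function.support_mul_subset_left _ _)).trans (hρ c)
  let κ := Fin (n + 1) × Fin (finrank ℝ F)
  let b : κ → Sections n F V := fun k =>
    ⟨fun x => ρ k.1 x • e k.1 k.2 x, (ρ k.1).contMDiff.contMDiffOn.smul_section_of_tsupport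
      (hopen k.1) (hρ k.1) ((he k.1).contMDiffOn k.2)⟩
  let β : κ → Module.Dual (SmoothFun n X) (Sections n F V) := fun k =>
    { toFun := fun s => ⟨fun x => τ k.1 x * (he k.1).coeff k.2 x (s x), by
        refine contMDiff_of_tsupport fun x hx => ?_
        have hx' := hτ k.1 (closure_mono (Function.support_mul_subset_left _ _) hx)
        exact (hτs k.1).contMDiffAt.mul
          ((hsm k.1 s k.2).contMDiffAt ((hopen k.1).mem_nhds hx'))⟩
      map_add' := fun s t => by
        ext x
        change _ * (he k.1).coeff k.2 x (s x + t x) = _ * _ + _ * _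
        rw [map_add, mul_add]
      map_smul' := fun f s => by
        ext x
        change _ * (he k.1).coeff k.2 x (f x • s x) = f x * (_ * _)
        rw [map_smul, smul_eq_mul, mul_left_comm] }
  have key : ∀ s, ∑ k, β k s • b k = s := by
    intro s
    ext x
    have h1 : (∑ k, β k s • b k) x = ∑ k, (β k s • b k) x :=
      (congrFun (map_sum (ContMDiffSection.coeAddHom (𝓡 n) F ∞ V) _ _) x).trans
        (Finset.sum_apply _ _ _)
    have h2 : ∀ c : Fin (n + 1), ∑ i, (β (c, i) s • b (c, i)) x = (τ c x * ρ c x) • s x := by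
      intro c
      have h3 : ∀ i, (β (c, i) s • b (c, i)) x =
          (τ c x * ρ c x) • ((he c).coeff i x (s x) • e c i x) := fun i => by
        change (τ c x * (he c).coeff i x (s x)) • ρ c x • e c i x = _
        rw [smul_smul, smul_smul]
        congr 1
        ring
      simp only [h3, ← Finset.smul_sum]
      by_cases hx : x ∈ ⋃₀ W c
      · rw [← (he c).coeff_sum_eq (fun x => s x) hx]
      -- Off the trivialising set the frame coefficients carry no information, but the cut-off
      -- removes them from both sides.
      · have : ρ c x = 0 := by
          by_contra h
          exact hx (hρ c (subset_closure h))
        rw [this, mul_zero, zero_smul, zero_smul]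
    rw [h1, Fintype.sum_prod_type]
    simp only [h2, ← Finset.sum_smul]
    have h4 : ∑ c, τ c x * ρ c x = 1 := by
      have : ∀ c, τ c x * ρ c x = ρ c x ^ 2 * (q x)⁻¹ := fun c => by simp only [τ]; ring
      simp only [this, ← Finset.sum_mul]
      exact mul_inv_cancel₀ (hq x)
    rw [h4, one_smul]
  let ε := Fintype.equivFin κ
  refine ⟨Fintype.card κ, b ∘ ε.symm, β ∘ ε.symm, fun s => ?_⟩
  exact (Equiv.sum_comp ε.symm fun k => β k s • b k).trans (key s)

end DualFamily

/-! ### The augmentation ideal of the jet algebra lies in the Jacobson radical. -/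

section JetRadical

variable {A L : Type*} [CommRing A] [LieRing L] [Module A L] [LieRingModule L A]
  [LieRinehartRing A L]

namespace Jet

lemma add_apply (φ ψ : Jet A L) (D : UEnv A L) : (φ + ψ) D = φ D + ψ D := rfl

@[simp] lemma mul_apply_one (φ ψ : Jet A L) : (φ * ψ) 1 = φ 1 * ψ 1 := by
  rw [mul_apply, UEnv.comul_one]; rfl

@[simp] lemma one_apply_one : (1 : Jet A L) 1 = 1 := by
  rw [← map_one (algebraMap A (Jet A L)), algebraMap_apply, UEnv.counit_one, mul_one]

variable (A L) in
/-- Evaluation at `1`, the projection `J_L → A`. -/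
noncomputable def evalOne : Jet A L →ₐ[A] A where
  toFun φ := φ 1
  map_one' := one_apply_one
  map_mul' := mul_apply_one
  map_zero' := rfl
  map_add' _ _ := rfl
  commutes' a := by rw [algebraMap_apply, UEnv.counit_one, one_mul]; rfl

/-- Solving the definition of `∇_x` for the last term expresses a jet on a longer element through
values of the jet and its derivative on a shorter one. This is the recursion behind orders of
vanishing. -/
lemma apply_inL_mul (φ : Jet A L) (x : L) (D : UEnv A L) :
    φ (UEnv.inL A L x * D) = ⁅x, φ D⁆ - (FlatConn.jet A L).nabla x φ D := by
  rw [FlatConn.jet_apply, sub_sub_cancel]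

/-- `VanishesTo k φ`: the jet `φ` vanishes to order `k`. -/
def VanishesTo : ℕ → Jet A L → Prop
  | 0, _ => True
  | k + 1, φ => φ 1 = 0 ∧ ∀ x, VanishesTo k ((FlatConn.jet A L).nabla x φ)

lemma VanishesTo.of_succ {k : ℕ} {φ : Jet A L} (h : VanishesTo (k + 1) φ) : VanishesTo k φ := by
  induction k generalizing φ with
  | zero => trivial
  | succ k ih => exact ⟨h.1, fun x => ih (h.2 x)⟩

lemma VanishesTo.mono {k l : ℕ} (hkl : k ≤ l) {φ : Jet A L} (h : VanishesTo l φ) :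
    VanishesTo k φ := by
  induction hkl with
  | refl => exact h
  | step _ ih => exact ih h.of_succ

lemma VanishesTo.add {k : ℕ} {φ ψ : Jet A L} (h : VanishesTo k φ) (h' : VanishesTo k ψ) :
    VanishesTo k (φ + ψ) := by
  induction k generalizing φ ψ with
  | zero => trivial
  | succ k ih =>
    refine ⟨by rw [add_apply, h.1, h'.1, add_zero], fun x => ?_⟩
    rw [map_add]
    exact ih (h.2 x) (h'.2 x)

lemma VanishesTo.mul_left {k : ℕ} (φ : Jet A L) {ψ : Jet A L} (h : VanishesTo k ψ) :
    VanishesTo k (φ * ψ) := by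
  induction k generalizing φ ψ with
  | zero => trivial
  | succ k ih =>
    refine ⟨by rw [mul_apply_one, h.1, mul_zero], fun x => ?_⟩
    rw [FlatConn.jet_mul]
    exact (ih _ h.of_succ).add (ih _ (h.2 x))

/-- In `∇_x(χ ψ) = ∇_x(χ) ψ + χ ∇_x(ψ)` the first term keeps the order of `ψ`, and the second
regains by induction the order that differentiation lost. -/
lemma VanishesTo.mul {k : ℕ} {χ ψ : Jet A L} (hχ : χ 1 = 0) (h : VanishesTo k ψ) :
    VanishesTo (k + 1) (χ * ψ) := by
  induction k generalizing ψ with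
  | zero => exact ⟨by rw [mul_apply_one, hχ, zero_mul], fun _ => trivial⟩
  | succ k ih =>
    refine ⟨by rw [mul_apply_one, hχ, zero_mul], fun x => ?_⟩
    rw [FlatConn.jet_mul]
    exact (h.mul_left _).add (ih (h.2 x))

lemma vanishesTo_pow {χ : Jet A L} (hχ : χ 1 = 0) (k : ℕ) : VanishesTo k (χ ^ k) := by
  induction k with
  | zero => trivial
  | succ k ih => rw [pow_succ']; exact ih.mul hχ

/-- Every element of `U_L` involves products of boundedly many elements of `L`, and each left factor
from `L` costs one order of vanishing. -/
lemma exists_apply_eq_zero (D : UEnv A L) :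
    ∃ k, ∀ φ : Jet A L, VanishesTo k φ → φ D = 0 := by
  induction D using UEnv.induction with
  | one => exact ⟨1, fun φ h => h.1⟩
  | add D E hD hE =>
    obtain ⟨k, hk⟩ := hD
    obtain ⟨l, hl⟩ := hE
    refine ⟨max k l, fun φ h => ?_⟩
    change φ.ofConv (D + E) = 0
    rw [map_add]
    change φ D + φ E = 0
    rw [hk φ (h.mono (le_max_left _ _)), hl φ (h.mono (le_max_right _ _)), add_zero]
  | smul a D hD =>
    obtain ⟨k, hk⟩ := hD
    refine ⟨k, fun φ h => ?_⟩
    change φ.ofConv (a • D) = 0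
    rw [map_smul]
    change a • φ D = 0
    rw [hk φ h, smul_zero]
  | inL_mul x D hD =>
    obtain ⟨k, hk⟩ := hD
    refine ⟨k + 1, fun φ h => ?_⟩
    rw [apply_inL_mul, hk φ h.of_succ, hk _ (h.2 x), lie_zero, sub_zero]

lemma sum_apply {ι : Type*} (s : Finset ι) (φ : ι → Jet A L) (D : UEnv A L) :
    (∑ i ∈ s, φ i) D = ∑ i ∈ s, φ i D := by
  classical
  induction s using Finset.induction_on with
  | empty => rfl
  | insert i s hi ih => rw [Finset.sum_insert hi, Finset.sum_insert hi, add_apply, ih]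

lemma exists_pow_apply_eq_zero {χ : Jet A L} (hχ : χ 1 = 0) (D : UEnv A L) :
    ∃ k, ∀ j ≥ k, (χ ^ j) D = 0 := by
  obtain ⟨k, hk⟩ := exists_apply_eq_zero D
  exact ⟨k, fun j hj => hk _ ((vanishesTo_pow hχ j).mono hj)⟩

/-- On a fixed `D` only finitely many powers contribute. The bound depends on `D`, so the series
converges pointwise although no power of `χ` need vanish. -/
lemma exists_geomSum_apply_eq {χ : Jet A L} (hχ : χ 1 = 0) (D : UEnv A L) :
    ∃ k, ∀ m ≥ k, (∑ j ∈ Finset.range m, χ ^ j) D = ∑ᶠ j, (χ ^ j) D := by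
  obtain ⟨k, hk⟩ := exists_pow_apply_eq_zero hχ D
  refine ⟨k, fun m hm => ?_⟩
  rw [sum_apply, finsum_eq_sum_of_support_subset]
  intro j hj
  rw [Function.mem_support] at hj
  rw [Finset.coe_range, Set.mem_Iio]
  by_contra! h
  exact hj (hk j (hm.trans h))

/-- The geometric series `∑ χ^j` of a jet with `χ(1) = 0`. -/
noncomputable def geomSeries {χ : Jet A L} (hχ : χ 1 = 0) : Jet A L :=
  WithConv.toConv
    { toFun := fun D => ∑ᶠ j, (χ ^ j) D
      map_add' := fun D E => by
        -- Truncating all the series involved at a common stage reduces linearity to that of a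
        -- finite sum of jets.
        obtain ⟨k, hk⟩ := exists_geomSum_apply_eq hχ D
        obtain ⟨l, hl⟩ := exists_geomSum_apply_eq hχ E
        obtain ⟨m, hm⟩ := exists_geomSum_apply_eq hχ (D + E)
        rw [← hk (max (max k l) m) (by simp), ← hl (max (max k l) m) (by simp),
          ← hm (max (max k l) m) (by simp)]
        exact map_add (WithConv.ofConv _) D E
      map_smul' := fun a D => by
        obtain ⟨k, hk⟩ := exists_geomSum_apply_eq hχ D
        obtain ⟨m, hm⟩ := exists_geomSum_apply_eq hχ (a • D)
        rw [← hk (max k m) (by simp), ← hm (max k m) (by simp)]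
        exact map_smul (WithConv.ofConv _) a D }

lemma exists_geomSum_apply_eq_geomSeries {χ : Jet A L} (hχ : χ 1 = 0) (D : UEnv A L) :
    ∃ k, ∀ m ≥ k, (∑ j ∈ Finset.range m, χ ^ j) D = geomSeries hχ D :=
  exists_geomSum_apply_eq hχ D

/-- Multiplication is continuous for pointwise stabilisation: a product evaluated at `D` sees the
second factor only on the finitely many components of the coproduct of `D`. -/
lemma exists_mul_geomSum_apply_eq {χ : Jet A L} (hχ : χ 1 = 0) (φ : Jet A L) (D : UEnv A L) :
    ∃ k, ∀ m ≥ k, (φ * ∑ j ∈ Finset.range m, χ ^ j) D = (φ * geomSeries hχ) D := by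
  simp only [mul_apply]
  generalize (Coalgebra.comul D : UEnv A L ⊗[A] UEnv A L) = t
  induction t with
  | zero => exact ⟨0, fun m _ => by simp only [map_zero]⟩
  | add s t hs ht =>
    obtain ⟨k, hk⟩ := hs
    obtain ⟨l, hl⟩ := ht
    refine ⟨max k l, fun m hm => ?_⟩
    simp only [map_add, hk m (le_of_max_le_left hm), hl m (le_of_max_le_right hm)]
  | tmul D E =>
    obtain ⟨k, hk⟩ := exists_geomSum_apply_eq_geomSeries hχ E
    refine ⟨k, fun m hm => ?_⟩
    simp only [TensorProduct.map_tmul, LinearMap.mul'_apply]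
    exact congrArg (φ D * ·) (hk m hm)

lemma one_sub_mul_geomSeries {χ : Jet A L} (hχ : χ 1 = 0) : (1 - χ) * geomSeries hχ = 1 := by
  ext D
  obtain ⟨k, hk⟩ := exists_mul_geomSum_apply_eq hχ (1 - χ) D
  obtain ⟨l, hl⟩ := exists_pow_apply_eq_zero hχ D
  change ((1 - χ) * geomSeries hχ) D = (1 : Jet A L) D
  rw [← hk (max k l) (le_max_left _ _), mul_neg_geom_sum]
  change (1 : Jet A L) D - (χ ^ max k l) D = _
  rw [hl _ (le_max_right _ _), sub_zero]

variable (A L) in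
/-- The kernel of `J_L → A` is contained in the Jacobson radical. -/
theorem ker_evalOne_le_jacobson : RingHom.ker (evalOne A L) ≤ Ideal.jacobson ⊥ := by
  intro χ hχ
  rw [Ideal.mem_jacobson_bot]
  intro φ
  -- The geometric series of `-χφ` inverts `1 + χφ`.
  have h : (-(χ * φ)) 1 = 0 := by
    have h1 : evalOne A L (-(χ * φ)) = 0 := by
      rw [map_neg, map_mul, RingHom.mem_ker.mp hχ, zero_mul, neg_zero]
    exact h1
  have h2 := one_sub_mul_geomSeries h
  rw [sub_neg_eq_add, add_comm] at h2
  exact IsUnit.of_mul_eq_one _ h2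

end Jet

end JetRadical

/-! ### Dual bases and a Nakayama criterion for bijectivity. -/

section JetModules

variable {R M : Type*} [CommRing R] [AddCommGroup M] [Module R M]

lemma projective_of_dualBasis {m : ℕ} {b : Fin m → M} {β : Fin m → Module.Dual R M}
    (h : ∀ s, ∑ i, β i s • b i = s) : Module.Projective R M :=
  Module.Projective.of_split (LinearMap.pi β) (Fintype.linearCombination R b)
    (LinearMap.ext fun s => by simpa [Fintype.linearCombination_apply] using h s)

lemma finite_of_dualBasis {m : ℕ} {b : Fin m → M} {β : Fin m → Module.Dual R M}
    (h : ∀ s, ∑ i, β i s • b i = s) : Module.Finite R M :=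
  Module.Finite.of_surjective (Fintype.linearCombination R b) fun s =>
    ⟨fun i => β i s, by simpa [Fintype.linearCombination_apply] using h s⟩

/-- A linear map between finite projective modules is bijective if it is so modulo an ideal in the
Jacobson radical; here the reductions of both modules are identified with a module `E`. -/
lemma bijective_of_comp_eq {P Q E : Type*} [AddCommGroup P] [Module R P] [AddCommGroup Q]
    [Module R Q] [AddCommGroup E] [Module.Finite R P] [Module.Finite R Q] [Module.Projective R Q]
    {I : Ideal R} (hI : I ≤ Ideal.jacobson ⊥) (f : P →ₗ[R] Q) (p : Q →+ E) (q : P →+ E)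
    (hq : Function.Surjective q) (hpf : ∀ u, p (f u) = q u)
    (hkp : ∀ t, p t = 0 → t ∈ I • (⊤ : Submodule R Q))
    (hkq : ∀ u, q u = 0 → u ∈ I • (⊤ : Submodule R P)) : Function.Bijective f := by
  have hsurj : Function.Surjective f := by
    rw [← LinearMap.range_eq_top, eq_top_iff]
    refine Submodule.le_of_le_smul_of_le_jacobson_bot Module.Finite.fg_top hI fun t _ => ?_
    obtain ⟨u, hu⟩ := hq (p t)
    rw [← add_sub_cancel (f u) t]
    exact Submodule.add_mem_sup (LinearMap.mem_range_self f u)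
      (hkp _ (by rw [map_sub, hpf, hu, sub_self]))
  refine ⟨?_, hsurj⟩
  -- A section of `f` is the identity on fibres too, so Nakayama makes it surjective; then `f` is
  -- injective. The source need not be known to be projective.
  obtain ⟨g, hg⟩ := Module.projective_lifting_property f LinearMap.id hsurj
  have hfg : ∀ t, f (g t) = t := fun t => LinearMap.congr_fun hg t
  have hgsurj : Function.Surjective g := by
    rw [← LinearMap.range_eq_top, eq_top_iff]
    refine Submodule.le_of_le_smul_of_le_jacobson_bot Module.Finite.fg_top hI fun u _ => ?_
    rw [← add_sub_cancel (g (f u)) u]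
    exact Submodule.add_mem_sup (LinearMap.mem_range_self g _)
      (hkq _ (by rw [map_sub, ← hpf, ← hpf, hfg, sub_self]))
  intro u v huv
  obtain ⟨s, rfl⟩ := hgsurj u
  obtain ⟨t, rfl⟩ := hgsurj v
  rw [hfg, hfg] at huv
  rw [huv]

end JetModules

/-! ### Every splitting trivialises the jet module, for both kinds of jets. -/

section SplitBijective

variable {A L : Type*} [CommRing A] [LieRing L] [Module A L] [LieRingModule L A]
  [LieRinehartRing A L] {E : Type*} [AddCommGroup E] [Module A E]

variable (L) in
/-- The map `p : N → E` presents `E` as the fibre of the finite projective `J_L`-module `N`. -/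
structure IsJetFibre {N : Type*} [AddCommGroup N] [Module A N] [Module (Jet A L) N]
    (p : N →ₗ[A] E) : Prop where
  finite : Module.Finite (Jet A L) N
  projective : Module.Projective (Jet A L) N
  surjective : Function.Surjective p
  map_smul : ∀ (φ : Jet A L) (n : N), p (φ • n) = φ 1 • p n
  mem_of_eq_zero : ∀ n : N, p n = 0 → n ∈ RingHom.ker (Jet.evalOne A L) • (⊤ : Submodule (Jet A L) N)

lemma Jet.sub_mem_ker_evalOne {φ ψ : Jet A L} (h : φ 1 = ψ 1) :
    φ - ψ ∈ RingHom.ker (Jet.evalOne A L) := by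
  rw [RingHom.sub_mem_ker_iff]; exact h

lemma Jet.algebraMap_apply_one (a : A) : algebraMap A (Jet A L) a 1 = a := by
  rw [Jet.algebraMap_apply, UEnv.counit_one, one_mul]

lemma Jet.taylor_apply_one (a : A) : Jet.taylor A L a 1 = a := by
  change (FlatConn.self A L).act 1 a = a
  simp

/-- On fibres at `1`, both sides are `E` and the map is `p ∘ ν = id`, so the Nakayama criterion
applies with the augmentation ideal of `J_L`. -/
theorem IsJetFibre.bijective_liftBaseChange [Module.Finite A E] [Module.Projective A E]
    {N : Type*} [AddCommGroup N] [Module A N] [Module (Jet A L) N] [IsScalarTower A (Jet A L) N]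
    {p : N →ₗ[A] E} (hp : IsJetFibre L p) {ν : E →ₗ[A] N} (hν : p ∘ₗ ν = LinearMap.id) :
    Function.Bijective (ν.liftBaseChange (Jet A L)) := by
  have := hp.finite
  have := hp.projective
  let q : Jet A L ⊗[A] E →ₗ[A] E :=
    (TensorProduct.lid A E).toLinearMap ∘ₗ LinearMap.rTensor E (Jet.evalOne A L).toLinearMap
  have hq : ∀ φ e, q (φ ⊗ₜ e) = φ 1 • e := fun φ e => rfl
  have hpν : ∀ e, p (ν e) = e := fun e => LinearMap.congr_fun hν e
  refine bijective_of_comp_eq (Jet.ker_evalOne_le_jacobson A L) _ p.toAddMonoidHom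
    q.toAddMonoidHom (fun e => ⟨1 ⊗ₜ e, ?_⟩) (fun u => ?_) hp.mem_of_eq_zero (fun u hu => ?_)
  · exact (hq 1 e).trans (by rw [Jet.one_apply_one, one_smul])
  · simp only [LinearMap.toAddMonoidHom_coe]
    induction u with
    | zero => simp
    | add u v hu hv => rw [map_add, map_add, hu, hv, map_add]
    | tmul φ e => rw [LinearMap.liftBaseChange_tmul, hp.map_smul, hpν, hq]
  · have key : ∀ u, u - 1 ⊗ₜ q u ∈
        RingHom.ker (Jet.evalOne A L) • (⊤ : Submodule (Jet A L) (Jet A L ⊗[A] E)) := by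
      intro u
      induction u with
      | zero => simp
      | add u v hu hv =>
        rw [map_add, TensorProduct.tmul_add, add_sub_add_comm]
        exact add_mem hu hv
      | tmul φ e =>
        -- The difference is a multiple of `φ - φ(1)`, which lies in the augmentation ideal.
        have h : φ ⊗ₜ[A] e - 1 ⊗ₜ q (φ ⊗ₜ e) =
            (φ - algebraMap A (Jet A L) (φ 1)) • (1 ⊗ₜ[A] e : Jet A L ⊗[A] E) := by
          rw [hq, sub_smul, TensorProduct.smul_tmul', TensorProduct.smul_tmul', smul_eq_mul,
            smul_eq_mul, mul_one, mul_one, Algebra.algebraMap_eq_smul_one,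
            TensorProduct.smul_tmul]
        rw [h]
        exact Submodule.smul_mem_smul
          (Jet.sub_mem_ker_evalOne (Jet.algebraMap_apply_one _).symm) trivial
    have h := key u
    rwa [show q u = 0 from hu, TensorProduct.tmul_zero, sub_zero] at h

/-- Up to a permutation of tensor factors, `i_ν` is the identity of `Ω_L` tensored with the
isomorphism `J_L ⊗ E ≅ N`. -/
theorem IsJetFibre.bijective_splitMap [Module.Finite A E] [Module.Projective A E]
    {N : Type*} [AddCommGroup N] [Module A N] [Module (Jet A L) N] [IsScalarTower A (Jet A L) N]
    {p : N →ₗ[A] E} (hp : IsJetFibre L p) {ν : E →ₗ[A] N} (hν : p ∘ₗ ν = LinearMap.id) :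
    Function.Bijective (splitMap (L := L) ν) := by
  let f : Jet A L ⊗[A] E ≃ₗ[A] N :=
    LinearEquiv.ofBijective ((ν.liftBaseChange (Jet A L)).restrictScalars A)
      (hp.bijective_liftBaseChange hν)
  let g : E ⊗[A] dR A L (Jet A L) ≃ₗ[A] dR A L N :=
    TensorProduct.leftComm A E (Forms A L) (Jet A L) ≪≫ₗ
      TensorProduct.congr (LinearEquiv.refl A _) (TensorProduct.comm A E (Jet A L) ≪≫ₗ f)
  have h : splitMap (L := L) ν = g.toLinearMap := by
    refine TensorProduct.ext' fun e r => ?_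
    induction r using TensorProduct.induction_on with
    | zero => simp
    | add r s hr hs => rw [TensorProduct.tmul_add, map_add, map_add, hr, hs]
    | tmul ξ φ =>
    change dR.rmul A L N (1 ⊗ₜ ν e) (ξ ⊗ₜ φ) = ξ ⊗ₜ ν.liftBaseChange (Jet A L) (φ ⊗ₜ e)
    rw [dR.rmul_tmul, one_mul, LinearMap.liftBaseChange_tmul]
  rw [h]
  exact g.bijective

/-- Projectivity of `E` is what supplies a splitting for `J_L ⊗_A E`: the map `e ↦ 1 ⊗ e` carries
multiplication by `a` to that by `j(a)`, so in general it is not linear for the `A`-structure used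
here. -/
lemma IsJetFibre.exists_splitting [Module.Projective A E] {N : Type*} [AddCommGroup N] [Module A N]
    [Module (Jet A L) N] {p : N →ₗ[A] E} (hp : IsJetFibre L p) :
    ∃ ν : E →ₗ[A] N, p ∘ₗ ν = LinearMap.id :=
  Module.projective_lifting_property p LinearMap.id hp.surjective

namespace JetHol

/-- The coordinate `φ ⊗ e ↦ β(e) φ` of `J_L ⊗ E` that is induced by a linear form on `E`. -/
noncomputable def coord (β : Module.Dual A E) : JetHol A L E →ₗ[Jet A L] Jet A L where
  toFun := liftAdd (AddMonoidHom.mk' (fun φ => AddMonoidHom.mk'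
      (fun e => Jet.taylor A L (β e) * φ) (fun e f => by rw [map_add, map_add, add_mul]))
      (fun φ ψ => AddMonoidHom.ext fun e => mul_add (Jet.taylor A L (β e)) φ ψ))
    (fun a φ e => by
      change Jet.taylor A L (β e) * (Jet.taylor A L a * φ) = Jet.taylor A L (β (a • e)) * φ
      rw [β.map_smul, smul_eq_mul, map_mul, mul_left_comm, mul_assoc])
  map_add' := map_add _
  map_smul' φ t := by
    induction t using induction with
    | add s t hs ht => rw [smul_add, map_add, map_add, hs, ht, smul_add]
    | tmul ψ e =>
      rw [smul_tmul, RingHom.id_apply, smul_eq_mul]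
      exact mul_left_comm _ φ ψ

lemma coord_tmul (β : Module.Dual A E) (φ : Jet A L) (e : E) :
    coord β (tmul φ e) = Jet.taylor A L (β e) * φ := rfl

lemma sum_tmul {ι : Type*} (s : Finset ι) (φ : Jet A L) (f : ι → E) :
    tmul φ (∑ i ∈ s, f i) = ∑ i ∈ s, tmul φ (f i) :=
  map_sum (AddMonoidHom.mk' (tmul φ) (tmul_add φ)) f s

/-- The elements `1 ⊗ b_i` inherit the dual basis property, since `j(β_i(e)) φ ⊗ b_i = φ ⊗ β_i(e)
b_i`. -/
lemma sum_coord_smul {m : ℕ} {b : Fin m → E} {β : Fin m → Module.Dual A E}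
    (h : ∀ e, ∑ i, β i e • b i = e) (t : JetHol A L E) :
    ∑ i, coord (β i) t • tmul 1 (b i) = t := by
  induction t using induction with
  | add s t hs ht => simp only [map_add, add_smul, Finset.sum_add_distrib, hs, ht]
  | tmul φ e =>
    simp only [coord_tmul, smul_tmul, mul_one, taylor_mul_tmul]
    rw [← sum_tmul, h]

lemma proj_tmul (φ : Jet A L) (e : E) : proj A L E (tmul φ e) = φ 1 • e := rfl

theorem isJetFibre {m : ℕ} {b : Fin m → E} {β : Fin m → Module.Dual A E}
    (h : ∀ e, ∑ i, β i e • b i = e) : IsJetFibre L (proj A L E) where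
  finite := finite_of_dualBasis (sum_coord_smul h)
  projective := projective_of_dualBasis (sum_coord_smul h)
  surjective e := ⟨tmul 1 e, by rw [proj_tmul, Jet.one_apply_one, one_smul]⟩
  map_smul φ t := by
    induction t using induction with
    | add s t hs ht => rw [smul_add, map_add, map_add, hs, ht, smul_add]
    | tmul ψ e => rw [smul_tmul, proj_tmul, proj_tmul, Jet.mul_apply_one, mul_smul]
  mem_of_eq_zero t ht := by
    have key : ∀ t : JetHol A L E, t - tmul 1 (proj A L E t) ∈
        RingHom.ker (Jet.evalOne A L) • (⊤ : Submodule (Jet A L) (JetHol A L E)) := by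
      intro t
      induction t using induction with
      | add s t hs ht =>
        rw [map_add, tmul_add, add_sub_add_comm]
        exact add_mem hs ht
      | tmul φ e =>
        -- Scalars cross this tensor product through `j`, so the factor is `φ - j(φ(1))`; it
        -- vanishes at `1` because `j(a)(1) = a`.
        have h : tmul φ e - tmul 1 (proj A L E (tmul φ e)) =
            (φ - Jet.taylor A L (φ 1)) • (tmul 1 e : JetHol A L E) := by
          rw [proj_tmul, sub_smul, smul_tmul, smul_tmul, mul_one, taylor_mul_tmul]
        rw [h]
        exact Submodule.smul_mem_smul
          (Jet.sub_mem_ker_evalOne (Jet.taylor_apply_one _).symm) trivial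
    have h1 := key t
    have h0 : tmul (1 : Jet A L) (0 : E) = 0 := TensorProduct.tmul_zero _ _
    rwa [ht, h0, sub_zero] at h1

end JetHol

namespace JetHom

variable (A L) in
/-- The jet `D ↦ ε(D) e`. -/
noncomputable def const (e : E) : JetHom A L E :=
  LinearMap.toSpanSingleton A E e ∘ₗ Coalgebra.counit

/-- The counit axiom collapses the second convolution factor. Constant jets of generators therefore
generate `Hom_A(U_L, E)` over `J_L`. -/
lemma smul_const_apply (φ : Jet A L) (e : E) (D : UEnv A L) :
    (φ • const A L e) D = φ D • e := by
  have h := congrArg (fun t => TensorProduct.lid A E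
    (TensorProduct.map φ.ofConv (LinearMap.toSpanSingleton A E e) t))
    (Coalgebra.lTensor_counit_comul (R := A) D)
  simp only [TensorProduct.map_tmul, LinearMap.toSpanSingleton_apply, TensorProduct.lid_tmul,
    one_smul] at h
  rw [← LinearMap.comp_apply, LinearMap.map_comp_lTensor] at h
  exact h

lemma smul_apply_one (φ : Jet A L) (ψ : JetHom A L E) : (φ • ψ) 1 = φ 1 • ψ 1 := by
  rw [smul_def, conv_apply, UEnv.comul_one]; rfl

/-- The coordinate `ψ ↦ β ∘ ψ` of `Hom_A(U_L, E)` that is induced by a linear form on `E`. -/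
noncomputable def coord (β : Module.Dual A E) : JetHom A L E →ₗ[Jet A L] Jet A L where
  toFun ψ := WithConv.toConv (β ∘ₗ ψ)
  map_add' φ ψ := by ext D; exact map_add β (φ D) (ψ D)
  map_smul' φ ψ := by
    ext D
    change β (TensorProduct.lid A E (TensorProduct.map φ.ofConv ψ (Coalgebra.comul D))) =
      LinearMap.mul' A A (TensorProduct.map φ.ofConv (β ∘ₗ ψ) (Coalgebra.comul D))
    generalize (Coalgebra.comul D : UEnv A L ⊗[A] UEnv A L) = t
    induction t with
    | zero => simp
    | add s t hs ht => simp only [map_add, hs, ht]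
    | tmul m n => simp

lemma coord_apply (β : Module.Dual A E) (ψ : JetHom A L E) (D : UEnv A L) :
    coord β ψ D = β (ψ D) := rfl

lemma sum_coord_smul {m : ℕ} {b : Fin m → E} {β : Fin m → Module.Dual A E}
    (h : ∀ e, ∑ i, β i e • b i = e) (ψ : JetHom A L E) :
    ∑ i, coord (β i) ψ • const A L (b i) = ψ := by
  ext D
  rw [LinearMap.sum_apply]
  simp only [smul_const_apply, coord_apply, h]

theorem isJetFibre {m : ℕ} {b : Fin m → E} {β : Fin m → Module.Dual A E}
    (h : ∀ e, ∑ i, β i e • b i = e) : IsJetFibre L (proj A L E) where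
  finite := finite_of_dualBasis (sum_coord_smul h)
  projective := projective_of_dualBasis (sum_coord_smul h)
  surjective e := ⟨const A L e, by
    change Coalgebra.counit (R := A) (1 : UEnv A L) • e = e
    rw [UEnv.counit_one, one_smul]⟩
  map_smul := smul_apply_one
  mem_of_eq_zero ψ hψ := by
    rw [← sum_coord_smul h ψ]
    -- A jet with `ψ(1) = 0` has all its coordinates `β_i ∘ ψ` in the augmentation ideal.
    refine sum_mem fun i _ => Submodule.smul_mem_smul ?_ trivial
    change β i (ψ 1) = 0
    rw [show ψ 1 = 0 from hψ, map_zero]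

end JetHom

end SplitBijective

/-! ### The de Rham differential of Kähler forms and the flat connection it induces. -/

section KaehlerDifferential

variable {A R : Type*} [CommRing A] [Ring R] [Algebra A R] {𝒢 : GrAlg A R}

namespace Kaehler

/-- An odd operator anticommutes with the sign automorphism. This cancels the cross terms in the
square of `d` on a product. -/
lemma d_parity (x : Kaehler 𝒢) : d 𝒢 (parity 𝒢 x) = -parity 𝒢 (d 𝒢 x) := by
  induction x using induction with
  | of r => rw [parity_of, d_of, d_of, parity_der, neg_neg]
  | der r => rw [parity_der, map_neg, d_der, d_der, map_zero]
  | add x y hx hy => rw [map_add, map_add, hx, hy, map_add, map_add, neg_add]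
  | mul x y hx hy =>
    rw [map_mul, d_mul, d_mul, hx, hy, map_add, map_mul, map_mul]
    simp only [mul_neg, neg_mul, neg_add]

lemma d_d (x : Kaehler 𝒢) : d 𝒢 (d 𝒢 x) = 0 := by
  induction x using induction with
  | of r => rw [d_of, d_der]
  | der r => rw [d_der, map_zero]
  | add x y hx hy => rw [map_add, map_add, hx, hy, add_zero]
  | mul x y hx hy =>
    rw [d_mul, map_add, d_mul, d_mul, hx, hy, d_parity]
    simp

lemma der_mem_form_one (r : R) : der 𝒢 r ∈ form 𝒢 1 := by
  rw [← one_mul (der 𝒢 r), form, pow_one]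
  exact Submodule.mul_mem_mul ⟨1, map_one (of 𝒢)⟩ ⟨r, rfl⟩

lemma der_one : der 𝒢 1 = 0 := by
  have h := der_mul (𝒢 := 𝒢) 1 1
  simp only [mul_one, map_one, one_mul] at h
  exact left_eq_add.mp h

end Kaehler

section Connection

variable {M : Type*} [AddCommGroup M] [Module A M] {act : M →ₗ[A] R →ₗ[A] M}

namespace TensorForms

variable (𝒢 act) in
/-- The bilinear map `m, ξ ↦ m ⊗ ξ`. -/
noncomputable def tmulₗ : M →ₗ[A] Kaehler 𝒢 →ₗ[A] TensorForms 𝒢 act :=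
  (TensorProduct.mk A M (Kaehler 𝒢)).compr₂ (balanceRel 𝒢 act).mkQ

lemma act_tmul (m : M) (r : R) (ξ : Kaehler 𝒢) :
    tmul 𝒢 act (act m r) ξ = tmul 𝒢 act m (Kaehler.of 𝒢 r * ξ) := by
  rw [← sub_eq_zero]
  exact (map_sub (balanceRel 𝒢 act).mkQ _ _).symm.trans
    ((Submodule.Quotient.mk_eq_zero _).mpr (Submodule.subset_span ⟨m, r, ξ, rfl⟩))

lemma induction {P : TensorForms 𝒢 act → Prop} (add : ∀ s t, P s → P t → P (s + t))
    (tmul : ∀ m ξ, P (tmul 𝒢 act m ξ)) (t : TensorForms 𝒢 act) : P t := by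
  obtain ⟨t, rfl⟩ := Submodule.mkQ_surjective _ t
  induction t using TensorProduct.induction_on with
  | zero => simpa [TensorForms.tmul] using tmul 0 0
  | tmul m ξ => exact tmul m ξ
  | add s t hs ht => rw [map_add]; exact add _ _ hs ht

lemma mulRight_mul (η ξ : Kaehler 𝒢) (t : TensorForms 𝒢 act) :
    mulRight 𝒢 act (η * ξ) t = mulRight 𝒢 act ξ (mulRight 𝒢 act η t) := by
  induction t using induction with
  | add s t hs ht => rw [map_add, hs, ht, map_add, map_add]
  | tmul m ξ' => rw [mulRight_tmul, mulRight_tmul, mulRight_tmul, mul_assoc]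

variable (𝒢 act) in
/-- Right multiplication `η, t ↦ t η`, as a bilinear map. -/
noncomputable def mulRightₗ : Kaehler 𝒢 →ₗ[A] TensorForms 𝒢 act →ₗ[A] TensorForms 𝒢 act where
  toFun := mulRight 𝒢 act
  map_add' η ξ := by
    refine LinearMap.ext fun t => ?_
    induction t using induction with
    | add s t hs ht => rw [map_add, hs, ht, map_add]
    | tmul m ξ' =>
      rw [LinearMap.add_apply, mulRight_tmul, mulRight_tmul, mulRight_tmul, mul_add]
      exact map_add (tmulₗ 𝒢 act m) _ _
  map_smul' a η := by
    refine LinearMap.ext fun t => ?_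
    induction t using induction with
    | add s t hs ht => rw [map_add, hs, ht, map_add]
    | tmul m ξ' =>
      rw [RingHom.id_apply, LinearMap.smul_apply, mulRight_tmul, mulRight_tmul, mul_smul_comm]
      exact map_smul (tmulₗ 𝒢 act m) _ _

variable (𝒢) in
/-- The extension `m ⊗ ξ ↦ m ⊗ dξ + (-1)^{|ξ|} D(m) ξ` of an operator `D` with
`D(m r) = m ⊗ dr + (-1)^{|r|} D(m) r`. -/
noncomputable def extend (D : M →ₗ[A] TensorForms 𝒢 act)
    (hD : ∀ m r, D (act m r) = tmul 𝒢 act m (Kaehler.der 𝒢 r) +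
      mulRight 𝒢 act (Kaehler.of 𝒢 (𝒢.parity r)) (D m)) :
    TensorForms 𝒢 act →ₗ[A] TensorForms 𝒢 act :=
  (balanceRel 𝒢 act).liftQ
    (TensorProduct.lift ((tmulₗ 𝒢 act).compl₂ (Kaehler.d 𝒢) +
      (((mulRightₗ 𝒢 act) ∘ₗ (Kaehler.parity 𝒢).toLinearMap).flip ∘ₗ D)))
    (by
      -- Compatibility with `m r ⊗ ξ = m ⊗ r ξ` is exactly the Leibniz rule for `D` combined with
      -- that for `d`.
      refine Submodule.span_le.mpr ?_
      rintro _ ⟨m, r, ξ, rfl⟩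
      rw [SetLike.mem_coe, LinearMap.mem_ker, map_sub, sub_eq_zero]
      change tmul 𝒢 act (act m r) (Kaehler.d 𝒢 ξ) +
          mulRight 𝒢 act (Kaehler.parity 𝒢 ξ) (D (act m r)) =
        tmul 𝒢 act m (Kaehler.d 𝒢 (Kaehler.of 𝒢 r * ξ)) +
          mulRight 𝒢 act (Kaehler.parity 𝒢 (Kaehler.of 𝒢 r * ξ)) (D m)
      rw [hD, map_add, mulRight_tmul, Kaehler.d_mul, Kaehler.d_of, map_mul, mulRight_mul,
        Kaehler.parity_of, act_tmul, ← add_assoc]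
      congr 1
      exact (map_add (tmulₗ 𝒢 act m) _ _).symm)

lemma extend_tmul (D : M →ₗ[A] TensorForms 𝒢 act)
    (hD : ∀ m r, D (act m r) = tmul 𝒢 act m (Kaehler.der 𝒢 r) +
      mulRight 𝒢 act (Kaehler.of 𝒢 (𝒢.parity r)) (D m)) (m : M) (ξ : Kaehler 𝒢) :
    extend 𝒢 D hD (tmul 𝒢 act m ξ) = tmul 𝒢 act m (Kaehler.d 𝒢 ξ) +
      mulRight 𝒢 act (Kaehler.parity 𝒢 ξ) (D m) := rfl

end TensorForms

open TensorForms in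
variable (𝒢) in
/-- If `e ⊗ r ↦ ν(e) r` is an isomorphism `E ⊗ R ≅ M`, then `1 ⊗ d` is a flat connection on `M`. -/
theorem exists_flat_connection {E : Type*} [AddCommGroup E] [Module A E]
    (act_one : ∀ m, act m 1 = m) (act_mul : ∀ m r s, act m (r * s) = act (act m r) s)
    (ν : E →ₗ[A] M) (hν : Function.Bijective (TensorProduct.lift (act ∘ₗ ν))) :
    ∃ D : M →ₗ[A] TensorForms 𝒢 act,
      (∀ (e : E) (r : R), D (act (ν e) r) = tmul 𝒢 act (ν e) (Kaehler.der 𝒢 r)) ∧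
      IsConnection 𝒢 act D ∧ IsFlat 𝒢 act D := by
  let i := LinearEquiv.ofBijective _ hν
  -- `1 ⊗ d` is defined on the tensor product over `A` because the universal derivation is
  -- `A`-linear.
  let D : M →ₗ[A] TensorForms 𝒢 act :=
    TensorProduct.lift ((tmulₗ 𝒢 act ∘ₗ ν).compl₂ (Kaehler.der 𝒢)) ∘ₗ i.symm.toLinearMap
  have hDν : ∀ e r, D (act (ν e) r) = tmul 𝒢 act (ν e) (Kaehler.der 𝒢 r) := by
    intro e r
    have h : i.symm (act (ν e) r) = e ⊗ₜ r := (LinearEquiv.symm_apply_eq i).mpr rfl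
    change TensorProduct.lift _ (i.symm (act (ν e) r)) = _
    rw [h]; rfl
  have hind : ∀ {P : M → Prop}, (∀ m n, P m → P n → P (m + n)) → (∀ e r, P (act (ν e) r)) →
      ∀ m, P m := by
    intro P hadd hact m
    obtain ⟨t, rfl⟩ := hν.surjective m
    induction t using TensorProduct.induction_on with
    | zero => simpa using hact 0 0
    | tmul e r => exact hact e r
    | add s t hs ht => rw [map_add]; exact hadd _ _ hs ht
  have hleib : ∀ m r, D (act m r) = tmul 𝒢 act m (Kaehler.der 𝒢 r) +
      mulRight 𝒢 act (Kaehler.of 𝒢 (𝒢.parity r)) (D m) := by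
    intro m r
    refine hind (P := fun m => D (act m r) = tmul 𝒢 act m (Kaehler.der 𝒢 r) +
      mulRight 𝒢 act (Kaehler.of 𝒢 (𝒢.parity r)) (D m)) (fun m n hm hn => ?_) (fun e s => ?_) m
    · have h : tmul 𝒢 act (m + n) (Kaehler.der 𝒢 r) = tmul 𝒢 act m (Kaehler.der 𝒢 r) +
        tmul 𝒢 act n (Kaehler.der 𝒢 r) := LinearMap.map_add₂ (tmulₗ 𝒢 act) m n _
      rw [map_add, LinearMap.add_apply, map_add, hm, hn, map_add, map_add, h]
      abel
    -- For `m = ν(e) s` the rule is `d(s r) = s dr + (-1)^{|r|} (ds) r`, with `s` moved across the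
    -- tensor sign.
    · rw [← act_mul, hDν, hDν, act_tmul, mulRight_tmul, Kaehler.der_mul]
      exact map_add (tmulₗ 𝒢 act (ν e)) _ _
  refine ⟨D, hDν, ⟨fun m => ?_, fun {k r} m hr => ?_⟩, extend 𝒢 D hleib,
    extend_tmul D hleib, fun t => ?_⟩
  · refine hind (P := fun m => D m ∈ form 𝒢 act 1) (fun m n hm hn => ?_) (fun e r => ?_) m
    · rw [map_add]; exact add_mem hm hn
    · rw [hDν]
      exact Submodule.subset_span ⟨_, _, Kaehler.der_mem_form_one r, rfl⟩
  · rw [hleib, 𝒢.parity_of_mem hr, map_smul]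
    congr 1
    exact LinearMap.map_smul₂ (mulRightₗ 𝒢 act) _ _ _
  -- The elements `ν(e)` are horizontal. Any `ν(e) r ⊗ η` equals `ν(e) ⊗ r η`, where the extension
  -- is just `d`, so flatness is `d² = 0`.
  · have hν0 : ∀ e, D (ν e) = 0 := fun e => by
      have h := hDν e 1
      rw [act_one, Kaehler.der_one] at h
      rw [h]
      exact map_zero (tmulₗ 𝒢 act (ν e))
    have h1 : ∀ e η, extend 𝒢 D hleib (tmul 𝒢 act (ν e) η) =
        tmul 𝒢 act (ν e) (Kaehler.d 𝒢 η) := fun e η => by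
      rw [extend_tmul, hν0, map_zero, add_zero]
    induction t using TensorForms.induction with
    | add s t hs ht => rw [map_add, map_add, hs, ht, add_zero]
    | tmul m η =>
      refine hind (P := fun m => extend 𝒢 D hleib (extend 𝒢 D hleib (tmul 𝒢 act m η)) = 0)
        (fun m n hm hn => ?_) (fun e r => ?_) m
      · have h : tmul 𝒢 act (m + n) η = tmul 𝒢 act m η + tmul 𝒢 act n η :=
          LinearMap.map_add₂ (tmulₗ 𝒢 act) m n _
        rw [h, map_add, map_add, hm, hn, add_zero]
      · rw [act_tmul, h1, h1, Kaehler.d_d]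
        exact map_zero (tmulₗ 𝒢 act (ν e))

end Connection

end KaehlerDifferential

/-! ### From fibrewise splittings to flat connections. -/

section Splittings

variable {A L : Type*} [CommRing A] [LieRing L] [Module A L] [LieRingModule L A]
  [LieRinehartRing A L]

namespace dR

variable {N : Type*} [AddCommGroup N] [Module A N] [Module (Jet A L) N]
  [IsScalarTower A (Jet A L) N]

lemma rmul_one (m : dR A L N) : rmul A L N m 1 = m := by
  induction m using TensorProduct.induction_on with
  | zero => simp
  | add m n hm hn => rw [map_add, LinearMap.add_apply, hm, hn]
  | tmul η n => rw [Algebra.TensorProduct.one_def, rmul_tmul, mul_one, one_smul]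

lemma rmul_mul (m : dR A L N) (r s : dR A L (Jet A L)) :
    rmul A L N m (r * s) = rmul A L N (rmul A L N m r) s := by
  induction m using TensorProduct.induction_on with
  | zero => simp
  | add m n hm hn => simp only [map_add, LinearMap.add_apply, hm, hn]
  | tmul η n =>
    induction r using TensorProduct.induction_on with
    | zero => simp
    | add r r' hr hr' => simp only [add_mul, map_add, LinearMap.add_apply, hr, hr']
    | tmul η' φ =>
      induction s using TensorProduct.induction_on with
      | zero => simp
      | add s s' hs hs' => simp only [mul_add, map_add, hs, hs']
      | tmul η'' ψ =>
        rw [Algebra.TensorProduct.tmul_mul_tmul, rmul_tmul, rmul_tmul, rmul_tmul, mul_assoc,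
          mul_comm φ, mul_smul]

end dR

theorem IsJetFibre.splittingGivesFlatConnection {E N : Type*} [AddCommGroup E] [Module A E]
    [Module.Finite A E] [Module.Projective A E] [AddCommGroup N] [Module A N] [Module (Jet A L) N]
    [IsScalarTower A (Jet A L) N] (𝒢 : GrAlg A (dR A L (Jet A L))) {p : N →ₗ[A] E}
    (hp : IsJetFibre L p) : SplittingGivesFlatConnection 𝒢 p := by
  refine ⟨hp.exists_splitting, fun ν hν => ⟨hp.bijective_splitMap hν, ?_⟩⟩
  exact exists_flat_connection 𝒢 dR.rmul_one dR.rmul_mul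
    (TensorProduct.mk A (Forms A L) N 1 ∘ₗ ν) (hp.bijective_splitMap hν)

end Splittings

/-! ### Contractions and the Euler operator on the exterior algebra. -/

namespace Forms

section Contract

variable {A L : Type*} [CommRing A] [LieRing L] [Module A L]

@[simp] lemma contract_algebraMap (x : L) (a : A) :
    contract x (algebraMap A (Forms A L) a) = 0 :=
  CliffordAlgebra.contractLeft_algebraMap _ _ _

@[simp] lemma contract_ι (x : L) (α : Module.Dual A L) :
    contract x (ExteriorAlgebra.ι A α) = algebraMap A _ (α x) :=
  CliffordAlgebra.contractLeft_ι _ _ _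

lemma contract_ι_mul (x : L) (α : Module.Dual A L) (η : Forms A L) :
    contract x (ExteriorAlgebra.ι A α * η) =
      α x • η - ExteriorAlgebra.ι A α * contract x η :=
  CliffordAlgebra.contractLeft_ι_mul _ _ _

@[simp] lemma parity_parity (η : Forms A L) : parity (parity η) = η :=
  CliffordAlgebra.involute_involute η

lemma contract_mul (x : L) (η θ : Forms A L) :
    contract x (η * θ) = contract x η * θ + parity η * contract x θ := by
  induction η using ExteriorAlgebra.induction generalizing θ with
  | algebraMap a =>
    rw [contract_algebraMap, zero_mul, zero_add, AlgHom.commutes, ← Algebra.smul_def, map_smul,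
      Algebra.smul_def]
  | ι α =>
    rw [contract_ι_mul, contract_ι, parity_ι, neg_mul, Algebra.smul_def, sub_eq_add_neg]
  | mul a b ha hb =>
    rw [mul_assoc, ha, hb, ha, map_mul]
    simp only [add_mul, mul_add, mul_assoc, add_assoc]
  | add a b ha hb =>
    rw [add_mul, map_add, ha, hb, map_add, map_add, add_mul, add_mul]
    abel

lemma contract_parity (x : L) (η : Forms A L) :
    contract x (parity η) = -parity (contract x η) := by
  induction η using ExteriorAlgebra.induction with
  | algebraMap a => simp
  | ι α => simp
  | mul a b ha hb =>
    rw [map_mul, contract_mul, ha, hb, contract_mul, map_add, map_mul, map_mul]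
    simp only [neg_mul, mul_neg, neg_add]
  | add a b ha hb => rw [map_add, map_add, ha, hb, map_add, map_add, neg_add]

lemma parity_of_mem {k : ℕ} {η : Forms A L} (hη : η ∈ ⋀[A]^k (Module.Dual A L)) :
    parity η = (-1 : A) ^ k • η := by
  induction hη using Submodule.pow_induction_on_left' with
  | algebraMap a => simp
  | add η θ k _ _ h h' => rw [map_add, h, h', smul_add]
  | mem_mul m hm k η _ h =>
    obtain ⟨α, rfl⟩ := hm
    rw [map_mul, h, parity_ι, pow_succ, mul_smul]; simp

lemma mul_comm_of_mem {i j : ℕ} {η θ : Forms A L} (hη : η ∈ ⋀[A]^i (Module.Dual A L))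
    (hθ : θ ∈ ⋀[A]^j (Module.Dual A L)) : η * θ = (-1 : A) ^ (i * j) • (θ * η) := by
  induction hη using Submodule.pow_induction_on_left' with
  | algebraMap a => rw [zero_mul, pow_zero, one_smul, Algebra.commutes]
  | add η η' k _ _ h h' => rw [add_mul, mul_add, h, h', smul_add]
  | mem_mul m hm k η _ h =>
    obtain ⟨α, rfl⟩ := hm
    rw [mul_assoc, h, mul_smul_comm, ← mul_assoc, ι_mul_eq, parity_of_mem hθ, smul_mul_assoc,
      smul_mul_assoc, smul_smul, ← pow_add, Nat.succ_mul, mul_assoc]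

lemma ι_mem (α : Module.Dual A L) : ExteriorAlgebra.ι A α ∈ ⋀[A]^1 (Module.Dual A L) := by
  change _ ∈ LinearMap.range (ExteriorAlgebra.ι A) ^ 1
  rw [pow_one]
  exact LinearMap.mem_range_self _ α

lemma mul_mem {i j : ℕ} {η θ : Forms A L} (hη : η ∈ ⋀[A]^i (Module.Dual A L))
    (hθ : θ ∈ ⋀[A]^j (Module.Dual A L)) : η * θ ∈ ⋀[A]^(i + j) (Module.Dual A L) := by
  change _ ∈ LinearMap.range (ExteriorAlgebra.ι A) ^ (i + j)
  rw [pow_add]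
  exact Submodule.mul_mem_mul hη hθ

lemma ι_mul_mem (α : Module.Dual A L) {k : ℕ} {η : Forms A L}
    (hη : η ∈ ⋀[A]^k (Module.Dual A L)) :
    ExteriorAlgebra.ι A α * η ∈ ⋀[A]^(k + 1) (Module.Dual A L) := by
  rw [add_comm]
  exact mul_mem (ι_mem α) hη

/-- The induction over powers varies the degree, so the conclusion is stated for a degree equal to
`j + 1`. The case of degree `0` is carried along because the term `α ∧ ι_x η` of a `1`-form needs
it. -/
lemma contract_mem_aux (x : L) {k : ℕ} {η : Forms A L} (hη : η ∈ ⋀[A]^k (Module.Dual A L)) :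
    (k = 0 → contract x η = 0) ∧
      ∀ j, k = j + 1 → contract x η ∈ ⋀[A]^j (Module.Dual A L) := by
  induction hη using Submodule.pow_induction_on_left' with
  | algebraMap a => exact ⟨fun _ => contract_algebraMap x a, fun j hj => by omega⟩
  | add η θ k _ _ h h' =>
    rw [map_add]
    exact ⟨fun hk => by rw [h.1 hk, h'.1 hk, add_zero], fun j hj => add_mem (h.2 j hj) (h'.2 j hj)⟩
  | mem_mul m hm k η hη h =>
    obtain ⟨α, rfl⟩ := hm
    refine ⟨fun hk => by omega, fun j hj => ?_⟩
    obtain rfl : j = k := by omega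
    rw [contract_ι_mul]
    refine sub_mem (Submodule.smul_mem _ _ hη) ?_
    cases j with
    | zero => rw [h.1 rfl, mul_zero]; exact zero_mem _
    | succ l => exact ι_mul_mem α (h.2 l rfl)

lemma contract_mem (x : L) {k : ℕ} {η : Forms A L} (hη : η ∈ ⋀[A]^(k + 1) (Module.Dual A L)) :
    contract x η ∈ ⋀[A]^k (Module.Dual A L) :=
  (contract_mem_aux x hη).2 k rfl

variable (A L) in
/-- The operator `∑ β_i ∧ ι_{b_i}`, which is multiplication by the degree. -/
noncomputable def euler : Forms A L →ₗ[A] Forms A L :=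
  ∑ i, LinearMap.mulLeft A (ExteriorAlgebra.ι A (coframe A L i)) ∘ₗ contract (frame A L i)

lemma euler_apply (η : Forms A L) :
    euler A L η = ∑ i, ExteriorAlgebra.ι A (coframe A L i) * contract (frame A L i) η := by
  simp [euler]

/-- For `α ∧ η` the contraction rule gives `∑ α(b_i) β_i ∧ η = α ∧ η` plus `α` times the Euler
operator on `η`, the sign being absorbed by swapping `β_i` and `α`. -/
lemma euler_of_mem (hd : (dualBasis A L).IsDual) {k : ℕ} {η : Forms A L}
    (hη : η ∈ ⋀[A]^k (Module.Dual A L)) : euler A L η = k • η := by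
  induction hη using Submodule.pow_induction_on_left' with
  | algebraMap a => simp [euler_apply]
  | add η θ k _ _ h h' => rw [map_add, h, h', smul_add]
  | mem_mul m hm k η _ h =>
    obtain ⟨α, rfl⟩ := hm
    have h1 : ∑ i, ExteriorAlgebra.ι A (coframe A L i) * (α (frame A L i) • η) =
        ExteriorAlgebra.ι A α * η := by
      conv_rhs => rw [← sum_smul_coframe hd α]
      simp [Finset.sum_mul]
    have h2 : ∑ i, ExteriorAlgebra.ι A (coframe A L i) *
        (ExteriorAlgebra.ι A α * contract (frame A L i) η) =
        -(ExteriorAlgebra.ι A α * euler A L η) := by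
      rw [euler_apply, Finset.mul_sum, ← Finset.sum_neg_distrib]
      refine Finset.sum_congr rfl fun i _ => ?_
      rw [← mul_assoc, ← mul_assoc, eq_neg_iff_add_eq_zero, ← add_mul,
        ExteriorAlgebra.ι_add_mul_swap, zero_mul]
    rw [euler_apply]
    simp only [contract_ι_mul, mul_sub, Finset.sum_sub_distrib]
    rw [h1, h2, h, sub_neg_eq_add, mul_smul_comm, succ_nsmul']

end Contract

/-! ### The Chevalley-Eilenberg differential and its square. -/

section Differential

variable {A L : Type*} [CommRing A] [Algebra ℝ A] [LieRing L] [Module A L] [LieRingModule L A]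
  [LieRinehartRing A L]

/-- Positive integers are invertible in an `ℝ`-algebra, so the eigenvalues of the Euler operator in
positive degree can be divided out. -/
lemma _root_.LieAlgd.eq_zero_of_nsmul_eq_zero {M : Type*} [AddCommGroup M] [Module A M] {k : ℕ}
    {m : M} (h : (k + 1) • m = 0) : m = 0 := by
  have hk : algebraMap ℝ A ((k + 1 : ℕ) : ℝ)⁻¹ * ((k + 1 : ℕ) : A) = 1 := by
    rw [← map_natCast (algebraMap ℝ A), ← map_mul, inv_mul_cancel₀ (by positivity), map_one]
  rw [← one_smul A m, ← hk, mul_smul, Nat.cast_smul_eq_nsmul, h, smul_zero]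

omit [LieRingModule L A] [LieRinehartRing A L] in
/-- A form of positive degree all of whose contractions vanish is zero. -/
lemma eq_zero_of_contract (hd : (dualBasis A L).IsDual) {k : ℕ} {η : Forms A L}
    (hη : η ∈ ⋀[A]^(k + 1) (Module.Dual A L)) (h : ∀ x, contract x η = 0) : η = 0 := by
  refine LieAlgd.eq_zero_of_nsmul_eq_zero (A := A) (k := k) ?_
  rw [← euler_of_mem hd hη, euler_apply]
  simp [h]

omit [Algebra ℝ A] [LieRinehartRing A L] in
lemma dFun_mem (a : A) : dFun (L := L) a ∈ ⋀[A]^1 (Module.Dual A L) :=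
  Submodule.sum_mem _ (t := Finset.univ)
    (f := fun i => ⁅frame A L i, a⁆ • ExteriorAlgebra.ι A (coframe A L i))
    fun _ _ => Submodule.smul_mem _ _ (ι_mem _)

omit [LieRinehartRing A L] in
lemma dOne_mem (α : Module.Dual A L) : dOne α ∈ ⋀[A]^2 (Module.Dual A L) :=
  Submodule.smul_mem _ _ (Submodule.sum_mem _ fun _ _ => Submodule.sum_mem _ fun _ _ =>
    Submodule.smul_mem _ _ (mul_mem (ι_mem _) (ι_mem _)))

lemma d_mem {k : ℕ} {η : Forms A L} (hη : η ∈ ⋀[A]^k (Module.Dual A L)) :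
    d η ∈ ⋀[A]^(k + 1) (Module.Dual A L) := by
  induction hη using Submodule.pow_induction_on_left' with
  | algebraMap a => rw [d_algebraMap]; exact dFun_mem a
  | add η θ k _ _ h h' => rw [map_add]; exact add_mem h h'
  | mem_mul m hm k η hη h =>
    obtain ⟨α, rfl⟩ := hm
    rw [d_mul, d_ι, parity_ι, neg_mul]
    refine add_mem ?_ (neg_mem ?_)
    · have h1 := mul_mem (dOne_mem α) hη
      rwa [add_comm] at h1
    · have h1 := mul_mem (ι_mem α) h
      rwa [add_comm] at h1

omit [Algebra ℝ A] in
lemma contract_dFun (hd : (dualBasis A L).IsDual) (x : L) (a : A) :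
    contract x (dFun a) = algebraMap A (Forms A L) ⁅x, a⁆ := by
  have h : ∀ s : Finset (Fin (dualBasis A L).card),
      ⁅∑ i ∈ s, coframe A L i x • frame A L i, a⁆ =
        ∑ i ∈ s, coframe A L i x * ⁅frame A L i, a⁆ := fun s => by
    classical
    induction s using Finset.induction_on with
    | empty => simp
    | insert i s hi ih =>
      rw [Finset.sum_insert hi, Finset.sum_insert hi, add_lie, ih, LieRinehartRing.lie_smul_eq_mul]
  have hx : ∑ i, coframe A L i x • frame A L i = x := hd x
  conv_rhs => rw [← hx]
  rw [h]
  simp only [dFun, AddMonoidHom.mk'_apply, map_sum, map_smul, contract_ι, map_mul]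
  exact Finset.sum_congr rfl fun i _ => (Algebra.smul_def _ _).trans (Algebra.commutes _ _)

/-- The values `⁅x, α y⁆ - ⁅y, α x⁆ - α ⁅x, y⁆` of `d α`, as a bilinear form. -/
noncomputable def dOneForm (α : Module.Dual A L) : L →ₗ[A] L →ₗ[A] A :=
  LinearMap.mk₂ A (fun x y => ⁅x, α y⁆ - ⁅y, α x⁆ - α ⁅x, y⁆)
    (fun x x' y => by simp only [add_lie, lie_add, map_add]; ring)
    (fun a x y => by
      have h : ⁅a • x, y⁆ = a • ⁅x, y⁆ - ⁅y, a⁆ • x := by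
        rw [← lie_skew, LieRinehartRing.leibniz_smul_right, ← lie_skew x y, smul_neg]
        abel
      rw [h]
      simp only [LieRinehartRing.lie_smul_eq_mul, map_smul, map_sub, smul_eq_mul,
        LieRinehartRing.leibniz_mul_right]
      ring)
    (fun x y y' => by simp only [add_lie, lie_add, map_add]; ring)
    (fun a x y => by
      simp only [LieRinehartRing.lie_smul_eq_mul, LieRinehartRing.leibniz_smul_right, map_smul,
        map_add, smul_eq_mul, LieRinehartRing.leibniz_mul_right]
      ring)

omit [Algebra ℝ A] in
lemma dOneForm_apply (α : Module.Dual A L) (x y : L) :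
    dOneForm α x y = ⁅x, α y⁆ - ⁅y, α x⁆ - α ⁅x, y⁆ := rfl

omit [Algebra ℝ A] in
lemma dOneForm_swap (α : Module.Dual A L) (x y : L) : dOneForm α y x = -dOneForm α x y := by
  rw [dOneForm_apply, dOneForm_apply, ← lie_skew x y, map_neg]
  ring

omit [Algebra ℝ A] in
-- Tensoriality in both arguments allows `dα(x, y)` to be computed from its values on the frame,
-- although each of its three terms alone is not bilinear over `A`.
lemma sum_sum_dOneForm (hd : (dualBasis A L).IsDual) (α : Module.Dual A L) (x y : L) :
    ∑ i, ∑ j, dOneForm α (frame A L i) (frame A L j) *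
      (coframe A L i x * coframe A L j y) = dOneForm α x y := by
  have hx : ∑ i, coframe A L i x • frame A L i = x := hd x
  have hy : ∑ i, coframe A L i y • frame A L i = y := hd y
  conv_rhs => rw [← hx, ← hy]
  simp only [map_sum, map_smul, LinearMap.sum_apply, LinearMap.smul_apply, smul_eq_mul]
  rw [Finset.sum_comm]
  refine Finset.sum_congr rfl fun i _ => ?_
  rw [Finset.mul_sum]
  exact Finset.sum_congr rfl fun j _ => by ring

/-- Contracting `β_i ∧ β_j` gives two terms. By skew-symmetry each sums to the same value, which
cancels the factor one half in the definition of `dOne`. -/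
lemma contract_contract_dOne (hd : (dualBasis A L).IsDual) (x y : L) (α : Module.Dual A L) :
    contract y (contract x (dOne α)) =
      algebraMap A (Forms A L) (⁅x, α y⁆ - ⁅y, α x⁆ - α ⁅x, y⁆) := by
  rw [← dOneForm_apply]
  have h1 : ∀ i j, contract y (contract x
      (ExteriorAlgebra.ι A (coframe A L i) * ExteriorAlgebra.ι A (coframe A L j))) =
      algebraMap A (Forms A L) (coframe A L i x * coframe A L j y -
        coframe A L i y * coframe A L j x) := by
    intro i j
    rw [contract_ι_mul, contract_ι, map_sub, map_smul, contract_ι, contract_ι_mul,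
      contract_algebraMap, mul_zero, sub_zero, Algebra.smul_def, Algebra.smul_def, map_sub,
      map_mul, map_mul]
  have h2 : dOne α = algebraMap ℝ A 2⁻¹ • ∑ i, ∑ j,
      dOneForm α (frame A L i) (frame A L j) •
        (ExteriorAlgebra.ι A (coframe A L i) * ExteriorAlgebra.ι A (coframe A L j)) := rfl
  rw [h2]
  simp only [map_smul, map_sum, h1]
  simp only [Algebra.smul_def, ← map_sum, ← map_mul, mul_sub, Finset.sum_sub_distrib]
  have h3 : ∑ i, ∑ j, dOneForm α (frame A L i) (frame A L j) *
      (coframe A L i y * coframe A L j x) = -dOneForm α x y := by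
    rw [sum_sum_dOneForm hd, dOneForm_swap]
  rw [sum_sum_dOneForm hd, h3]
  congr 1
  have h4 : algebraMap ℝ A 2⁻¹ * 2 = 1 := by
    rw [← map_ofNat (algebraMap ℝ A) 2, ← map_mul]; norm_num
  linear_combination (dOneForm α x y) * h4

omit [Algebra ℝ A] [LieRinehartRing A L] in
lemma parity_dFun (a : A) : parity (dFun (L := L) a) = -dFun a := by
  rw [parity_of_mem (dFun_mem a), pow_one, neg_one_smul]

lemma d_parity (η : Forms A L) : d (parity η) = -parity (d η) := by
  induction η using ExteriorAlgebra.induction with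
  | algebraMap a => rw [AlgHom.commutes, d_algebraMap, parity_dFun, neg_neg]
  | ι α =>
    rw [parity_ι, map_neg, d_ι, parity_of_mem (dOne_mem α)]
    simp
  | mul a b ha hb =>
    rw [map_mul, d_mul, ha, hb, d_mul, map_add, map_mul, map_mul]
    simp only [neg_mul, mul_neg, neg_add]
  | add a b ha hb => rw [map_add, map_add, ha, hb, map_add, map_add, neg_add]

/-- The Lie derivative `d ι_x + ι_x d`. -/
noncomputable def lieDer (x : L) : Forms A L →+ Forms A L :=
  d.comp (contract x).toAddMonoidHom + (contract x).toAddMonoidHom.comp d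

lemma lieDer_apply (x : L) (η : Forms A L) :
    lieDer x η = d (contract x η) + contract x (d η) := rfl

lemma contract_d (x : L) (η : Forms A L) :
    contract x (d η) = lieDer x η - d (contract x η) := by
  rw [lieDer_apply, add_sub_cancel_left]

lemma lieDer_mul (x : L) (η θ : Forms A L) :
    lieDer x (η * θ) = lieDer x η * θ + η * lieDer x θ := by
  simp only [lieDer_apply, contract_mul, d_mul, map_add, contract_parity, d_parity, parity_parity,
    add_mul, mul_add, neg_mul]
  abel

lemma lieDer_parity (x : L) (η : Forms A L) : lieDer x (parity η) = parity (lieDer x η) := by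
  simp only [lieDer_apply, contract_parity, d_parity, map_add, map_neg, neg_neg]

lemma lieDer_algebraMap (hd : (dualBasis A L).IsDual) (x : L) (a : A) :
    lieDer x (algebraMap A (Forms A L) a) = algebraMap A _ ⁅x, a⁆ := by
  rw [lieDer_apply, contract_algebraMap, map_zero, zero_add, d_algebraMap, contract_dFun hd]

/-- This is Cartan's relation `[L_x, ι_y] = ι_{[x, y]}`. Both sides are odd derivations, so
generators suffice, and on a linear form it is the defining formula for `dα`. -/
lemma contract_lie (x y : L) (η : Forms A L) (hd : (dualBasis A L).IsDual) :
    contract y (lieDer x η) = lieDer x (contract y η) - contract ⁅x, y⁆ η := by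
  induction η using ExteriorAlgebra.induction with
  | algebraMap a => simp [lieDer_algebraMap hd]
  | ι α =>
    rw [contract_ι, contract_ι, lieDer_algebraMap hd, lieDer_apply, contract_ι, d_algebraMap,
      map_add, contract_dFun hd, d_ι, contract_contract_dOne hd, ← map_add, ← map_sub]
    congr 1
    ring
  | mul a b ha hb =>
    simp only [lieDer_mul, contract_mul, map_add, ha, hb, lieDer_parity, sub_mul, mul_sub]
    abel
  | add a b ha hb => simp only [map_add, ha, hb]; abel

lemma d_d_mul {η θ : Forms A L} (hη : d (d η) = 0) (hθ : d (d θ) = 0) : d (d (η * θ)) = 0 := by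
  rw [d_mul, map_add, d_mul, d_mul, hη, hθ, d_parity]
  simp

lemma d_dFun (hd : (dualBasis A L).IsDual) (a : A) : d (dFun (L := L) a) = 0 := by
  have hm := d_mem (dFun_mem (L := L) a)
  refine eq_zero_of_contract hd hm fun x => eq_zero_of_contract hd (contract_mem x hm) fun y => ?_
  rw [contract_d, map_sub, contract_lie _ _ _ hd, contract_dFun hd, contract_dFun hd,
    contract_dFun hd, d_algebraMap, contract_dFun hd, lieDer_algebraMap hd, ← map_sub, ← map_sub,
    lie_lie, sub_sub_cancel, sub_self, map_zero]

lemma d_d_algebraMap (hd : (dualBasis A L).IsDual) (a : A) :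
    d (d (algebraMap A (Forms A L) a)) = 0 := by
  rw [d_algebraMap, d_dFun hd]

lemma contract_contract_contract_d_dOne (hd : (dualBasis A L).IsDual) (α : Module.Dual A L)
    (x y z : L) : contract z (contract y (contract x (d (dOne α)))) = 0 := by
  rw [← d_ι]
  simp only [contract_d, map_sub, contract_ι, d_d_algebraMap hd, contract_lie _ _ _ hd,
    lieDer_algebraMap hd, contract_algebraMap, map_zero, sub_zero]
  simp only [← map_sub]
  -- What remains are second derivatives of values of `α`, which cancel as the anchor respects
  -- brackets, and values of `α` on double brackets, which cancel by Jacobi.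
  refine (congrArg _ ?_).trans (map_zero (algebraMap A (Forms A L)))
  have h1 := leibniz_lie x y (α z)
  have h2 := leibniz_lie x z (α y)
  have h3 : α ⁅x, ⁅y, z⁆⁆ = α ⁅⁅x, y⁆, z⁆ + α ⁅y, ⁅x, z⁆⁆ := by rw [leibniz_lie, map_add]
  linear_combination h1 - h2 - h3

lemma d_dOne (hd : (dualBasis A L).IsDual) (α : Module.Dual A L) : d (dOne α) = 0 := by
  have hm := d_mem (dOne_mem α)
  exact eq_zero_of_contract hd hm fun x => eq_zero_of_contract hd (contract_mem x hm) fun y =>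
    eq_zero_of_contract hd (contract_mem y (contract_mem x hm)) fun z =>
      contract_contract_contract_d_dOne hd α x y z

lemma d_d (hd : (dualBasis A L).IsDual) (η : Forms A L) : d (d η) = 0 := by
  induction η using ExteriorAlgebra.induction with
  | algebraMap a => exact d_d_algebraMap hd a
  | ι α => rw [d_ι, d_dOne hd]
  | mul a b ha hb => exact d_d_mul ha hb
  | add a b ha hb => rw [map_add, map_add, ha, hb, add_zero]

theorem isCEDifferential (hd : (dualBasis A L).IsDual) :
    IsCEDifferential (d (A := A) (L := L)) where
  d_fun x a := by rw [d_algebraMap, contract_dFun hd]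
  d_form x y α := by rw [d_ι, contract_contract_dOne hd]
  d_fun_mem a := by rw [d_algebraMap]; exact dFun_mem a
  d_form_mem α := by rw [d_ι]; exact dOne_mem α
  d_mul := d_mul

end Differential

end Forms

/-! ### The grading of the de Rham module. -/

namespace dR

section Grading

variable {A L : Type*} [CommRing A] [LieRing L] [Module A L]
  {N : Type*} [AddCommGroup N] [Module A N]

lemma tmul_mem {k : ℕ} {η : Forms A L} (hη : η ∈ ⋀[A]^k (Module.Dual A L)) (m : N) :
    η ⊗ₜ m ∈ deg A L N k :=
  ⟨(⟨η, hη⟩ : ⋀[A]^k (Module.Dual A L)) ⊗ₜ m, rfl⟩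

@[elab_as_elim]
lemma deg_induction {k : ℕ} {P : (t : dR A L N) → t ∈ deg A L N k → Prop}
    (tmul : ∀ (η : Forms A L) (hη : η ∈ ⋀[A]^k (Module.Dual A L)) (m : N),
      P (η ⊗ₜ m) (tmul_mem hη m))
    (add : ∀ s t hs ht, P s hs → P t ht → P (s + t) (add_mem hs ht)) {t : dR A L N}
    (ht : t ∈ deg A L N k) : P t ht := by
  obtain ⟨t, rfl⟩ := ht
  induction t using TensorProduct.induction_on with
  | zero => simpa using tmul 0 (zero_mem _) 0
  | tmul η m => exact tmul η η.2 m
  | add s t hs ht => simpa only [map_add] using add _ _ _ _ hs ht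

variable (A L N) in
/-- The projection to the part of degree `k`. -/
noncomputable def projDeg (k : ℕ) : dR A L N →ₗ[A] dR A L N :=
  LinearMap.rTensor N ((⋀[A]^k (Module.Dual A L)).subtype ∘ₗ
    DirectSum.component A ℕ (fun i => ⋀[A]^i (Module.Dual A L)) k ∘ₗ
      (DirectSum.decomposeLinearEquiv fun i : ℕ => ⋀[A]^i (Module.Dual A L)).toLinearMap)

lemma projDeg_tmul (k : ℕ) (η : Forms A L) (m : N) :
    projDeg A L N k (η ⊗ₜ m) =
      (DirectSum.decompose (fun i : ℕ => ⋀[A]^i (Module.Dual A L)) η k : Forms A L) ⊗ₜ m := rfl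

lemma projDeg_of_mem {j : ℕ} (k : ℕ) {t : dR A L N} (ht : t ∈ deg A L N j) :
    projDeg A L N k t = if j = k then t else 0 := by
  induction ht using deg_induction with
  | tmul η hη m =>
    rw [projDeg_tmul]
    split_ifs with h
    · subst h; rw [DirectSum.decompose_of_mem_same (fun i : ℕ => ⋀[A]^i (Module.Dual A L)) hη]
    · rw [DirectSum.decompose_of_mem_ne (fun i : ℕ => ⋀[A]^i (Module.Dual A L)) hη h, TensorProduct.zero_tmul]
  | add s t _ _ hs ht =>
    rw [map_add, hs, ht]
    split_ifs with h
    · rfl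
    · rw [add_zero]

/-- The decomposition of `Ω_L` is split by its projections, and split decompositions survive
tensoring with any `N`: `projDeg` recovers the components. -/
lemma isInternal_deg : DirectSum.IsInternal (deg A L N) := by
  classical
  refine ⟨fun x y hxy => ?_, fun t => ?_⟩
  · have key : ∀ (y : DirectSum ℕ fun k => deg A L N k) k,
        projDeg A L N k (DirectSum.coeAddMonoidHom (deg A L N) y) = y k := by
      intro y k
      induction y using DirectSum.induction_on with
      | zero => simp
      | of j t =>
        rw [DirectSum.coeAddMonoidHom_of, projDeg_of_mem k t.2]
        split_ifs with h
        · subst h; rw [DirectSum.of_eq_same]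
        · rw [DirectSum.of_eq_of_ne _ _ _ (Ne.symm h)]; rfl
      | add y z hy hz => rw [map_add, map_add, hy, hz]; rfl
    ext k
    rw [← key x k, ← key y k, hxy]
  · induction t using TensorProduct.induction_on with
    | zero => exact ⟨0, map_zero _⟩
    | add s t hs ht =>
      obtain ⟨x, rfl⟩ := hs
      obtain ⟨y, rfl⟩ := ht
      exact ⟨x + y, map_add _ _ _⟩
    | tmul η m =>
      refine ⟨∑ k ∈ (DirectSum.decompose (fun i : ℕ => ⋀[A]^i (Module.Dual A L)) η).support,
        DirectSum.of (fun k => deg A L N k) k ⟨_, tmul_mem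
          (DirectSum.decompose (fun i : ℕ => ⋀[A]^i (Module.Dual A L)) η k).2 m⟩, ?_⟩
      rw [map_sum]
      simp only [DirectSum.coeAddMonoidHom_of]
      rw [← TensorProduct.sum_tmul, DirectSum.sum_support_decompose]

lemma one_mem [LieRingModule L A] [LieRinehartRing A L] :
    (1 : dR A L (Jet A L)) ∈ deg A L (Jet A L) 0 := by
  rw [Algebra.TensorProduct.one_def]
  refine tmul_mem ?_ 1
  exact SetLike.GradedOne.one_mem (A := fun i : ℕ => ⋀[A]^i (Module.Dual A L))

variable [LieRingModule L A] [LieRinehartRing A L] [Module (Jet A L) N]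
  [IsScalarTower A (Jet A L) N]

lemma rmul_mem {i j : ℕ} {m : dR A L N} {r : dR A L (Jet A L)} (hm : m ∈ deg A L N i)
    (hr : r ∈ deg A L (Jet A L) j) : rmul A L N m r ∈ deg A L N (i + j) := by
  induction hm using deg_induction with
  | add s t _ _ hs ht => rw [map_add, LinearMap.add_apply]; exact add_mem hs ht
  | tmul η hη n =>
    induction hr using deg_induction with
    | add s t _ _ hs ht => rw [map_add]; exact add_mem hs ht
    | tmul θ hθ φ => rw [rmul_tmul]; exact tmul_mem (Forms.mul_mem hη hθ) _

/-- Commutativity of `J_L` identifies the action `φ n` with the product `n φ`, so the algebra is a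
special case of the modules over it. -/
lemma rmul_eq_mul (r s : dR A L (Jet A L)) : rmul A L (Jet A L) r s = r * s := by
  induction r using TensorProduct.induction_on with
  | zero => simp
  | add r r' hr hr' => rw [map_add, LinearMap.add_apply, hr, hr', add_mul]
  | tmul η φ =>
    induction s using TensorProduct.induction_on with
    | zero => simp
    | add s s' hs hs' => rw [map_add, hs, hs', mul_add]
    | tmul θ ψ => rw [rmul_tmul, Algebra.TensorProduct.tmul_mul_tmul, smul_eq_mul, mul_comm ψ]

omit N [AddCommGroup N] [Module A N] [Module (Jet A L) N] [IsScalarTower A (Jet A L) N] in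
lemma mul_comm_of_mem {i j : ℕ} {r s : dR A L (Jet A L)} (hr : r ∈ deg A L (Jet A L) i)
    (hs : s ∈ deg A L (Jet A L) j) : r * s = (-1 : A) ^ (i * j) • (s * r) := by
  induction hr using deg_induction with
  | add r r' _ _ hr hr' => rw [add_mul, hr, hr', mul_add, smul_add]
  | tmul η hη φ =>
    induction hs using deg_induction with
    | add s s' _ _ hs hs' => rw [add_mul, mul_add, hs, hs', smul_add]
    | tmul θ hθ ψ =>
      rw [Algebra.TensorProduct.tmul_mul_tmul, Algebra.TensorProduct.tmul_mul_tmul,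
        Forms.mul_comm_of_mem hη hθ, mul_comm φ, TensorProduct.smul_tmul']

end Grading

/-! ### The de Rham differential of a flat connection and its square. -/

section Differential

variable {A L : Type*} [CommRing A] [Algebra ℝ A] [LieRing L] [Module A L] [LieRingModule L A]
  [LieRinehartRing A L] {N : Type*} [AddCommGroup N] [Module A N] (c : FlatConn A L N)

variable (N) in
/-- Left multiplication by a form. -/
noncomputable abbrev lmul (η : Forms A L) : dR A L N →ₗ[A] dR A L N :=
  LinearMap.rTensor N (LinearMap.mulLeft A η)

omit [Algebra ℝ A] [LieRingModule L A] [LieRinehartRing A L] in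
lemma lmul_tmul (η θ : Forms A L) (m : N) : lmul N η (θ ⊗ₜ m) = (η * θ) ⊗ₜ m := rfl

omit [Algebra ℝ A] [LieRingModule L A] [LieRinehartRing A L] in
lemma lmul_lmul (η θ : Forms A L) (t : dR A L N) : lmul N η (lmul N θ t) = lmul N (η * θ) t := by
  rw [lmul, lmul, lmul, ← LinearMap.comp_apply, ← LinearMap.rTensor_comp, LinearMap.mulLeft_mul]

omit [Algebra ℝ A] [LieRingModule L A] [LieRinehartRing A L] in
lemma lmul_neg_left (η : Forms A L) (t : dR A L N) : lmul N (-η) t = -lmul N η t := by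
  induction t using TensorProduct.induction_on with
  | zero => simp
  | add s t hs ht => simp only [map_add, hs, ht, neg_add]
  | tmul θ m => rw [lmul_tmul, lmul_tmul, neg_mul, TensorProduct.neg_tmul]

lemma diff_one_tmul (m : N) : diff c (1 ⊗ₜ m) =
    ∑ i, ExteriorAlgebra.ι A (Forms.coframe A L i) ⊗ₜ[A] c.nabla (Forms.frame A L i) m := by
  have h : Forms.d (1 : Forms A L) = 0 := by
    have h1 := Forms.d_mul (1 : Forms A L) 1
    rw [map_one Forms.parity, one_mul, mul_one, one_mul] at h1
    exact left_eq_add.mp h1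
  rw [diff_tmul, h, TensorProduct.zero_tmul, zero_add]
  simp

lemma diff_tmul_eq (η : Forms A L) (m : N) :
    diff c (η ⊗ₜ m) = Forms.d η ⊗ₜ m + lmul N (Forms.parity η) (diff c (1 ⊗ₜ m)) := by
  rw [diff_one_tmul, diff_tmul, map_sum]
  rfl

/-- As `Ω_L` generates the module from the elements `1 ⊗ m`, this rule reduces statements about the
differential to those elements. -/
lemma diff_lmul (η : Forms A L) (t : dR A L N) :
    diff c (lmul N η t) = lmul N (Forms.d η) t + lmul N (Forms.parity η) (diff c t) := by
  induction t using TensorProduct.induction_on with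
  | zero => simp
  | add s t hs ht => simp only [map_add, hs, ht]; abel
  | tmul θ m =>
    rw [lmul_tmul, diff_tmul_eq c (η * θ), diff_tmul_eq c θ, Forms.d_mul, map_mul, map_add, lmul_lmul,
      TensorProduct.add_tmul, lmul_tmul, lmul_tmul, add_assoc]

omit [Algebra ℝ A] [LieRinehartRing A L] in
lemma sum_coframe_smul_nabla (hd : (Forms.dualBasis A L).IsDual) (x : L) (m : N) :
    ∑ i, Forms.coframe A L i x • c.nabla (Forms.frame A L i) m = c.nabla x m := by
  have hx : ∑ i, Forms.coframe A L i x • Forms.frame A L i = x := hd x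
  conv_rhs => rw [← hx]
  rw [map_sum, AddMonoidHom.finsetSum_apply]
  simp only [c.smul_left]

lemma rTensor_contract_diff_one (hd : (Forms.dualBasis A L).IsDual) (x : L) (m : N) :
    LinearMap.rTensor N (Forms.contract x) (diff c (1 ⊗ₜ m)) = 1 ⊗ₜ c.nabla x m := by
  rw [← sum_coframe_smul_nabla c hd, diff_one_tmul, map_sum, TensorProduct.tmul_sum]
  refine Finset.sum_congr rfl fun i _ => ?_
  rw [LinearMap.rTensor_tmul, Forms.contract_ι, TensorProduct.tmul_smul,
    TensorProduct.smul_tmul', Algebra.algebraMap_eq_smul_one]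

lemma diff_one_tmul_mem (m : N) : diff c (1 ⊗ₜ m) ∈ deg A L N 1 := by
  rw [diff_one_tmul]
  exact Submodule.sum_mem _ fun i _ => tmul_mem (Forms.ι_mem _) _

theorem isDeRhamDifferential (hd : (Forms.dualBasis A L).IsDual) :
    IsDeRhamDifferential c (diff c) where
  d_sec := rTensor_contract_diff_one c hd
  d_sec_mem := diff_one_tmul_mem c
  d_tmul := diff_tmul_eq c

omit [Algebra ℝ A] [LieRingModule L A] [LieRinehartRing A L] in
lemma lmul_mem {i j : ℕ} {η : Forms A L} (hη : η ∈ ⋀[A]^i (Module.Dual A L)) {t : dR A L N}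
    (ht : t ∈ deg A L N j) : lmul N η t ∈ deg A L N (i + j) := by
  induction ht using deg_induction with
  | add s t _ _ hs ht => rw [map_add]; exact add_mem hs ht
  | tmul θ hθ m => rw [lmul_tmul]; exact tmul_mem (Forms.mul_mem hη hθ) m

lemma diff_mem {k : ℕ} {t : dR A L N} (ht : t ∈ deg A L N k) : diff c t ∈ deg A L N (k + 1) := by
  induction ht using deg_induction with
  | add s t _ _ hs ht => rw [map_add]; exact add_mem hs ht
  | tmul η hη m =>
    rw [diff_tmul_eq]
    refine add_mem (tmul_mem (Forms.d_mem hη) m) ?_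
    refine lmul_mem ?_ (diff_one_tmul_mem c m)
    rw [Forms.parity_of_mem hη]
    exact Submodule.smul_mem _ _ hη

omit [LieRingModule L A] [LieRinehartRing A L] in
-- The Euler operator tensored with the identity of `N` multiplies degree `k + 1` by `k + 1`, and it
-- factors through the contractions.
lemma eq_zero_of_contract (hd : (Forms.dualBasis A L).IsDual) {k : ℕ} {t : dR A L N}
    (ht : t ∈ deg A L N (k + 1))
    (h : ∀ x, LinearMap.rTensor N (Forms.contract x) t = 0) : t = 0 := by
  have h1 : LinearMap.rTensor N (Forms.euler A L) t = (k + 1) • t := by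
    clear h
    induction ht using deg_induction with
    | add s t _ _ hs ht => rw [map_add, hs, ht, smul_add]
    | tmul η hη m =>
      rw [LinearMap.rTensor_tmul, Forms.euler_of_mem hd hη, ← Nat.cast_smul_eq_nsmul A,
        ← Nat.cast_smul_eq_nsmul A, TensorProduct.smul_tmul']
  refine eq_zero_of_nsmul_eq_zero (A := A) (k := k) ?_
  rw [← h1, Forms.euler]
  have h2 : ∀ s : Finset (Fin (Forms.dualBasis A L).card), LinearMap.rTensor N
      (∑ i ∈ s, LinearMap.mulLeft A (ExteriorAlgebra.ι A (Forms.coframe A L i)) ∘ₗ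
        Forms.contract (Forms.frame A L i)) t = 0 := fun s => by
    classical
    induction s using Finset.induction_on with
    | empty => simp
    | insert i s hi ih =>
      rw [Finset.sum_insert hi, LinearMap.rTensor_add, LinearMap.add_apply, ih,
        LinearMap.rTensor_comp, LinearMap.comp_apply, h, map_zero, add_zero]
  exact h2 _

omit [Algebra ℝ A] [LieRingModule L A] [LieRinehartRing A L] in
lemma contract_mem (x : L) {k : ℕ} {t : dR A L N} (ht : t ∈ deg A L N (k + 1)) :
    LinearMap.rTensor N (Forms.contract x) t ∈ deg A L N k := by
  induction ht using deg_induction with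
  | add s t _ _ hs ht => rw [map_add]; exact add_mem hs ht
  | tmul η hη m => exact tmul_mem (Forms.contract_mem x hη) m

omit [Algebra ℝ A] [LieRingModule L A] [LieRinehartRing A L] in
lemma contract_lmul_ι (x : L) (α : Module.Dual A L) (t : dR A L N) :
    LinearMap.rTensor N (Forms.contract x) (lmul N (ExteriorAlgebra.ι A α) t) =
      α x • t - lmul N (ExteriorAlgebra.ι A α) (LinearMap.rTensor N (Forms.contract x) t) := by
  induction t using TensorProduct.induction_on with
  | zero => simp
  | add s t hs ht => simp only [map_add, hs, ht, smul_add]; abel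
  | tmul η m =>
    rw [lmul_tmul, LinearMap.rTensor_tmul, Forms.contract_ι_mul, TensorProduct.sub_tmul,
      TensorProduct.smul_tmul']
    rfl

/-- The double contraction is the curvature `∇_x ∇_y m - ∇_y ∇_x m - ∇_{[x, y]} m`, written out in
the dual basis. -/
lemma contract_contract_diff_diff_one (hd : (Forms.dualBasis A L).IsDual) (x y : L) (m : N) :
    LinearMap.rTensor N (Forms.contract y) (LinearMap.rTensor N (Forms.contract x)
      (diff c (diff c (1 ⊗ₜ m)))) = 0 := by
  have h1 : ∀ (α : Module.Dual A L) (n : N), LinearMap.rTensor N (Forms.contract y)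
      (LinearMap.rTensor N (Forms.contract x) (diff c (ExteriorAlgebra.ι A α ⊗ₜ n))) =
      1 ⊗ₜ ((⁅x, α y⁆ - ⁅y, α x⁆ - α ⁅x, y⁆) • n - α x • c.nabla y n + α y • c.nabla x n) := by
    intro α n
    rw [diff_tmul_eq, Forms.parity_ι, Forms.d_ι]
    rw [lmul_neg_left, map_add, map_neg, contract_lmul_ι, rTensor_contract_diff_one c hd, map_add, map_neg,
      map_sub, map_smul, rTensor_contract_diff_one c hd, lmul_tmul, LinearMap.rTensor_tmul,
      LinearMap.rTensor_tmul, LinearMap.rTensor_tmul, Forms.contract_contract_dOne hd, mul_one,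
      Forms.contract_ι, Algebra.algebraMap_eq_smul_one, Algebra.algebraMap_eq_smul_one,
      TensorProduct.smul_tmul, TensorProduct.smul_tmul, ← TensorProduct.tmul_smul,
      ← TensorProduct.tmul_sub, ← TensorProduct.tmul_neg, ← TensorProduct.tmul_add]
    congr 1
    abel
  -- Expanding `v` in the frame before differentiating produces the derivatives of the coefficients
  -- that occur in `dβ_i(x, y)`.
  have h2 : ∀ u v, c.nabla u (c.nabla v m) = ∑ i, Forms.coframe A L i v •
      c.nabla u (c.nabla (Forms.frame A L i) m) +
        ∑ i, ⁅u, Forms.coframe A L i v⁆ • c.nabla (Forms.frame A L i) m := by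
    intro u v
    rw [← sum_coframe_smul_nabla c hd v, map_sum, ← Finset.sum_add_distrib]
    simp only [c.leibniz]
  rw [diff_one_tmul, map_sum, map_sum, map_sum]
  simp only [h1]
  rw [← TensorProduct.tmul_sum]
  simp only [Finset.sum_add_distrib, Finset.sum_sub_distrib, sub_smul]
  have h3 := c.flat x y m
  rw [h2, h2, ← sum_coframe_smul_nabla c hd] at h3
  rw [h3]
  refine (congrArg _ ?_).trans (TensorProduct.tmul_zero _ _)
  abel

lemma diff_diff_one (hd : (Forms.dualBasis A L).IsDual) (m : N) :
    diff c (diff c (1 ⊗ₜ m)) = 0 := by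
  have hm := diff_mem c (diff_one_tmul_mem c m)
  exact eq_zero_of_contract hd hm fun x => eq_zero_of_contract hd (contract_mem x hm) fun y =>
    contract_contract_diff_diff_one c hd x y m

lemma diff_diff (hd : (Forms.dualBasis A L).IsDual) (t : dR A L N) : diff c (diff c t) = 0 := by
  induction t using TensorProduct.induction_on with
  | zero => simp
  | add s t hs ht => rw [map_add, map_add, hs, ht, add_zero]
  | tmul η m =>
    rw [diff_tmul_eq, map_add, diff_lmul, diff_diff_one c hd, map_zero, add_zero,
      diff_tmul_eq c (Forms.d η), Forms.d_d hd, TensorProduct.zero_tmul, zero_add, Forms.d_parity,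
      lmul_neg_left, add_neg_cancel]

end Differential

/-! ### Compatibility of the differential with the action of `dR_L(J_L)`. -/

section Leibniz

variable {A L : Type*} [CommRing A] [Algebra ℝ A] [LieRing L] [Module A L] [LieRingModule L A]
  [LieRinehartRing A L] {N : Type*} [AddCommGroup N] [Module A N] [Module (Jet A L) N]
  [IsScalarTower A (Jet A L) N] {c : FlatConn A L N}

omit [Algebra ℝ A] in
lemma rmul_lmul (η : Forms A L) (t : dR A L N) (r : dR A L (Jet A L)) :
    rmul A L N (lmul N η t) r = lmul N η (rmul A L N t r) := by
  induction t using TensorProduct.induction_on with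
  | zero => simp
  | add s t hs ht => simp only [map_add, LinearMap.add_apply, hs, ht]
  | tmul θ m =>
    induction r using TensorProduct.induction_on with
    | zero => simp
    | add r r' hr hr' => simp only [map_add, hr, hr']
    | tmul ξ φ => simp only [lmul_tmul, rmul_tmul, mul_assoc]

omit [Algebra ℝ A] in
lemma rmul_one_tmul_lmul (m : N) (η : Forms A L) (r : dR A L (Jet A L)) :
    rmul A L N (1 ⊗ₜ m) (lmul (Jet A L) η r) = lmul N η (rmul A L N (1 ⊗ₜ m) r) := by
  induction r using TensorProduct.induction_on with
  | zero => simp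
  | add r r' hr hr' => simp only [map_add, hr, hr']
  | tmul ξ φ => simp only [lmul_tmul, rmul_tmul, one_mul]

/-- The connections that are compatible with the canonical one of `J_L`. -/
def IsCompatible (c : FlatConn A L N) : Prop :=
  ∀ (x : L) (φ : Jet A L) (m : N),
    c.nabla x (φ • m) = (FlatConn.jet A L).nabla x φ • m + φ • c.nabla x m

lemma diff_one_tmul_smul (hc : IsCompatible c) (φ : Jet A L) (m : N) :
    diff c (1 ⊗ₜ (φ • m)) = rmul A L N (diff c (1 ⊗ₜ m)) (1 ⊗ₜ φ) +
      rmul A L N (1 ⊗ₜ m) (diff (FlatConn.jet A L) (1 ⊗ₜ φ)) := by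
  rw [diff_one_tmul, diff_one_tmul, diff_one_tmul, map_sum, map_sum, LinearMap.sum_apply,
    ← Finset.sum_add_distrib]
  refine Finset.sum_congr rfl fun i _ => ?_
  rw [rmul_tmul, rmul_tmul, hc, TensorProduct.tmul_add, mul_one, one_mul, add_comm]

/-- The differential of `1 ⊗ m` has degree one in the forms, so moving `η` to the left of it costs
the sign `(-1)^{|η|}`. -/
lemma lmul_rmul_diff_one (η : Forms A L) (φ : Jet A L) (m : N) :
    rmul A L N (diff c (1 ⊗ₜ m)) (η ⊗ₜ φ) =
      lmul N (Forms.parity η) (rmul A L N (diff c (1 ⊗ₜ m)) (1 ⊗ₜ φ)) := by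
  rw [diff_one_tmul, map_sum, LinearMap.sum_apply, LinearMap.sum_apply, map_sum]
  refine Finset.sum_congr rfl fun i _ => ?_
  rw [rmul_tmul, rmul_tmul, lmul_tmul, Forms.ι_mul_eq, mul_one]

omit [Algebra ℝ A] [LieRingModule L A] [LieRinehartRing A L] [Module (Jet A L) N]
  [IsScalarTower A (Jet A L) N] in
lemma parity_lmul (η : Forms A L) (t : dR A L N) :
    parity A L N (lmul N η t) = lmul N (Forms.parity η) (parity A L N t) := by
  induction t using TensorProduct.induction_on with
  | zero => simp
  | add s t hs ht => simp only [map_add, hs, ht]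
  | tmul θ m =>
    change Forms.parity (η * θ) ⊗ₜ m = (Forms.parity η * Forms.parity θ) ⊗ₜ[A] m
    rw [map_mul]

/-- Left multiplication by forms commutes with the right action, which reduces to `t = 1 ⊗ m`; there
the rule is compatibility of the connections together with the sign of `lmul_rmul_diff_one`. -/
lemma diff_rmul (hc : IsCompatible c) (t : dR A L N) (r : dR A L (Jet A L)) :
    diff c (rmul A L N t r) = rmul A L N (diff c t) r +
      rmul A L N (parity A L N t) (diff (FlatConn.jet A L) r) := by
  have h1 : ∀ (m : N), diff c (rmul A L N (1 ⊗ₜ m) r) = rmul A L N (diff c (1 ⊗ₜ m)) r +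
      rmul A L N (1 ⊗ₜ m) (diff (FlatConn.jet A L) r) := by
    intro m
    induction r using TensorProduct.induction_on with
    | zero => simp
    | add r r' hr hr' => simp only [map_add, hr, hr']; abel
    | tmul η φ =>
      rw [rmul_tmul, one_mul, diff_tmul_eq, diff_one_tmul_smul hc, lmul_rmul_diff_one η φ m,
        diff_tmul_eq _ η φ, map_add, map_add, rmul_one_tmul_lmul, rmul_tmul, one_mul]
      abel
  induction t using TensorProduct.induction_on with
  | zero => simp
  | add s t hs ht => simp only [map_add, LinearMap.add_apply, hs, ht]; abel
  | tmul η m =>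
    have h2 : η ⊗ₜ m = lmul N η (1 ⊗ₜ[A] m) := by rw [lmul_tmul, mul_one]
    have h3 : parity A L N (1 ⊗ₜ m) = 1 ⊗ₜ m := by
      rw [parity, LinearMap.rTensor_tmul, AlgHom.toLinearMap_apply, map_one]
    rw [h2, rmul_lmul, diff_lmul, h1, diff_lmul, parity_lmul, h3, rmul_lmul, map_add, map_add,
      LinearMap.add_apply, rmul_lmul, rmul_lmul, add_assoc]

theorem isDGModule (hd : (Forms.dualBasis A L).IsDual) (hc : IsCompatible c) :
    IsDGModule (deg A L (Jet A L)) (diff (FlatConn.jet A L)) (rmul A L N) (deg A L N)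
      (diff c) where
  act_one := rmul_one
  act_mul := rmul_mul
  decomp := isInternal_deg
  act_mem := rmul_mem
  d_mem := diff_mem c
  d_d := diff_diff c hd
  d_act hm := by
    rw [diff_rmul hc, parity_of_mem_deg A L N hm, map_smul, LinearMap.smul_apply]

omit [Algebra ℝ A] in
lemma isCompatible_jet : IsCompatible (FlatConn.jet A L) := fun x φ ψ => FlatConn.jet_mul x φ ψ

theorem isCDGA (hd : (Forms.dualBasis A L).IsDual) :
    IsCDGA (deg A L (Jet A L)) (diff (FlatConn.jet A L)) where
  decomp := isInternal_deg
  one_mem := one_mem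
  mul_mem hr hs := by rw [← rmul_eq_mul]; exact rmul_mem hr hs
  mul_comm := mul_comm_of_mem
  d_mem := diff_mem _
  d_d := diff_diff _ hd
  d_mul hr := by
    rw [← rmul_eq_mul, ← rmul_eq_mul, ← rmul_eq_mul]
    exact (isDGModule hd isCompatible_jet).d_act hr

variable {E : Type*} [AddCommGroup E] [Module A E]

omit [Algebra ℝ A] in
lemma isCompatible_jetHol : IsCompatible (FlatConn.jetHol A L E) := by
  intro x φ t
  induction t using JetHol.induction with
  | add s t hs ht => simp only [smul_add, map_add, hs, ht]; abel
  | tmul ψ e =>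
    rw [JetHol.smul_tmul]
    change JetHol.tmul ((FlatConn.jet A L).nabla x (φ * ψ)) e =
      JetHol.tmul ((FlatConn.jet A L).nabla x φ * ψ) e +
        JetHol.tmul (φ * (FlatConn.jet A L).nabla x ψ) e
    rw [FlatConn.jet_mul, JetHol.add_tmul]

omit [Algebra ℝ A] in
-- Elements of `L` are primitive: the coproduct of `x D` is `x ⊗ 1 + 1 ⊗ x` applied to that of `D`,
-- which matches the two terms of the Leibniz rule of the connection on `E`.
lemma isCompatible_jetHom (c : FlatConn A L E) : IsCompatible c.jetHom := by
  intro x φ ψ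
  ext D
  change c.nabla x ((φ • ψ) D) - (φ • ψ) (UEnv.inL A L x * D) =
    ((FlatConn.jet A L).nabla x φ • ψ) D + (φ • c.jetHom.nabla x ψ) D
  simp only [JetHom.smul_def, JetHom.conv_apply, UEnv.comul_inL_mul]
  generalize (Coalgebra.comul D : UEnv A L ⊗[A] UEnv A L) = t
  induction t with
  | zero => simp
  | add s t hs ht =>
    simp only [map_add] at hs ht ⊢
    rw [add_sub_add_comm, hs, ht]; abel
  | tmul m n =>
    have h : ∀ m, (FlatConn.mulLeft A L).nabla x m = UEnv.inL A L x * m := fun _ => rfl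
    have h1 : c.jetHom.nabla x ψ n = c.nabla x (ψ n) - ψ (UEnv.inL A L x * n) := rfl
    simp only [FlatConn.tensor_nabla_tmul, map_add, TensorProduct.map_tmul,
      TensorProduct.lid_tmul, FlatConn.jet_apply, c.leibniz, h, h1, smul_sub, sub_smul]
    abel

end Leibniz

end dR

lemma Forms.dualBasis_isDual_of_exists {A L : Type*} [CommRing A] [LieRing L] [Module A L]
    (h : ∃ F : Forms.Family A L, F.IsDual) : (Forms.dualBasis A L).IsDual := by
  rw [Forms.dualBasis, dif_pos h]
  exact h.choose_spec

end LieAlgd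

/-! ### The main theorem. -/

open LieAlgd
open scoped Manifold ContDiff
theorem mainTheorem6 {n : ℕ} {X : Type*} [TopologicalSpace X] [T2Space X]
    [SecondCountableTopology X] [ChartedSpace (EuclideanSpace ℝ (Fin n)) X] [IsManifold (𝓡 n) ∞ X]
    (F_L : Type*) [NormedAddCommGroup F_L] [NormedSpace ℝ F_L] [FiniteDimensional ℝ F_L]
    (L : X → Type*) [TopologicalSpace (Bundle.TotalSpace F_L L)] [∀ x, TopologicalSpace (L x)]
    [∀ x, AddCommGroup (L x)] [∀ x, Module ℝ (L x)] [FiberBundle F_L L] [VectorBundle ℝ F_L L]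
    [ContMDiffVectorBundle ∞ F_L L (𝓡 n)] [LieAlgebroid n F_L L]
    (F_E : Type*) [NormedAddCommGroup F_E] [NormedSpace ℝ F_E] [FiniteDimensional ℝ F_E]
    (E : X → Type*) [TopologicalSpace (Bundle.TotalSpace F_E E)] [∀ x, TopologicalSpace (E x)]
    [∀ x, AddCommGroup (E x)] [∀ x, Module ℝ (E x)] [FiberBundle F_E E] [VectorBundle ℝ F_E E]
    [ContMDiffVectorBundle ∞ F_E E (𝓡 n)] :
    let A := SmoothFun n X
    let 𝓛 := Sections n F_L L
    let 𝓔 := Sections n F_E E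
    let dJ := dR.diff (FlatConn.jet A 𝓛)
    -- `dR_L(J_L)` is a commutative dg algebra for the de Rham differential
    (IsCEDifferential (Forms.d (A := A) (L := 𝓛)) ∧ IsDeRhamDifferential (FlatConn.jet A 𝓛) dJ ∧
      IsCDGA (dR.deg A 𝓛 (Jet A 𝓛)) dJ) ∧
    -- `dR_L` of the jets with values in `E` is a dg module over it
    (IsDeRhamDifferential (FlatConn.jetHol A 𝓛 𝓔) (dR.diff (FlatConn.jetHol A 𝓛 𝓔)) ∧
      IsDGModule (dR.deg A 𝓛 (Jet A 𝓛)) dJ (dR.rmul A 𝓛 (JetHol A 𝓛 𝓔))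
        (dR.deg A 𝓛 (JetHol A 𝓛 𝓔)) (dR.diff (FlatConn.jetHol A 𝓛 𝓔))) ∧
    (∀ c : FlatConn A 𝓛 𝓔, IsDeRhamDifferential c.jetHom (dR.diff c.jetHom) ∧
      IsDGModule (dR.deg A 𝓛 (Jet A 𝓛)) dJ (dR.rmul A 𝓛 (JetHom A 𝓛 𝓔))
        (dR.deg A 𝓛 (JetHom A 𝓛 𝓔)) (dR.diff c.jetHom)) ∧
    -- splittings exist, and each of them gives the flat connection `1 ⊗ d_dR`
    ∀ (S : Subalgebra A (Forms A 𝓛)) (hS : ∀ η ∈ S, Forms.parity η ∈ S),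
      SplittingGivesFlatConnection (drAlg S hS) (JetHol.proj A 𝓛 𝓔) ∧
      SplittingGivesFlatConnection (drAlg S hS) (JetHom.proj A 𝓛 𝓔) := by
  intro A 𝓛 𝓔 dJ
  -- The operators on forms are defined through a chosen family, so existence of some dual basis of
  -- `Γ(X, L)` is needed to exclude the empty default.
  have hd : (Forms.dualBasis A 𝓛).IsDual := by
    obtain ⟨m, b, β, h⟩ := exists_sections_dualBasis n F_L L
    exact Forms.dualBasis_isDual_of_exists ⟨⟨m, b, β⟩, h⟩
  -- The dual basis of `Γ(X, E)` serves twice: it makes `E` finite projective over `A`, and it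
  -- induces dual bases over `J_L` of both jet modules.
  obtain ⟨m, b, β, h⟩ := exists_sections_dualBasis n F_E E
  have := finite_of_dualBasis h
  have := projective_of_dualBasis h
  refine ⟨⟨Forms.isCEDifferential hd, dR.isDeRhamDifferential _ hd, dR.isCDGA hd⟩,
    ⟨dR.isDeRhamDifferential _ hd, dR.isDGModule hd dR.isCompatible_jetHol⟩,
    fun c => ⟨dR.isDeRhamDifferential _ hd, dR.isDGModule hd (dR.isCompatible_jetHom c)⟩,
    fun S hS => ⟨(JetHol.isJetFibre h).splittingGivesFlatConnection _,
      (JetHom.isJetFibre h).splittingGivesFlatConnection _⟩⟩
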